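/- Let $G$ be a (finite or infinite) directed graph with bounded in- and out-degrees (at most one edge $e_{ij}$ from $i$ to $j$; loops allowed; an undirected graph is viewed as a symmetric digraph), with edge weights in a commutative ring $K$ (all equal to $1$ in the unweighted case). Let $\mathsf A$ be the weighted adjacency matrix and $\mathsf W$ the labelled one: $\mathsf A_{ij}$ is the weight of $e_{ij}$ and $\mathsf W_{ij}=e_{ij}$ if this edge exists, and both are $0$ otherwise. A *prime* (self-avoiding polygon, simple cycle) is a nonempty cyclic sequence of distinct vertices, consecutive ones being joined by edges; orientation matters, the starting point does not. *Hikes* are words in the primes modulo commutation of vertex-disjoint primes; they are multiplied by concatenation. A hike $w$ is a *closed walk whose last erased loop is $p$*, written $p\,|_r\,w$, if $p$ is the unique prime $q$ such that $w=w'q$ for some hike $w'$. The length $\ell(w)$ of a hike is its number of edges and its weight $\mathrm{wt}(w)$ the product of the weights of its edges, both counted with multiplicity. Fix a prime $p$ with vertex set $\mathcal V(p)$. Let $G_p$ be the finite set of the vertices of $p$ and of all their in- and out-neighbours. Let $\mathsf B_p$ (respectively $\mathsf W_p$) be the matrix indexed by $G_p$ whose $(i,j)$ entry is $\mathsf A_{ij}$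 (respectively $\mathsf W_{ij}$) if $i\in\mathcal V(p)$ or $j\in\mathcal V(p)$, and $0$ otherwise; that is, the part of $\mathsf A$ (respectively $\mathsf W$) carried by the edges with at least one endpoint on $p$. (If all edges of the subgraph induced on $G_p$ have an endpoint on $p$, this is its adjacency matrix.) 1. Let $\mathsf R(z)=(\mathsf I-z\mathsf A)^{-1}\big|_{G_p}=\sum_{n\ge0}z^n\mathsf A^n\big|_{G_p}$ be the restriction to $G_p$ of the resolvent of $G$. For each $n$ there are finitely many closed walks of length $n$ whose last erased loop is $p$, and their ordinary generating function $R_p(z)=\sum_{w:\,p|_rw}\mathrm{wt}(w)\,z^{\ell(w)}$ is, in $K[[z]]$, $$R_p(z)=\mathrm{wt}(p)\,z^{\ell(p)}\det\big(\mathsf I+z\,\mathsf R(z)\,\mathsf B_p\big).$$ In particular $R_p(z)=z^{\ell(p)}\det(\mathsf I+z\mathsf R(z)\mathsf B_p)$ for unweighted graphs. 2. For every vertex $v$ of $p$, $R_p(z)$ is also the (weighted) generating function of the closed walks $v=x_0,x_1,\dots,x_n=v$ based at $v$ for which the last loop erased by chronological (Lawler) loop erasure is $p$; there are finitely many of each length.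 3. (Formal series.) Consider formal series with integer coefficients over the Cartier–Foata monoid generated by the symbols $e_{ij}$, in which $e_{ij}e_{kl}=e_{kl}e_{ij}$ for $i\neq k$; a hike is read in this monoid as the product of its edges. Each element is obtained from finitely many closed walks whose last erased loop is $p$. Let $\mathsf R=(\mathsf I-\mathsf W)^{-1}\big|_{G_p}=\sum_{n\ge0}\mathsf W^n\big|_{G_p}$. For every ordering of $G_p$, $$\sum_{w:\,p|_rw}w=\det\big(\mathsf I+\mathsf R\,\mathsf W_p\big)\,p,$$ where the determinant of a matrix $\mathsf X$ with non-commuting entries, indexed by $1,\dots,m$ through the ordering, is the column-ordered one, $\det\mathsf X=\sum_{\sigma\in S_m}\operatorname{sgn}(\sigma)\,\mathsf X_{\sigma(1)1}\mathsf X_{\sigma(2)2}\cdots\mathsf X_{\sigma(m)m}$. -/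

import Mathlib

/-! ## Partially commutative (Cartier–Foata) monoids and their formal series -/

/-- The Cartier–Foata (trace) monoid on the alphabet `α`: words modulo the commutations
`a b = b a` for all letters with `I a b`. -/
abbrev TraceMonoid (α : Type*) (I : α → α → Prop) : Type _ :=
  PresentedMonoid (fun x y : FreeMonoid α =>
    ∃ a b, I a b ∧ x = FreeMonoid.of a * FreeMonoid.of b ∧ y = FreeMonoid.of b * FreeMonoid.of a)

namespace TraceMonoid

variable {α : Type*} {I : α → α → Prop}

/-- A letter, seen in the monoid. -/
def of (I : α → α → Prop) (a : α) : TraceMonoid α I := PresentedMonoid.of _ a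

theorem of_mul_of {a b : α} (h : I a b) : of I a * of I b = of I b * of I a :=
  PresentedMonoid.mk_eq_mk_of_rel ⟨a, b, h, rfl, rfl⟩

/-- The morphism determined by a map on letters that respects the commutations. -/
def lift {M : Type*} [Monoid M] (f : α → M) (hf : ∀ a b, I a b → f a * f b = f b * f a) :
    TraceMonoid α I →* M :=
  PresentedMonoid.lift f (by
    rintro _ _ ⟨a, b, h, rfl, rfl⟩
    simpa using hf a b h)

/-- The multiset of letters of an element. -/
def content : TraceMonoid α I →* Multiplicative (Multiset α) :=
  lift (fun a => Multiplicative.ofAdd {a}) (fun _ _ _ => mul_comm _ _)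

theorem content_mk (l : FreeMonoid α) :
    content (PresentedMonoid.mk _ l : TraceMonoid α I) =
      Multiplicative.ofAdd (l.toList : Multiset α) := by
  induction l using FreeMonoid.inductionOn' with
  | one => rw [map_one, map_one]; rfl
  | of_mul x l ih =>
    rw [map_mul, map_mul, ih]
    rfl

theorem finite_content_eq (m : Multiset α) :
    {t : TraceMonoid α I | (content t).toAdd = m}.Finite := by
  induction m using Quotient.inductionOn with
  | h l₀ =>
    refine ((List.finite_toSet l₀.permutations).image
      (fun l => (PresentedMonoid.mk _ (FreeMonoid.ofList l) : TraceMonoid α I))).subset ?_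
    intro t ht
    induction t using PresentedMonoid.inductionOn with
    | h w =>
      refine ⟨w.toList, ?_, rfl⟩
      have h1 : ((w.toList : Multiset α)) = (l₀ : Multiset α) := by
        rw [← show _ = ((w.toList : Multiset α)) from congrArg Multiplicative.toAdd
          (content_mk (I := I) w)]
        exact ht
      exact List.mem_permutations.2 (Multiset.coe_eq_coe.1 h1)

/-- An element has finitely many factorisations into two factors. -/
theorem finite_factorizations (t : TraceMonoid α I) :
    {x : TraceMonoid α I × TraceMonoid α I | x.1 * x.2 = t}.Finite := by
  classical
  have hS : {u : TraceMonoid α I | (content u).toAdd ≤ (content t).toAdd}.Finite := by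
    have : {u : TraceMonoid α I | (content u).toAdd ≤ (content t).toAdd} =
        ⋃ m ∈ Set.Iic (content t).toAdd, {u : TraceMonoid α I | (content u).toAdd = m} := by
      ext u; simp
    rw [this]
    exact (Set.finite_Iic _).biUnion fun m _ => finite_content_eq m
  refine (hS.prod hS).subset ?_
  rintro ⟨u, v⟩ h
  have h' : u * v = t := h
  subst h'
  refine ⟨?_, ?_⟩
  · change _ ≤ (content (u * v)).toAdd
    rw [map_mul]; exact Multiset.le_add_right _ _
  · change _ ≤ (content (u * v)).toAdd
    rw [map_mul]; exact Multiset.le_add_left _ _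

/-- All pairs `(u, v)` with `u * v = t`. -/
noncomputable def factorizations (t : TraceMonoid α I) :
    Finset (TraceMonoid α I × TraceMonoid α I) :=
  (finite_factorizations t).toFinset

@[simp]
theorem mem_factorizations {t : TraceMonoid α I} {x : TraceMonoid α I × TraceMonoid α I} :
    x ∈ factorizations t ↔ x.1 * x.2 = t := by
  simp [factorizations]

theorem eq_one_of_mul_eq_one {u v : TraceMonoid α I} (h : u * v = 1) : u = 1 := by
  have h1 : (content u).toAdd + (content v).toAdd = 0 := by
    have := congrArg (fun t => (content t).toAdd) h
    simpa using this
  have h2 : (content u).toAdd = 0 := (add_eq_zero.1 h1).1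
  induction u using PresentedMonoid.inductionOn with
  | h w =>
    rw [content_mk] at h2
    have h3 : w.toList = [] := by simpa using h2
    have h4 : w = 1 := h3
    rw [h4, map_one]

end TraceMonoid

/-- Formal series `∑ f(t) t` with integer coefficients over a Cartier–Foata monoid. -/
def TraceSeries (α : Type*) (I : α → α → Prop) : Type _ := TraceMonoid α I → ℤ

namespace TraceSeries

open TraceMonoid

variable {α : Type*} {I : α → α → Prop}

instance : AddCommGroup (TraceSeries α I) :=
  inferInstanceAs (AddCommGroup (TraceMonoid α I → ℤ))

/-- The series consisting of the single monomial `t`. -/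
noncomputable def single (t : TraceMonoid α I) : TraceSeries α I :=
  open Classical in fun s => if s = t then 1 else 0

noncomputable instance : One (TraceSeries α I) := ⟨single 1⟩

/-- The Cauchy product. -/
noncomputable instance : Mul (TraceSeries α I) :=
  ⟨fun f g => (fun t => ∑ x ∈ factorizations t, f x.1 * g x.2 : TraceMonoid α I → ℤ)⟩

theorem mul_apply (f g : TraceSeries α I) (t : TraceMonoid α I) :
    (f * g) t = ∑ x ∈ factorizations t, f x.1 * g x.2 := rfl

theorem add_apply (f g : TraceSeries α I) (t : TraceMonoid α I) : (f + g) t = f t + g t := rfl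

theorem zero_apply (t : TraceMonoid α I) : (0 : TraceSeries α I) t = 0 := rfl

theorem one_apply [DecidableEq (TraceMonoid α I)] (t : TraceMonoid α I) :
    (1 : TraceSeries α I) t = if t = 1 then 1 else 0 := by
  change single 1 t = _
  unfold single
  split_ifs <;> rfl

noncomputable instance : Ring (TraceSeries α I) :=
  { (inferInstance : AddCommGroup (TraceSeries α I)),
    (inferInstance : One (TraceSeries α I)), (inferInstance : Mul (TraceSeries α I)) with
    left_distrib := fun f g h => by
      funext t
      simp only [add_apply, mul_apply, mul_add, Finset.sum_add_distrib]
    right_distrib := fun f g h => by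
      funext t
      simp only [add_apply, mul_apply, add_mul, Finset.sum_add_distrib]
    zero_mul := fun f => by
      funext t
      simp [mul_apply, zero_apply]
    mul_zero := fun f => by
      funext t
      simp [mul_apply, zero_apply]
    one_mul := fun f => by
      classical
      funext t
      rw [mul_apply, Finset.sum_eq_single ((1 : TraceMonoid α I), t)]
      · simp [one_apply]
      · rintro ⟨u, v⟩ hx hne
        have hu : u ≠ 1 := by
          rintro rfl
          have hv : 1 * v = t := mem_factorizations.1 hx
          rw [one_mul] at hv
          exact hne (by rw [hv])
        simp [one_apply, hu]
      · intro h
        exact absurd (mem_factorizations.2 (one_mul t)) h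
    mul_one := fun f => by
      classical
      funext t
      rw [mul_apply, Finset.sum_eq_single (t, (1 : TraceMonoid α I))]
      · simp [one_apply]
      · rintro ⟨u, v⟩ hx hne
        have hu : v ≠ 1 := by
          rintro rfl
          have hv : u * 1 = t := mem_factorizations.1 hx
          rw [mul_one] at hv
          exact hne (by rw [hv])
        simp [one_apply, hu]
      · intro h
        exact absurd (mem_factorizations.2 (mul_one t)) h
    mul_assoc := fun f g h => by
      funext t
      simp only [mul_apply, Finset.sum_mul, Finset.mul_sum]
      rw [Finset.sum_sigma', Finset.sum_sigma']
      refine Finset.sum_bij' (fun x _ => ⟨(x.2.1, x.2.2 * x.1.2), (x.2.2, x.1.2)⟩)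
        (fun x _ => ⟨(x.1.1 * x.2.1, x.2.2), (x.1.1, x.2.1)⟩) ?_ ?_ ?_ ?_ ?_
      · rintro ⟨⟨u, v⟩, ⟨a, b⟩⟩ hx
        simp only [Finset.mem_sigma, mem_factorizations] at hx ⊢
        obtain ⟨h1, h2⟩ := hx
        exact ⟨by rw [← mul_assoc, h2, h1], trivial⟩
      · rintro ⟨⟨u, v⟩, ⟨a, b⟩⟩ hx
        simp only [Finset.mem_sigma, mem_factorizations] at hx ⊢
        obtain ⟨h1, h2⟩ := hx
        exact ⟨by rw [mul_assoc, h2, h1], trivial⟩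
      · rintro ⟨⟨u, v⟩, ⟨a, b⟩⟩ hx
        simp only [Finset.mem_sigma, mem_factorizations] at hx
        obtain ⟨h1, h2⟩ := hx
        subst h2
        rfl
      · rintro ⟨⟨u, v⟩, ⟨a, b⟩⟩ hx
        simp only [Finset.mem_sigma, mem_factorizations] at hx
        obtain ⟨h1, h2⟩ := hx
        subst h2
        rfl
      · rintro ⟨⟨u, v⟩, ⟨a, b⟩⟩ _
        exact mul_assoc _ _ _ }

end TraceSeries

/-! ## Simple cycles, hikes and closed walks -/

section Graphs

variable {V : Type*}

/-- Both the out-degrees and the in-degrees are bounded by a common constant. -/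
def BoundedDegree (G : Digraph V) : Prop :=
  ∃ D : ℕ, ∀ v : V, {u | G.Adj v u}.encard ≤ D ∧ {u | G.Adj u v}.encard ≤ D

/-- Simple cycles (self-avoiding polygons, primes) of `G`: nonempty cyclic sequences of distinct
vertices, consecutive ones (cyclically) being joined by an edge. The starting point is irrelevant,
the orientation is not; loops and back-and-forth edges are cycles of length 1 and 2. -/
def SimpleCycle (G : Digraph V) : Type _ :=
  {c : Cycle V // c ≠ Cycle.nil ∧ c.Nodup ∧ c.Chain G.Adj}

/-- The multiset of the directed edges of a cyclic sequence of vertices. -/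
def cycleEdges (c : Cycle V) : Multiset (V × V) :=
  Quotient.liftOn c (fun l => (List.zipWith Prod.mk l (l.rotate 1) : Multiset (V × V))) (by
    rintro l _ ⟨n, rfl⟩
    refine Multiset.coe_eq_coe.2 ?_
    have h : List.zipWith Prod.mk (l.rotate n) ((l.rotate n).rotate 1) =
        (List.zipWith Prod.mk l (l.rotate 1)).rotate n := by
      rw [List.zipWith_rotate_distrib _ _ _ _ (by simp), List.rotate_rotate, List.rotate_rotate,
        Nat.add_comm]
    rw [h]
    exact (List.rotate_perm _ _).symm)

theorem cycleEdges_fst (c : Cycle V) : (cycleEdges c).map Prod.fst = c.toMultiset := by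
  induction c using Quotient.inductionOn with
  | h l =>
    change ((List.zipWith Prod.mk l (l.rotate 1) : Multiset (V × V))).map Prod.fst = (l : Multiset V)
    rw [Multiset.map_coe, Multiset.coe_eq_coe, ← List.zip, List.map_fst_zip (by simp)]

/-- The two simple cycles have no vertex in common. -/
def SimpleCycle.Disjoint {G : Digraph V} (c d : SimpleCycle G) : Prop :=
  ∀ v, v ∈ c.1 → v ∉ d.1

/-- Hikes on `G`: words in the simple cycles, where vertex-disjoint cycles commute. -/
abbrev Hike (G : Digraph V) : Type _ := TraceMonoid (SimpleCycle G) SimpleCycle.Disjoint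

/-- The Cartier–Foata monoid on the labels `e_ij` of the directed edges, in which two edges commute
iff they have different starting points. -/
abbrev EdgeMonoid (V : Type*) : Type _ :=
  TraceMonoid (V × V) (fun e f => e.1 ≠ f.1)

/-- Formal series over the edge monoid. -/
abbrev EdgeSeries (V : Type*) : Type _ :=
  TraceSeries (V × V) (fun e f => e.1 ≠ f.1)

variable {G : Digraph V}

/-- `p` divides the hike `h` on the right. -/
def SimpleCycle.RightDvd (p : SimpleCycle G) (h : Hike G) : Prop :=
  ∃ h' : Hike G, h = h' * TraceMonoid.of _ p

/-- The hike `h` is a closed walk whose last erased loop is `p`, that is, `p` is its unique right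
prime divisor. -/
def Hike.IsWalkWithLast (p : SimpleCycle G) (h : Hike G) : Prop :=
  p.RightDvd h ∧ ∀ q : SimpleCycle G, q.RightDvd h → q = p

/-- The length (number of edges) of a hike. -/
def Hike.length (h : Hike G) : ℕ :=
  (TraceMonoid.lift (fun c : SimpleCycle G => Multiplicative.ofAdd c.1.length)
    (fun _ _ _ => mul_comm _ _) h).toAdd

/-- The weight of a simple cycle: the product of the weights of its edges. -/
def SimpleCycle.weight {K : Type*} [CommRing K] (wt : V → V → K) (c : SimpleCycle G) : K :=
  ((cycleEdges c.1).map fun e => wt e.1 e.2).prod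

/-- The weight of a hike: the product of the weights of its edges. -/
def Hike.weight {K : Type*} [CommRing K] (wt : V → V → K) (h : Hike G) : K :=
  TraceMonoid.lift (fun c : SimpleCycle G => c.weight wt) (fun _ _ _ => mul_comm _ _) h

theorem SimpleCycle.edges_commute (c : SimpleCycle G) :
    {x | x ∈ (cycleEdges c.1).map
      (TraceMonoid.of (fun e f : V × V => e.1 ≠ f.1))}.Pairwise Commute := by
  intro x hx y hy hxy
  obtain ⟨e, he, rfl⟩ := Multiset.mem_map.1 hx
  obtain ⟨f, hf, rfl⟩ := Multiset.mem_map.1 hy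
  by_cases h : e.1 = f.1
  · exfalso
    have hn : ((cycleEdges c.1).map Prod.fst).Nodup := by
      rw [cycleEdges_fst]
      obtain ⟨c, h1, h2, h3⟩ := c
      induction c using Quotient.inductionOn with
      | h l => exact h2
    have hef : e = f := Multiset.inj_on_of_nodup_map hn e he f hf h
    exact hxy (by rw [hef])
  · exact TraceMonoid.of_mul_of h

/-- A simple cycle as an element of the edge monoid: the product of its edges (which commute with
one another). -/
noncomputable def SimpleCycle.toEdges (c : SimpleCycle G) : EdgeMonoid V :=
  ((cycleEdges c.1).map (TraceMonoid.of (fun e f : V × V => e.1 ≠ f.1))).noncommProd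
    c.edges_commute

theorem SimpleCycle.toEdges_comm (c d : SimpleCycle G) (h : c.Disjoint d) :
    c.toEdges * d.toEdges = d.toEdges * c.toEdges := by
  have hv : ∀ (c : SimpleCycle G) (e : V × V), e ∈ cycleEdges c.1 → e.1 ∈ c.1 := by
    intro c e he
    have h1 : e.1 ∈ c.1.toMultiset := by
      rw [← cycleEdges_fst]; exact Multiset.mem_map_of_mem _ he
    obtain ⟨c, h1', h2, h3⟩ := c
    induction c using Quotient.inductionOn with
    | h l => exact h1
  refine Multiset.noncommProd_commute _ _ _ fun x hx => ?_
  refine (Multiset.noncommProd_commute _ _ _ fun y hy => ?_).symm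
  obtain ⟨f, hf, rfl⟩ := Multiset.mem_map.1 hx
  obtain ⟨e, he, rfl⟩ := Multiset.mem_map.1 hy
  exact TraceMonoid.of_mul_of fun hef => h e.1 (hv c e he) (by rw [← hef]; exact hv d f hf)

/-- A hike as an element of the edge monoid. -/
noncomputable def Hike.toEdges : Hike G →* EdgeMonoid V :=
  TraceMonoid.lift SimpleCycle.toEdges SimpleCycle.toEdges_comm

/-- The vertices of `G_p`: those of `p`, their out-neighbours and their in-neighbours. -/
def closedNbhd (p : SimpleCycle G) : Set V :=
  {v | v ∈ p.1 ∨ ∃ u ∈ p.1, G.Adj u v ∨ G.Adj v u}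

theorem closedNbhd_finite (hG : BoundedDegree G) (p : SimpleCycle G) :
    (closedNbhd p).Finite := by
  classical
  obtain ⟨D, hD⟩ := hG
  have hp : {v | v ∈ p.1}.Finite := by
    obtain ⟨c, h1, h2, h3⟩ := p
    induction c using Quotient.inductionOn with
    | h l => exact List.finite_toSet l
  have hfin : ∀ s : Set V, s.encard ≤ D → s.Finite := fun s hs =>
    Set.finite_of_encard_le_coe hs
  refine (hp.union (hp.biUnion (t := fun u => {v | G.Adj u v} ∪ {v | G.Adj v u}) fun u _ =>
    (hfin _ (hD u).1).union (hfin _ (hD u).2))).subset ?_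
  rintro v (hv | ⟨u, hu, huv⟩)
  · exact Or.inl hv
  · exact Or.inr (Set.mem_biUnion (x := u) hu huv)

/-- The (finite) vertex set of `G_p`. -/
noncomputable def gpVerts (hG : BoundedDegree G) (p : SimpleCycle G) : Finset V :=
  (closedNbhd_finite hG p).toFinset

/-! ## Matrices and generating functions -/

/-- Powers of a possibly infinite, row-finite matrix. -/
noncomputable def matPow {S : Type*} [Semiring S] (A : V → V → S) : ℕ → V → V → S
  | 0 => open Classical in fun i j => if i = j then 1 else 0
  | n + 1 => fun i j => ∑ᶠ k, A i k * matPow A n k j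

/-- The matrix with entry `a i j` for each edge from `i` to `j` and zeros elsewhere. -/
noncomputable def edgeMatrix (G : Digraph V) {S : Type*} [Zero S] (a : V → V → S) : V → V → S :=
  open Classical in fun i j => if G.Adj i j then a i j else 0

/-- The resolvent `(I - z A)⁻¹ = ∑ zⁿ Aⁿ` as a matrix of power series. -/
noncomputable def resolventGF {K : Type*} [CommRing K] (A : V → V → K) (i j : V) : PowerSeries K :=
  PowerSeries.mk fun n => matPow A n i j

/-- The labelled adjacency matrix `W`, with entries `W_ij = e_ij`. -/
noncomputable def labelledMatrix (G : Digraph V) : V → V → EdgeSeries V :=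
  edgeMatrix G fun i j => TraceSeries.single (TraceMonoid.of _ (i, j))

/-- The formal resolvent `(I - W)⁻¹ = ∑ Wⁿ` (each monomial occurs in one power of `W` only). -/
noncomputable def formalResolvent (G : Digraph V) (i j : V) : EdgeSeries V :=
  (fun t => ∑ᶠ n, matPow (labelledMatrix G) n i j t : EdgeMonoid V → ℤ)

/-- The restriction of a matrix to a finite set of vertices. -/
def restrictTo {S : Type*} (s : Finset V) (A : V → V → S) : Matrix s s S := fun i j => A i j

/-- The part `A - A_{G∖p}` of a matrix that is carried by the edges with at least one endpoint
on `p`. -/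
noncomputable def touching {S : Type*} [Zero S] (p : SimpleCycle G) (A : V → V → S) : V → V → S :=
  open Classical in fun i j => if i ∈ p.1 ∨ j ∈ p.1 then A i j else 0

/-- The determinant of a matrix with entries in a ring that need not be commutative, with the
factors of each term in the order of the columns. -/
def colDet {S : Type*} [Ring S] {n : ℕ} (M : Matrix (Fin n) (Fin n) S) : S :=
  ∑ σ : Equiv.Perm (Fin n), (Equiv.Perm.sign σ : ℤ) • (List.ofFn fun j => M (σ j) j).prod

/-- The ordinary generating function `∑ weight(w) z^ℓ(w)` of the closed walks `w` (as hikes) whose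
last erased loop is `p`. -/
noncomputable def walkGF {K : Type*} [CommRing K] (wt : V → V → K) (p : SimpleCycle G) :
    PowerSeries K :=
  PowerSeries.mk fun n =>
    ∑ᶠ (h : Hike G) (_ : h.IsWalkWithLast p ∧ h.length = n), h.weight wt

/-- The formal series `∑ w` of the closed walks whose last erased loop is `p`. -/
noncomputable def walkSeries (p : SimpleCycle G) : EdgeSeries V :=
  (fun t => ({h : Hike G | h.IsWalkWithLast p ∧ Hike.toEdges h = t}.ncard : ℤ) : EdgeMonoid V → ℤ)

/-! ## Chronological loop erasure -/

/-- One step of chronological loop erasure. The state consists of the current self-avoiding path,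
latest vertex first, and of the last loop erased so far. When the walk moves to a vertex `y` of the
path, the loop closed at `y` is erased. -/
def eraseStep [DecidableEq V] (s : List V × Option (Cycle V)) (y : V) :
    List V × Option (Cycle V) :=
  if y ∈ s.1 then
    (s.1.dropWhile (fun x => x ≠ y),
      some (((s.1.takeWhile (fun x => x ≠ y) ++ [y]).reverse : List V) : Cycle V))
  else (y :: s.1, s.2)

/-- The last loop erased by chronological loop erasure from the sequence of vertices of a walk. -/
def lastErasedLoop [DecidableEq V] : List V → Option (Cycle V)
  | [] => none
  | x :: l => (l.foldl eraseStep ([x], none)).2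

/-- Closed walks `x₀ = v, x₁, …, x_n = v` of length `n` on `G` based at `v` from which
chronological loop erasure erases `p` last. -/
def rootedWalks [DecidableEq V] (p : SimpleCycle G) (v : V) (n : ℕ) : Set (List V) :=
  {l | l.length = n + 1 ∧ l.head? = some v ∧ l.getLast? = some v ∧ l.IsChain G.Adj ∧
    lastErasedLoop l = some p.1}

/-- The ordinary generating function of the closed walks based at `v` whose last erased loop
is `p`. -/
noncomputable def rootedWalkGF [DecidableEq V] {K : Type*} [CommRing K] (wt : V → V → K)
    (p : SimpleCycle G) (v : V) : PowerSeries K :=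
  PowerSeries.mk fun n => ∑ᶠ l ∈ rootedWalks p v n, (List.zipWith wt l l.tail).prod

end Graphs

/-! ## Cancellation and Levi's lemma in trace monoids -/

namespace TraceMonoid

variable {α : Type*} {I : α → α → Prop}

/-! The formal identity of part 3 carries the determinant formula of part 1: sending `e_ij` to its
weight times `z` is a ring morphism on the series with finitely many terms of each length
(`evalHom`), and it turns the column determinant into the ordinary one. Both the series of closed
walks and the determinant side are computed as the same product (`loopProd`), `∏ R_k(v_k, v_k)`,
times `p` for the former. Here the `v_k` are the vertices of `p` in any order and `R_k` is the
resolvent of the graph from which `v_1, …, v_{k-1}` have been removed.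

Combinatorial side. An element of the edge monoid acts as a pile of successive exits over each
vertex (`row`). Every hike factors as the hike of a closed walk based at `v` times a hike avoiding
`v`, uniquely: starting at `v`, always take the first unused exit. Each loop closed on the way
divides what remains of the hike on the left (`Hike.left_dvd_of_rows`), and the walk can only get
stuck at `v`, because a hike leaves each vertex as often as it enters it (`exists_eraseHike_mul`,
`eq_of_mul_closedWalk`). This gives the faithfulness of the edge representation
(`Hike.toEdges_injective`) and the rooted version in part 2 (`bijOn_eraseHike`). A hike `h p` has
`p` as its only right prime divisor iff every right prime divisor of `h` meets `p`
(`isWalkWithLast_mul_iff`); peeling off closed walks at the vertices of `p` one after the other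
yields the product (`walkSeries_eq_loopProd`).

Algebraic side. Entries of `W` in different rows commute. Hence the columns of the inverse `R` of `I
- W`, viewed as linear forms in Grassmann variables, anticommute (`wedgeCoeff_add_swap`), and an
entry of row `k` placed after column `k` can be moved past another column (`wedgeCoeff_mul`). The
column determinant is the top coefficient of the product of the columns
(`Grassmann.topCoeff_prod_column`). Column `v` of `I + R W_p` is column `v` of `R` when `v` is on
`p`, and otherwise the variable of `v` plus a combination of the columns of `R` indexed by `p`. All
these anticommute (`psiMat_anticomm`), so the columns of `p` can be put first, where they annihilate
the combinations. By `exists_resolvent_sub`, each column of `R` may then be replaced by that of the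
graph without the preceding vertices, of which only the diagonal entry survives (`mul_prod_psiRes`).
-/

theorem induction_left {C : TraceMonoid α I → Prop} (one : C 1)
    (of_mul : ∀ a t, C t → C (of I a * t)) (t : TraceMonoid α I) : C t := by
  induction t using PresentedMonoid.inductionOn with
  | h w =>
    induction w using FreeMonoid.inductionOn' with
    | one => rw [map_one]; exact one
    | of_mul x l ih => rw [map_mul]; exact of_mul x _ ih

theorem induction_right {C : TraceMonoid α I → Prop} (one : C 1)
    (mul_of : ∀ t a, C t → C (t * of I a)) (t : TraceMonoid α I) : C t := by
  induction t using PresentedMonoid.inductionOn with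
  | h w =>
    obtain ⟨l, rfl⟩ := FreeMonoid.ofList.surjective w
    induction l using List.reverseRecOn with
    | nil => exact one
    | append_singleton l x ih =>
      rw [FreeMonoid.ofList_append, map_mul]; exact mul_of _ x ih

@[simp]
theorem lift_of {M : Type*} [Monoid M] (f : α → M) (hf : ∀ a b, I a b → f a * f b = f b * f a)
    (a : α) : lift f hf (of I a) = f a := by
  simp [lift, of]

/-- Removing the letter `q` on the right of a product, if possible, letter by letter: the state
consists of the product and of the result of the removal. -/
noncomputable def stripStep (I : α → α → Prop) (q a : α) :
    Function.End (TraceMonoid α I × Option (TraceMonoid α I)) :=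
  open Classical in fun s =>
    -- Appending `q` itself makes the old product the quotient; a letter commuting with `q` is
    -- appended to the quotient; any other letter blocks access to `q`.
    (s.1 * of I a, if a = q then some s.1 else if I a q then s.2.map (· * of I a) else none)

/-- This makes removal well defined on words modulo commutation. Irreflexivity ensures that two
commuting letters are not both `q`; symmetry is needed when the first one is `q`. -/
theorem stripStep_comm (hs : ∀ a b, I a b → I b a) (hi : ∀ a, ¬ I a a) (q : α) {a b : α}
    (h : I a b) (s : TraceMonoid α I × Option (TraceMonoid α I)) :
    stripStep I q b (stripStep I q a s) = stripStep I q a (stripStep I q b s) := by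
  classical
  have hab : a ≠ b := by rintro rfl; exact hi a h
  have hc : ∀ x : TraceMonoid α I, x * of I a * of I b = x * of I b * of I a := fun x => by
    rw [mul_assoc, of_mul_of h, mul_assoc]
  obtain ⟨x, o⟩ := s
  refine Prod.ext (hc x) ?_
  by_cases ha : a = q
  · subst ha
    simp [stripStep, hab.symm, hs _ _ h]
  · by_cases hb : b = q
    · subst hb
      simp [stripStep, hab, h]
    · by_cases h1 : I a q <;> by_cases h2 : I b q <;> simp [stripStep, ha, hb, h1, h2]
      congr 1
      funext y
      rw [← mul_assoc, hc y, mul_assoc]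

/-- The action of the trace monoid by removals. -/
noncomputable def strip (hs : ∀ a b, I a b → I b a) (hi : ∀ a, ¬ I a a) (q : α) :
    TraceMonoid α I →*
      (Function.End (TraceMonoid α I × Option (TraceMonoid α I)))ᵐᵒᵖ :=
  lift (fun a => MulOpposite.op (stripStep I q a)) (fun a b h => by
    exact congrArg MulOpposite.op (funext fun s => stripStep_comm hs hi q h s))

/-- The quotient of `t` by the letter `q` on the right, if `q` divides `t`. -/
noncomputable def rightQuot (hs : ∀ a b, I a b → I b a) (hi : ∀ a, ¬ I a a) (q : α)
    (t : TraceMonoid α I) : Option (TraceMonoid α I) :=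
  ((strip hs hi q t).unop (1, none)).2

section

variable (hs : ∀ a b, I a b → I b a) (hi : ∀ a, ¬ I a a)
include hs hi

theorem strip_fst (q : α) (t : TraceMonoid α I) : ((strip hs hi q t).unop (1, none)).1 = t := by
  induction t using induction_right with
  | one => rw [map_one]; rfl
  | mul_of t a ih =>
    rw [map_mul]
    have : strip hs hi q (of I a) = MulOpposite.op (stripStep I q a) := lift_of _ _ a
    rw [this]
    change ((strip hs hi q t).unop (1, none)).1 * _ = _
    rw [ih]

open Classical in
theorem rightQuot_mul_of (q a : α) (t : TraceMonoid α I) :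
    rightQuot hs hi q (t * of I a) =
      if a = q then some t else if I a q then (rightQuot hs hi q t).map (· * of I a) else none := by
  have : strip hs hi q (of I a) = MulOpposite.op (stripStep I q a) := lift_of _ _ a
  rw [rightQuot, map_mul, this]
  change (stripStep I q a ((strip hs hi q t).unop (1, none))).2 = _
  simp only [stripStep, strip_fst, rightQuot]

theorem rightQuot_mul_self (q : α) (t : TraceMonoid α I) :
    rightQuot hs hi q (t * of I q) = some t := by
  rw [rightQuot_mul_of, if_pos rfl]

theorem eq_mul_of_rightQuot_eq (q : α) (t u : TraceMonoid α I)
    (h : rightQuot hs hi q t = some u) : t = u * of I q := by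
  classical
  induction t using induction_right generalizing u with
  | one => rw [rightQuot, map_one] at h; cases h
  | mul_of t a ih =>
    rw [rightQuot_mul_of] at h
    split_ifs at h with h1 h2
    · rw [Option.some.inj h, h1]
    · obtain ⟨w, hw, rfl⟩ := Option.map_eq_some_iff.1 h
      rw [ih w hw, mul_assoc, mul_assoc, of_mul_of h2]

theorem mul_of_cancel {q : α} {t u : TraceMonoid α I} (h : t * of I q = u * of I q) : t = u := by
  have := congrArg (rightQuot hs hi q) h
  rw [rightQuot_mul_self, rightQuot_mul_self] at this
  exact Option.some.inj this

theorem mul_right_cancel' {t u w : TraceMonoid α I} (h : t * w = u * w) : t = u := by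
  induction w using induction_right with
  | one => simpa using h
  | mul_of w a ih =>
    rw [← mul_assoc, ← mul_assoc] at h
    exact ih (mul_of_cancel hs hi h)

/-- Take the quotient by `q` on both sides: on the right it exists, so on the left the computation
must have gone through the commuting branch. -/
theorem levi {p q : α} {t u : TraceMonoid α I} (h : t * of I p = u * of I q) (hpq : p ≠ q) :
    I p q ∧ ∃ g, t = g * of I q := by
  classical
  have := congrArg (rightQuot hs hi q) h
  rw [rightQuot_mul_self, rightQuot_mul_of, if_neg hpq] at this
  split_ifs at this with h1
  obtain ⟨g, hg, -⟩ := Option.map_eq_some_iff.1 this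
  exact ⟨h1, g, eq_mul_of_rightQuot_eq hs hi q t g hg⟩

/-- A letter dividing a product on the right divides one of the factors on the right. -/
theorem right_divisor_mul {q : α} {a b : TraceMonoid α I} (h : ∃ g, a * b = g * of I q) :
    (∃ g, b = g * of I q) ∨ ∃ g, a = g * of I q := by
  induction b using induction_right with
  | one => right; simpa using h
  | mul_of b c ih =>
    obtain ⟨g, hg⟩ := h
    by_cases hc : c = q
    · left; exact ⟨b, by rw [hc]⟩
    · rw [← mul_assoc] at hg
      obtain ⟨h1, h2⟩ := levi hs hi hg hc
      rcases ih h2 with ⟨g', rfl⟩ | h3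
      · left
        exact ⟨g' * of I c, by rw [mul_assoc, mul_assoc, of_mul_of h1]⟩
      · exact Or.inr h3

end

/-- Reversal of words. -/
noncomputable def reverse (I : α → α → Prop) : TraceMonoid α I →* (TraceMonoid α I)ᵐᵒᵖ :=
  lift (fun a => MulOpposite.op (of I a)) (fun a b h => by
    rw [← MulOpposite.op_mul, ← MulOpposite.op_mul, of_mul_of h])

theorem reverse_reverse (t : TraceMonoid α I) :
    (reverse I (reverse I t).unop).unop = t := by
  induction t using induction_left with
  | one => simp
  | of_mul a t ih => simp [reverse] at ih ⊢; rw [ih]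

/-- Reversal exchanges the two sides and is an involution. -/
theorem mul_left_cancel' (hs : ∀ a b, I a b → I b a) (hi : ∀ a, ¬ I a a)
    {t u w : TraceMonoid α I} (h : w * t = w * u) : t = u := by
  have := congrArg (fun x => (reverse I x).unop) h
  simp only [map_mul, MulOpposite.unop_mul] at this
  have := mul_right_cancel' hs hi this
  rw [← reverse_reverse t, this, reverse_reverse]

end TraceMonoid

/-! ## The edge monoid: rows, lengths and walks -/

theorem FreeMonoid.of_mul_inj {α : Type*} {x y : α} {s t : FreeMonoid α}
    (h : FreeMonoid.of x * s = FreeMonoid.of y * t) : x = y ∧ s = t :=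
  List.cons.inj h

theorem FreeMonoid.of_mul_ne_one {α : Type*} {x : α} {s : FreeMonoid α} :
    FreeMonoid.of x * s ≠ 1 :=
  List.cons_ne_nil _ _

namespace EdgeMonoid

variable {V : Type*}

/-- The generator `e_ij`. -/
def edge (i j : V) : EdgeMonoid V := TraceMonoid.of _ (i, j)

theorem mul_right_cancel {t u w : EdgeMonoid V} (h : t * w = u * w) : t = u :=
  TraceMonoid.mul_right_cancel' (fun _ _ h => h.symm) (fun _ h => h rfl) h

theorem mul_left_cancel {t u w : EdgeMonoid V} (h : w * t = w * u) : t = u :=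
  TraceMonoid.mul_left_cancel' (fun _ _ h => h.symm) (fun _ h => h rfl) h

theorem edge_comm {i j k l : V} (h : i ≠ k) : edge i j * edge k l = edge k l * edge i j :=
  TraceMonoid.of_mul_of h

/-- The number of edges of an element. -/
def len (t : EdgeMonoid V) : ℕ := Multiset.card (TraceMonoid.content t).toAdd

@[simp] theorem len_one : len (1 : EdgeMonoid V) = 0 := by simp [len]

@[simp] theorem len_mul (s t : EdgeMonoid V) : len (s * t) = len s + len t := by simp [len]

@[simp] theorem content_edge (i j : V) :
    (TraceMonoid.content (edge i j)).toAdd = {(i, j)} := by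
  rw [edge, TraceMonoid.content, TraceMonoid.lift_of]; rfl

@[simp] theorem len_edge (i j : V) : len (edge i j) = 1 := by
  rw [len, content_edge]; rfl

theorem eq_one_of_len_eq_zero {t : EdgeMonoid V} (h : len t = 0) : t = 1 := by
  induction t using TraceMonoid.induction_left with
  | one => rfl
  | of_mul a t _ =>
    change len (edge a.1 a.2 * t) = 0 at h
    simp at h

/-- The edges are those of a walk through the given vertices. -/
def edgeProd : List V → EdgeMonoid V
  | [] => 1
  | [_] => 1
  | x :: y :: l => edge x y * edgeProd (y :: l)

@[simp] theorem edgeProd_nil : edgeProd ([] : List V) = 1 := rfl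

@[simp] theorem edgeProd_singleton (x : V) : edgeProd [x] = 1 := rfl

@[simp] theorem edgeProd_cons_cons (x y : V) (l : List V) :
    edgeProd (x :: y :: l) = edge x y * edgeProd (y :: l) := rfl

theorem edgeProd_append (a : List V) (x : V) (b : List V) :
    edgeProd (a ++ x :: b) = edgeProd (a ++ [x]) * edgeProd (x :: b) := by
  induction a with
  | nil => simp
  | cons y a ih =>
    cases a with
    | nil => simp
    | cons z a =>
      simp only [List.cons_append, edgeProd_cons_cons] at ih ⊢
      rw [ih, mul_assoc]

theorem len_edgeProd (l : List V) : len (edgeProd l) = l.length - 1 := by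
  induction l with
  | nil => simp
  | cons x l ih =>
    cases l with
    | nil => simp
    | cons y l => simp at ih ⊢; omega

theorem content_edgeProd_fst (l : List V) :
    (TraceMonoid.content (edgeProd l)).toAdd.map Prod.fst = (l.dropLast : Multiset V) := by
  induction l with
  | nil => simp
  | cons x l ih =>
    cases l with
    | nil => simp
    | cons y l => simp at ih ⊢; simp [ih]

theorem content_edgeProd_snd (l : List V) :
    (TraceMonoid.content (edgeProd l)).toAdd.map Prod.snd = (l.tail : Multiset V) := by
  induction l with
  | nil => simp
  | cons x l ih =>
    cases l with
    | nil => simp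
    | cons y l => simp at ih ⊢; simp [ih]

/-! ### Rows: the successive exits from a vertex. -/

section Rows

variable [DecidableEq V]

/-- The sequence of the end points of the edges starting at `x`. -/
def row (x : V) : EdgeMonoid V →* FreeMonoid V :=
  TraceMonoid.lift (fun e => if e.1 = x then FreeMonoid.of e.2 else 1) (by
    intro a b h
    by_cases ha : a.1 = x
    · have hb : b.1 ≠ x := fun hb => h (ha.trans hb.symm)
      simp [hb]
    · simp [ha])

theorem row_edge (x i j : V) : row x (edge i j) = if i = x then FreeMonoid.of j else 1 :=
  TraceMonoid.lift_of _ _ _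

@[simp] theorem row_edge_self (x j : V) : row x (edge x j) = FreeMonoid.of j := by
  simp [row_edge]

theorem row_edge_of_ne {x i : V} (h : i ≠ x) (j : V) : row x (edge i j) = 1 := by
  simp [row_edge, h]

theorem row_edgeProd_of_notMem {x : V} {l : List V} (h : x ∉ l.dropLast) :
    row x (edgeProd l) = 1 := by
  induction l with
  | nil => simp
  | cons y l ih =>
    cases l with
    | nil => simp
    | cons z l =>
      simp only [List.dropLast_cons_cons, List.mem_cons, not_or] at h
      rw [edgeProd_cons_cons, map_mul, row_edge_of_ne (Ne.symm h.1), ih h.2, one_mul]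

/-- The first exit from `x` is preceded only by edges with other origins, with which it commutes, so
it can be brought to the front. -/
theorem eq_edge_mul_of_row {x y : V} {t : EdgeMonoid V} {w : FreeMonoid V}
    (h : row x t = FreeMonoid.of y * w) : ∃ t', t = edge x y * t' := by
  induction t using TraceMonoid.induction_left with
  | one => rw [map_one] at h; exact absurd h.symm FreeMonoid.of_mul_ne_one
  | of_mul a t ih =>
    obtain ⟨i, j⟩ := a
    change row x (edge i j * t) = _ at h
    change ∃ t', edge i j * t = _
    by_cases hi : i = x
    · subst hi
      rw [map_mul, row_edge_self] at h
      exact ⟨t, by rw [(FreeMonoid.of_mul_inj h).1]⟩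
    · rw [map_mul, row_edge_of_ne hi, one_mul] at h
      obtain ⟨t', rfl⟩ := ih h
      exact ⟨edge i j * t', by rw [← mul_assoc, edge_comm hi, mul_assoc]⟩

theorem row_eq_one_or (x : V) (t : EdgeMonoid V) :
    row x t = 1 ∨ ∃ y t', t = edge x y * t' := by
  rcases h : (row x t).toList with _ | ⟨y, w⟩
  · exact Or.inl h
  · right
    obtain ⟨t', ht⟩ := eq_edge_mul_of_row (x := x) (y := y) (t := t) (w := FreeMonoid.ofList w) h
    exact ⟨y, t', ht⟩

theorem row_eq_one_iff {x : V} {t : EdgeMonoid V} :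
    row x t = 1 ↔ x ∉ (TraceMonoid.content t).toAdd.map Prod.fst := by
  induction t using TraceMonoid.induction_left with
  | one => simp
  | of_mul a t ih =>
    obtain ⟨i, j⟩ := a
    change row x (edge i j * t) = 1 ↔ x ∉ (TraceMonoid.content (edge i j * t)).toAdd.map Prod.fst
    by_cases hi : i = x
    · subst hi
      rw [map_mul, map_mul, row_edge_self, toAdd_mul, content_edge]
      simp
    · rw [map_mul, map_mul, row_edge_of_ne hi, one_mul, toAdd_mul, content_edge, ih]
      simp [Ne.symm hi]

/-- Elements with nothing in the common rows commute. -/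
theorem edge_mul_comm_of_row {x : V} (y : V) {t : EdgeMonoid V} (h : row x t = 1) :
    edge x y * t = t * edge x y := by
  induction t using TraceMonoid.induction_left with
  | one => simp
  | of_mul a t ih =>
    obtain ⟨i, j⟩ := a
    change row x (edge i j * t) = _ at h
    change edge x y * (edge i j * t) = edge i j * t * _
    by_cases hi : i = x
    · subst hi
      rw [map_mul, row_edge_self] at h
      exact absurd h FreeMonoid.of_mul_ne_one
    · rw [map_mul, row_edge_of_ne hi, one_mul] at h
      rw [← mul_assoc, edge_comm (Ne.symm hi), mul_assoc, ih h, mul_assoc]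

theorem edgeProd_mul_comm {l : List V} {t : EdgeMonoid V} (h : ∀ x ∈ l.dropLast, row x t = 1) :
    edgeProd l * t = t * edgeProd l := by
  induction l with
  | nil => simp
  | cons x l ih =>
    cases l with
    | nil => simp
    | cons y l =>
      simp only [List.dropLast_cons_cons, List.mem_cons, forall_eq_or_imp] at h
      rw [edgeProd_cons_cons, mul_assoc, ih h.2, ← mul_assoc, edge_mul_comm_of_row y h.1,
        mul_assoc]

/-- A walk is determined by its starting point and its edges. -/
theorem edgeProd_injective {x : V} {a b : List V}
    (h : edgeProd (x :: a) = edgeProd (x :: b)) : a = b := by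
  induction a generalizing x b with
  | nil =>
    cases b with
    | nil => rfl
    | cons y b =>
      have := congrArg len h
      simp [len_edgeProd] at this
      omega
  | cons y a ih =>
    cases b with
    | nil =>
      have := congrArg len h
      simp [len_edgeProd] at this
    | cons z b =>
      have h1 := congrArg (row x) h
      simp only [edgeProd_cons_cons, map_mul, row_edge_self] at h1
      obtain rfl := (FreeMonoid.of_mul_inj h1).1
      rw [ih (mul_left_cancel h)]

/-- A walk ending at `v` is determined by its starting point and by its product with something
that contains no edge starting at `v`. -/
theorem edgeProd_mul_injective {v x : V} {a b : List V} {t u : EdgeMonoid V}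
    (ha : (x :: a).getLast? = some v) (hb : (x :: b).getLast? = some v)
    (ht : row v t = 1) (hu : row v u = 1)
    (h : edgeProd (x :: a) * t = edgeProd (x :: b) * u) : a = b ∧ t = u := by
  induction a generalizing x b with
  | nil =>
    obtain rfl : x = v := by simpa using ha
    cases b with
    | nil => simpa using h
    | cons y b =>
      -- One walk has ended at `v` where the other goes on, so an empty row at `v` would equal a
      -- nonempty one.
      have h1 := congrArg (row x) h
      rw [edgeProd_cons_cons] at h1
      simp only [edgeProd_singleton, map_mul, row_edge_self, ht, one_mul, mul_assoc] at h1
      exact absurd h1.symm FreeMonoid.of_mul_ne_one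
  | cons y a ih =>
    cases b with
    | nil =>
      obtain rfl : x = v := by simpa using hb
      have h1 := congrArg (row x) h
      rw [edgeProd_cons_cons] at h1
      simp only [edgeProd_singleton, map_mul, row_edge_self, hu, one_mul, mul_assoc] at h1
      exact absurd h1 FreeMonoid.of_mul_ne_one
    | cons z b =>
      have h1 := congrArg (row x) h
      simp only [edgeProd_cons_cons, map_mul, row_edge_self, mul_assoc] at h1
      obtain rfl := (FreeMonoid.of_mul_inj h1).1
      rw [edgeProd_cons_cons, edgeProd_cons_cons, mul_assoc, mul_assoc] at h
      obtain ⟨h2, h3⟩ := ih (by simpa using ha) (by simpa using hb) (mul_left_cancel h)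
      exact ⟨by rw [h2], h3⟩

end Rows

end EdgeMonoid

/-! ## Simple cycles and hikes in the edge monoid -/

open EdgeMonoid

namespace SimpleCycle

variable {V : Type*} {G : Digraph V}

theorem exists_rep (c : SimpleCycle G) {x : V} (hx : x ∈ c.1) :
    ∃ a : List V, c.1 = ((x :: a : List V) : Cycle V) ∧ (x :: a).Nodup ∧
      (x :: (a ++ [x])).IsChain G.Adj := by
  obtain ⟨c, h1, h2, h3⟩ := c
  induction c using Quotient.inductionOn with
  | h l =>
    obtain ⟨n, hn⟩ : ∃ n, ∃ a, l.rotate n = x :: a := by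
      obtain ⟨s, t, rfl⟩ := List.append_of_mem (show x ∈ l from hx)
      exact ⟨s.length, t ++ s, by rw [List.rotate_append_length_eq]; rfl⟩
    obtain ⟨a, ha⟩ := hn
    have hl : ((l : List V) : Cycle V) = ((x :: a : List V) : Cycle V) :=
      Cycle.coe_eq_coe.2 ⟨n, ha⟩
    refine ⟨a, hl, ?_, ?_⟩
    · have h2' : Cycle.Nodup ((l : List V) : Cycle V) := h2
      rw [hl] at h2'
      exact h2'
    · have h3' : Cycle.Chain G.Adj ((l : List V) : Cycle V) := h3
      rw [hl] at h3'
      exact Cycle.chain_coe_cons _ _ _ |>.1 h3'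

theorem exists_mem (c : SimpleCycle G) : ∃ x, x ∈ c.1 := by
  obtain ⟨c, h1, h2, h3⟩ := c
  induction c using Quotient.inductionOn with
  | h l =>
    cases l with
    | nil => exact absurd rfl h1
    | cons x l => exact ⟨x, List.mem_cons_self⟩

theorem disjoint_symm (c d : SimpleCycle G) (h : c.Disjoint d) : d.Disjoint c :=
  fun v hd hc => h v hc hd

theorem disjoint_irrefl (c : SimpleCycle G) : ¬ c.Disjoint c := fun h =>
  let ⟨x, hx⟩ := c.exists_mem
  h x hx hx

theorem prod_zip_eq_edgeProd (x z : V) (a : List V) :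
    ((List.zipWith Prod.mk (x :: a) (a ++ [z])).map
      (TraceMonoid.of (fun e f : V × V => e.1 ≠ f.1))).prod = edgeProd (x :: (a ++ [z])) := by
  induction a generalizing x with
  | nil => simp [edge]
  | cons y a ih =>
    have := ih y
    simp only [List.cons_append, List.zipWith_cons_cons, List.map_cons, List.prod_cons,
      edgeProd_cons_cons] at this ⊢
    rw [this]; rfl

theorem cycleEdges_coe_cons (x : V) (a : List V) :
    cycleEdges ((x :: a : List V) : Cycle V) =
      (List.zipWith Prod.mk (x :: a) (a ++ [x]) : Multiset (V × V)) := by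
  change ((List.zipWith Prod.mk (x :: a) ((x :: a).rotate 1) : List (V × V)) :
    Multiset (V × V)) = _
  simp

theorem toEdges_eq (c : SimpleCycle G) {x : V} {a : List V}
    (h : c.1 = ((x :: a : List V) : Cycle V)) : c.toEdges = edgeProd (x :: (a ++ [x])) := by
  -- The multiset is generalised because the commutation proof stored in `noncommProd` depends on
  -- it.
  have key : ∀ (m : Multiset (V × V)) (hm : m =
      (List.zipWith Prod.mk (x :: a) (a ++ [x]) : Multiset (V × V)))
      (hc : {y | y ∈ m.map (TraceMonoid.of (fun e f : V × V => e.1 ≠ f.1))}.Pairwise Commute),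
      (m.map (TraceMonoid.of (fun e f : V × V => e.1 ≠ f.1))).noncommProd hc =
        edgeProd (x :: (a ++ [x])) := by
    rintro _ rfl hc
    rw [← prod_zip_eq_edgeProd]
    exact Multiset.noncommProd_coe _ _
  exact key _ (by rw [h, cycleEdges_coe_cons]) _

theorem content_toEdges (c : SimpleCycle G) :
    (TraceMonoid.content c.toEdges).toAdd = cycleEdges c.1 := by
  obtain ⟨x, hx⟩ := c.exists_mem
  obtain ⟨a, h1, -, -⟩ := c.exists_rep hx
  rw [c.toEdges_eq h1, h1, cycleEdges_coe_cons]
  clear h1 hx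
  -- The closing vertex is separated from the starting vertex, so that the induction can move the
  -- start alone.
  generalize hz : x = z
  nth_rw 1 3 [← hz]
  clear hz
  induction a generalizing x with
  | nil => simp
  | cons y a ih => simp at ih ⊢; rw [ih]; rfl

section

variable [DecidableEq V]

theorem row_toEdges_of_notMem (c : SimpleCycle G) {x : V} (hx : x ∉ c.1) :
    row x c.toEdges = 1 := by
  rw [row_eq_one_iff, content_toEdges, cycleEdges_fst]
  intro h
  apply hx
  obtain ⟨c, h1, h2, h3⟩ := c
  induction c using Quotient.inductionOn with
  | h l => exact h

theorem row_toEdges_of_mem (c : SimpleCycle G) {x : V} (hx : x ∈ c.1) :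
    ∃ y, row x c.toEdges = FreeMonoid.of y := by
  obtain ⟨a, h1, h2, -⟩ := c.exists_rep hx
  rw [c.toEdges_eq h1]
  cases a with
  | nil => exact ⟨x, by simp⟩
  | cons y a =>
    refine ⟨y, ?_⟩
    rw [List.cons_append, edgeProd_cons_cons, map_mul, row_edge_self, row_edgeProd_of_notMem,
      mul_one]
    rw [← List.cons_append, List.dropLast_concat]
    exact (List.nodup_cons.1 h2).1

theorem row_toEdges_eq_one_iff (c : SimpleCycle G) {x : V} : row x c.toEdges = 1 ↔ x ∉ c.1 := by
  refine ⟨fun h hx => ?_, c.row_toEdges_of_notMem⟩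
  obtain ⟨y, hy⟩ := c.row_toEdges_of_mem hx
  rw [hy] at h
  exact absurd h (FreeMonoid.of_ne_one y)

/-- Follow both lists in parallel: the next vertex is read off the row of the current one. Since `x`
occurs in neither list, both return to it at the same time. -/
theorem eq_of_rows_agree_aux {x u : V} {a b : List V} (ha : (u :: a).Nodup) (hb : (u :: b).Nodup)
    (hxa : x ∉ a) (hxb : x ∉ b)
    (h : ∀ z ∈ u :: a, z ∈ u :: b →
      row z (edgeProd (u :: (a ++ [x]))) = row z (edgeProd (u :: (b ++ [x])))) : a = b := by
  induction a generalizing u b with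
  | nil =>
    cases b with
    | nil => rfl
    | cons y b =>
      have := h u (by simp) (by simp)
      simp only [List.nil_append, List.cons_append, edgeProd_cons_cons, map_mul,
        row_edge_self] at this
      exact absurd (FreeMonoid.of_mul_inj this).1 (fun h => hxb (by simp [h]))
  | cons y a ih =>
    cases b with
    | nil =>
      have := h u (by simp) (by simp)
      simp only [List.nil_append, List.cons_append, edgeProd_cons_cons, map_mul,
        row_edge_self] at this
      exact absurd (FreeMonoid.of_mul_inj this).1 (fun h => hxa (by simp [h]))
    | cons z b =>
      have h0 := h u (by simp) (by simp)
      simp only [List.cons_append, edgeProd_cons_cons, map_mul, row_edge_self] at h0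
      obtain rfl := (FreeMonoid.of_mul_inj h0).1
      congr 1
      refine ih (List.nodup_cons.1 ha).2 (List.nodup_cons.1 hb).2
        (fun h => hxa (List.mem_cons_of_mem _ h)) (fun h => hxb (List.mem_cons_of_mem _ h)) ?_
      intro w hw1 hw2
      have hwu : u ≠ w := by rintro rfl; exact (List.nodup_cons.1 ha).1 hw1
      have := h w (List.mem_cons_of_mem _ hw1) (List.mem_cons_of_mem _ hw2)
      simpa only [List.cons_append, edgeProd_cons_cons, map_mul, row_edge_of_ne hwu,
        one_mul] using this

/-- Two intersecting simple cycles with the same successors at all common vertices are equal. -/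
theorem eq_of_rows_agree {c d : SimpleCycle G} {x : V} (hc : x ∈ c.1) (hd : x ∈ d.1)
    (h : ∀ z ∈ c.1, z ∈ d.1 → row z c.toEdges = row z d.toEdges) : c = d := by
  obtain ⟨a, ha, hna, -⟩ := c.exists_rep hc
  obtain ⟨b, hb, hnb, -⟩ := d.exists_rep hd
  rw [c.toEdges_eq ha, d.toEdges_eq hb] at h
  have := eq_of_rows_agree_aux (x := x) hna hnb (List.nodup_cons.1 hna).1
    (List.nodup_cons.1 hnb).1 (fun z h1 h2 => h z (by rw [ha]; exact h1) (by rw [hb]; exact h2))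
  subst this
  exact Subtype.ext (ha.trans hb.symm)

end

end SimpleCycle

/-! ### Hikes read in the edge monoid: balance and left divisibility. -/

namespace Hike

variable {V : Type*} {G : Digraph V}

@[simp] theorem toEdges_of (c : SimpleCycle G) :
    Hike.toEdges (TraceMonoid.of _ c : Hike G) = c.toEdges :=
  TraceMonoid.lift_of _ _ _

/-- A cycle leaves each of its vertices as often as it enters it. This balance is what forces a walk
consuming the edges of a hike to end where it started. -/
theorem content_toEdges_fst (h : Hike G) :
    (TraceMonoid.content (Hike.toEdges h)).toAdd.map Prod.fst =
      (TraceMonoid.content (Hike.toEdges h)).toAdd.map Prod.snd := by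
  induction h using TraceMonoid.induction_left with
  | one => simp
  | of_mul c h ih =>
    rw [map_mul, map_mul, toAdd_mul, Multiset.map_add, Multiset.map_add, ih, toEdges_of]
    congr 1
    obtain ⟨x, hx⟩ := c.exists_mem
    obtain ⟨a, h1, -, -⟩ := c.exists_rep hx
    rw [c.toEdges_eq h1, content_edgeProd_fst, content_edgeProd_snd]
    rw [← List.cons_append, List.dropLast_concat]
    exact Multiset.coe_eq_coe.2 (List.perm_append_singleton x a).symm

variable [DecidableEq V]

/-- A simple cycle lying on top of the rows of a hike divides it on the left. -/
theorem left_dvd_of_rows (c : SimpleCycle G) (h : Hike G)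
    (hc : ∀ x ∈ c.1, ∃ w, row x (Hike.toEdges h) = row x c.toEdges * w) :
    ∃ h' : Hike G, h = TraceMonoid.of _ c * h' := by
  induction h using TraceMonoid.induction_left with
  | one =>
    obtain ⟨x, hx⟩ := c.exists_mem
    obtain ⟨w, hw⟩ := hc x hx
    obtain ⟨y, hy⟩ := c.row_toEdges_of_mem hx
    rw [map_one, map_one, hy] at hw
    exact absurd hw.symm FreeMonoid.of_mul_ne_one
  | of_mul d h ih =>
    -- A first factor `d` disjoint from `c` leaves the rows of `c` untouched and commutes with it.
    -- Otherwise, at each common vertex the top of the pile is the exit of both `c` and `d`, which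
    -- makes them equal.
    by_cases hcd : c.Disjoint d
    · obtain ⟨h', rfl⟩ := ih (fun x hx => by
        obtain ⟨w, hw⟩ := hc x hx
        rw [map_mul, map_mul, toEdges_of, d.row_toEdges_of_notMem (hcd x hx), one_mul] at hw
        exact ⟨w, hw⟩)
      exact ⟨TraceMonoid.of _ d * h', by
        rw [← mul_assoc, ← mul_assoc, TraceMonoid.of_mul_of hcd]⟩
    · obtain ⟨x, hxc, hxd⟩ : ∃ x, x ∈ c.1 ∧ x ∈ d.1 := by
        by_contra hcon
        push Not at hcon
        exact hcd hcon
      refine ⟨h, ?_⟩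
      rw [SimpleCycle.eq_of_rows_agree hxc hxd]
      intro z hz1 hz2
      obtain ⟨w, hw⟩ := hc z hz1
      obtain ⟨y, hy⟩ := c.row_toEdges_of_mem hz1
      obtain ⟨y', hy'⟩ := d.row_toEdges_of_mem hz2
      rw [map_mul, map_mul, toEdges_of, hy, hy'] at hw
      rw [hy, hy', (FreeMonoid.of_mul_inj hw).1]

end Hike

/-! ## Loop erasure and the factorisation of hikes -/

open EdgeMonoid

section LoopErasure

variable {V : Type*} {G : Digraph V}

theorem Hike.adj_of_mem_content (h : Hike G) {e : V × V}
    (he : e ∈ (TraceMonoid.content (Hike.toEdges h)).toAdd) : G.Adj e.1 e.2 := by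
  induction h using TraceMonoid.induction_left with
  | one => simp at he
  | of_mul c h ih =>
    rw [map_mul, map_mul, toAdd_mul, Multiset.mem_add, Hike.toEdges_of] at he
    rcases he with he | he
    · obtain ⟨x, hx⟩ := c.exists_mem
      obtain ⟨a, h1, -, h3⟩ := c.exists_rep hx
      rw [c.toEdges_eq h1] at he
      clear h1
      generalize x :: (a ++ [x]) = l at h3 he
      induction l with
      | nil => simp at he
      | cons x l ih =>
        cases l with
        | nil => simp at he
        | cons y l =>
          rw [edgeProd_cons_cons, map_mul, toAdd_mul, Multiset.mem_add, content_edge,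
            Multiset.mem_singleton] at he
          rw [List.isChain_cons_cons] at h3
          rcases he with rfl | he
          · exact h3.1
          · exact ih h3.2 he
    · exact ih he

theorem edgeProd_concat {l : List V} {x : V} (hl : l.getLast? = some x) (y : V) :
    edgeProd (l ++ [y]) = edgeProd l * edge x y := by
  obtain ⟨l, rfl⟩ := List.getLast?_eq_some_iff.1 hl
  rw [List.append_assoc, List.singleton_append, edgeProd_append]
  simp

/-- A cyclic sequence of vertices as a hike (trivial if it is no simple cycle). -/
noncomputable def cycleHike (G : Digraph V) (c : Cycle V) : Hike G :=
  open Classical in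
  if h : c ≠ Cycle.nil ∧ c.Nodup ∧ c.Chain G.Adj then TraceMonoid.of _ ⟨c, h⟩ else 1

theorem cycleHike_coe (c : SimpleCycle G) : cycleHike G c.1 = TraceMonoid.of _ c :=
  dif_pos c.2

variable [DecidableEq V]

/-- One step of chronological loop erasure, together with the product of the erased loops. -/
noncomputable def hikeStep (G : Digraph V) (s : (List V × Option (Cycle V)) × Hike G) (y : V) :
    (List V × Option (Cycle V)) × Hike G :=
  (eraseStep s.1 y, if y ∈ s.1.1 then
    s.2 * cycleHike G (((s.1.1.takeWhile (fun x => x ≠ y) ++ [y]).reverse : List V) : Cycle V)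
    else s.2)

/-- The product of the loops erased from a walk. -/
noncomputable def eraseHike (G : Digraph V) : List V → Hike G
  | [] => 1
  | x :: l => (l.foldl (hikeStep G) (([x], none), 1)).2

theorem foldl_hikeStep_fst (s : (List V × Option (Cycle V)) × Hike G) (l : List V) :
    (l.foldl (hikeStep G) s).1 = l.foldl eraseStep s.1 := by
  induction l generalizing s with
  | nil => rfl
  | cons y l ih => exact ih _

theorem hikeStep_of_notMem {γ : List V} {y : V} (hy : y ∉ γ) (o : Option (Cycle V))
    (h : Hike G) :
    hikeStep G ((γ.reverse, o), h) y = (((γ ++ [y]).reverse, o), h) := by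
  simp [hikeStep, eraseStep, hy]

theorem hikeStep_of_mem {α β : List V} {y : V} (hy : y ∉ β) (o : Option (Cycle V))
    (h : Hike G) :
    hikeStep G (((α ++ y :: β).reverse, o), h) y =
      (((α ++ [y]).reverse, some ((y :: β : List V) : Cycle V)),
        h * cycleHike G ((y :: β : List V) : Cycle V)) := by
  have h1 : (α ++ y :: β).reverse.takeWhile (fun x => x ≠ y) = β.reverse := by
    rw [List.reverse_append, List.reverse_cons, List.append_assoc,
      List.takeWhile_append_of_pos (by
        intro x hx; rw [List.mem_reverse] at hx
        simpa using (show x ≠ y by rintro rfl; exact hy hx))]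
    simp
  have h2 : (α ++ y :: β).reverse.dropWhile (fun x => x ≠ y) = y :: α.reverse := by
    rw [List.reverse_append, List.reverse_cons, List.append_assoc,
      List.dropWhile_append_of_pos (by
        intro x hx; rw [List.mem_reverse] at hx
        simpa using (show x ≠ y by rintro rfl; exact hy hx))]
    simp
  have h3 : y ∈ (α ++ y :: β).reverse := by simp
  simp only [hikeStep, eraseStep, h3, if_true, h1, h2]
  simp

/-- The invariant of loop erasure: after the walk `w`, the current path is `γ`, the last erased
loop is `o` and the product of the erased loops is `h`. -/
structure ErasureInv (G : Digraph V) (w γ : List V) (o : Option (Cycle V)) (h : Hike G) :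
    Prop where
  head : γ.head? = w.head?
  last : γ.getLast? = w.getLast?
  nodup : γ.Nodup
  chain : γ.IsChain G.Adj
  walk : w.IsChain G.Adj
  edges : Hike.toEdges h * edgeProd γ = edgeProd w
  meets : ∀ q : SimpleCycle G, q.RightDvd h → ∃ x ∈ γ, x ∈ q.1
  loop : ∀ c, o = some c → ∃ q : SimpleCycle G, q.1 = c ∧ q.RightDvd h
  noLoop : o = none → h = 1

theorem SimpleCycle.not_rightDvd_one (q : SimpleCycle G) : ¬ q.RightDvd (1 : Hike G) := by
  rintro ⟨h', hh⟩
  have h1 := congrArg (fun h => len (Hike.toEdges h)) hh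
  simp only [map_one, len_one, map_mul, len_mul, Hike.toEdges_of] at h1
  obtain ⟨x, hx⟩ := q.exists_mem
  have h2 : q.toEdges = 1 := eq_one_of_len_eq_zero (by omega)
  obtain ⟨y, hy⟩ := q.row_toEdges_of_mem hx
  rw [h2, map_one] at hy
  exact absurd hy.symm (FreeMonoid.of_ne_one y)

theorem ErasureInv.init (G : Digraph V) (x : V) : ErasureInv G [x] [x] none 1 where
  head := rfl
  last := rfl
  nodup := by simp
  chain := by simp
  walk := by simp
  edges := by simp
  meets := fun q hq => absurd hq q.not_rightDvd_one
  loop := by simp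
  noLoop := by simp

omit [DecidableEq V] in
theorem isChain_concat {l : List V} {x y : V} (hl : l.IsChain G.Adj) (hx : l.getLast? = some x)
    (hxy : G.Adj x y) : (l ++ [y]).IsChain G.Adj := by
  rw [List.isChain_append]
  refine ⟨hl, by simp, ?_⟩
  intro a ha b hb
  rw [hx] at ha
  obtain rfl : x = a := by simpa using ha
  obtain rfl : y = b := by simpa using hb
  exact hxy

omit [DecidableEq V] in
theorem ErasureInv.extend {w γ : List V} {o : Option (Cycle V)} {h : Hike G} {x y : V}
    (H : ErasureInv G w γ o h) (hx : γ.getLast? = some x) (hxy : G.Adj x y) (hy : y ∉ γ) :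
    ErasureInv G (w ++ [y]) (γ ++ [y]) o h where
  head := by
    have h1 := H.head
    cases w with
    | nil => rw [H.last] at hx; simp at hx
    | cons a w =>
      cases γ with
      | nil => simp at hx
      | cons b γ => simpa using h1
  last := by simp
  nodup := List.nodup_append.2 ⟨H.nodup, by simp, by
    intro a ha b hb hab
    obtain rfl : b = y := by simpa using hb
    exact hy (hab ▸ ha)⟩
  chain := isChain_concat H.chain hx hxy
  walk := isChain_concat H.walk (H.last ▸ hx) hxy
  edges := by
    rw [edgeProd_concat hx, edgeProd_concat (H.last ▸ hx), ← mul_assoc, H.edges]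
  meets := fun q hq => by
    obtain ⟨z, hz, hzq⟩ := H.meets q hq
    exact ⟨z, by simp [hz], hzq⟩
  loop := H.loop
  noLoop := H.noLoop

/-- The loop closed by a step of the walk. -/
theorem exists_loop {α β : List V} {x y : V}
    (hn : (α ++ y :: β).Nodup) (hc : (α ++ y :: β).IsChain G.Adj)
    (hx : (α ++ y :: β).getLast? = some x) (hxy : G.Adj x y) :
    ∃ c : SimpleCycle G, c.1 = ((y :: β : List V) : Cycle V) ∧
      edgeProd (α ++ y :: β) * edge x y = c.toEdges * edgeProd (α ++ [y]) := by
  have hx' : (y :: β).getLast? = some x := by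
    rw [List.getLast?_append_of_ne_nil _ (by simp)] at hx
    exact hx
  have h1 : (y :: β).Nodup := (List.nodup_append.1 hn).2.1
  have h2 : ((y :: β) ++ [y]).IsChain G.Adj :=
    isChain_concat (List.isChain_append.1 hc).2.1 hx' hxy
  have h3 : ((y :: β : List V) : Cycle V) ≠ Cycle.nil := by simp
  obtain ⟨c, hc⟩ : ∃ c : SimpleCycle G, c.1 = ((y :: β : List V) : Cycle V) :=
    ⟨⟨_, h3, h1, (Cycle.chain_coe_cons _ _ _).2 (by simpa using h2)⟩, rfl⟩
  refine ⟨c, hc, ?_⟩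
  -- The edges of the approach `α` start at vertices off the loop, so they commute with all edges of
  -- the loop, which can be pulled out in front.
  rw [c.toEdges_eq hc, ← edgeProd_concat hx, List.append_assoc, List.cons_append,
    edgeProd_append, edgeProd_mul_comm]
  intro z hz
  rw [List.dropLast_concat] at hz
  apply row_edgeProd_of_notMem
  rw [← List.cons_append, List.dropLast_concat]
  exact fun hz' => (List.nodup_append.1 hn).2.2 z hz z hz' rfl

omit [DecidableEq V] in
theorem SimpleCycle.rightDvd_mul {q : SimpleCycle G} {a b : Hike G} (h : q.RightDvd (a * b)) :
    q.RightDvd b ∨ q.RightDvd a :=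
  TraceMonoid.right_divisor_mul SimpleCycle.disjoint_symm SimpleCycle.disjoint_irrefl h

omit [DecidableEq V] in
theorem SimpleCycle.disjoint_of_rightDvd {p q : SimpleCycle G} {h : Hike G} (hp : p.RightDvd h)
    (hq : q.RightDvd h) (hpq : p ≠ q) : p.Disjoint q := by
  obtain ⟨a, rfl⟩ := hp
  obtain ⟨b, hb⟩ := hq
  exact (TraceMonoid.levi SimpleCycle.disjoint_symm SimpleCycle.disjoint_irrefl hb hpq).1

omit [DecidableEq V] in
/-- If `q` divides `h c` on the right and is different from `c`, it is disjoint from `c` and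
divides `h`. -/
theorem SimpleCycle.rightDvd_mul_of {q c : SimpleCycle G} {h : Hike G}
    (hq : q.RightDvd (h * TraceMonoid.of _ c)) (hne : c ≠ q) : c.Disjoint q ∧ q.RightDvd h := by
  obtain ⟨b, hb⟩ := hq
  exact TraceMonoid.levi SimpleCycle.disjoint_symm SimpleCycle.disjoint_irrefl hb hne

/-- The point is `meets`. A right prime divisor of the new product is either the loop just closed,
which contains `y`, or it is disjoint from that loop and already divides `h`. In the second case its
vertex on the old path cannot be among the erased ones and lies on `α`. -/
theorem ErasureInv.close {w α β : List V} {o : Option (Cycle V)} {h : Hike G} {x y : V}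
    (H : ErasureInv G w (α ++ y :: β) o h) (hx : (α ++ y :: β).getLast? = some x)
    (hxy : G.Adj x y) :
    ErasureInv G (w ++ [y]) (α ++ [y]) (some ((y :: β : List V) : Cycle V))
      (h * cycleHike G ((y :: β : List V) : Cycle V)) := by
  obtain ⟨c, hc, hce⟩ := exists_loop H.nodup H.chain hx hxy
  have hwx : w.getLast? = some x := H.last ▸ hx
  rw [← hc, cycleHike_coe]
  constructor
  · have h1 := H.head
    cases w with
    | nil => simp at hwx
    | cons a w => cases α <;> simpa using h1
  · simp
  · exact H.nodup.sublist (by simp)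
  · exact H.chain.prefix (by simp)
  · exact isChain_concat H.walk hwx hxy
  · rw [map_mul, Hike.toEdges_of, mul_assoc, ← hce, ← mul_assoc, H.edges, edgeProd_concat hwx]
  · intro q hq
    have hyc : y ∈ c.1 := by rw [hc]; exact List.mem_cons_self
    by_cases hqc : c = q
    · exact ⟨y, by simp, hqc ▸ hyc⟩
    · obtain ⟨hd, hq'⟩ := SimpleCycle.rightDvd_mul_of hq hqc
      obtain ⟨z, hz, hzq⟩ := H.meets q hq'
      rw [List.mem_append] at hz
      rcases hz with hz | hz
      · exact ⟨z, by simp [hz], hzq⟩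
      · exact absurd hzq (hd z (by rw [hc]; exact hz))
  · rintro _ ⟨⟩
    exact ⟨c, rfl, h, rfl⟩
  · simp

omit [DecidableEq V] in
theorem ErasureInv.ne_nil {w γ : List V} {o : Option (Cycle V)} {h : Hike G}
    (H : ErasureInv G w γ o h) (hw : w ≠ []) : ∃ x, γ.getLast? = some x := by
  rw [H.last]
  exact ⟨_, List.getLast?_eq_some_getLast hw⟩

/-- The erasure state stores the path with its latest vertex first, whence the reversals. -/
theorem exists_erasureInv (w l : List V) (hw : w ≠ []) (hl : (w ++ l).IsChain G.Adj)
    {γ : List V} {o : Option (Cycle V)} {h : Hike G} (H : ErasureInv G w γ o h) :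
    ∃ γ' o' h', l.foldl (hikeStep G) ((γ.reverse, o), h) = ((γ'.reverse, o'), h') ∧
      ErasureInv G (w ++ l) γ' o' h' := by
  induction l generalizing w γ o h with
  | nil => exact ⟨γ, o, h, rfl, by simpa using H⟩
  | cons y l ih =>
    obtain ⟨x, hx⟩ := H.ne_nil hw
    have hxy : G.Adj x y := by
      rw [List.isChain_append] at hl
      exact hl.2.2 x (by rw [← H.last]; exact hx) y (by simp)
    rw [List.append_cons] at hl
    rw [List.append_cons w y l, List.foldl_cons]
    by_cases hy : y ∈ γ
    · obtain ⟨α, β, rfl⟩ := List.append_of_mem hy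
      have hyβ : y ∉ β := (List.nodup_cons.1 (List.nodup_append.1 H.nodup).2.1).1
      rw [hikeStep_of_mem hyβ]
      exact ih _ (by simp) (by simpa using hl) (H.close hx hxy)
    · rw [hikeStep_of_notMem hy]
      exact ih _ (by simp) (by simpa using hl) (H.extend hx hxy hy)

/-- The closed walks based at `v`. -/
def closedWalks (G : Digraph V) (v : V) : Set (List V) :=
  {l | l.head? = some v ∧ l.getLast? = some v ∧ l.IsChain G.Adj}

omit [DecidableEq V] in
theorem eq_singleton_of_nodup {γ : List V} {v : V} (h1 : γ.head? = some v)
    (h2 : γ.getLast? = some v) (hn : γ.Nodup) : γ = [v] := by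
  cases γ with
  | nil => simp at h1
  | cons a γ =>
    obtain rfl : a = v := by simpa using h1
    cases γ with
    | nil => rfl
    | cons b γ =>
      rw [List.getLast?_cons_cons] at h2
      exact absurd (List.mem_of_getLast? h2) (List.nodup_cons.1 hn).1

/-- The remaining path goes from `v` to `v` without repetition, so it is trivial. The invariant then
says that the erased loops carry all edges of the walk and that every right prime divisor of their
product contains `v`. -/
theorem erasureInv_of_mem_closedWalks {l : List V} {v : V} (hl : l ∈ closedWalks G v) :
    ErasureInv G l [v] (lastErasedLoop l) (eraseHike G l) := by
  obtain ⟨h1, h2, h3⟩ := hl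
  cases l with
  | nil => simp at h1
  | cons x l =>
    obtain rfl : x = v := by simpa using h1
    obtain ⟨γ, o, h, he, H⟩ := exists_erasureInv [x] l (by simp) h3 (ErasureInv.init G x)
    have hγ : γ = [x] := eq_singleton_of_nodup (H.head.trans h1) (H.last.trans h2) H.nodup
    subst hγ
    have ho : lastErasedLoop (x :: l) = o := by
      have := foldl_hikeStep_fst (G := G) (([x], none), 1) l
      change l.foldl (hikeStep G) (([x], none), 1) = _ at he
      rw [he] at this
      exact (congrArg Prod.snd this).symm
    have hh : eraseHike G (x :: l) = h := by
      change l.foldl (hikeStep G) (([x], none), 1) = _ at he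
      change (l.foldl (hikeStep G) (([x], none), 1)).2 = h
      rw [he]
    rw [ho, hh]
    exact H

theorem toEdges_eraseHike {l : List V} {v : V} (hl : l ∈ closedWalks G v) :
    Hike.toEdges (eraseHike G l) = edgeProd l := by
  simpa using (erasureInv_of_mem_closedWalks hl).edges

theorem mem_of_rightDvd_eraseHike {l : List V} {v : V} (hl : l ∈ closedWalks G v)
    {q : SimpleCycle G} (hq : q.RightDvd (eraseHike G l)) : v ∈ q.1 := by
  simpa using (erasureInv_of_mem_closedWalks hl).meets q hq

/-- The case of a walk that is stuck at its end point `x`, no unused edge leaving `x`. If `x` were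
not `v`, the path would enter `x` and, being self-avoiding, not leave it; as `r` does not leave it
either, the balance of `g` would be violated. -/
theorem exists_complete_walk_aux {w γ : List V} {o : Option (Cycle V)} {h g : Hike G}
    {r : EdgeMonoid V} {v : V} (hr : ∀ x ∈ γ.getLast?, row x r = 1) (H : ErasureInv G w γ o h)
    (hv : w.head? = some v) (hg : Hike.toEdges g = edgeProd γ * r) :
    ∃ l γ' o' h' g', l.foldl (hikeStep G) ((γ.reverse, o), h) = ((γ'.reverse, o'), h') ∧
      ErasureInv G (w ++ l) γ' o' h' ∧ (w ++ l).getLast? = some v ∧ h * g = h' * g' ∧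
      row v (Hike.toEdges g') = 1 := by
  obtain ⟨x, hx⟩ := H.ne_nil (by rintro rfl; simp at hv)
  have hrx := hr x hx
  have hvx : v = x := by
    by_contra hne
    have hb := g.content_toEdges_fst
    rw [hg, map_mul, toAdd_mul, Multiset.map_add, Multiset.map_add, content_edgeProd_fst,
      content_edgeProd_snd] at hb
    have h1 : x ∈ (γ.tail : Multiset V) + ((TraceMonoid.content r).toAdd).map Prod.snd := by
      rw [Multiset.mem_add]
      left
      have h2 := List.mem_of_getLast? hx
      have h3 := H.head.trans hv
      cases γ with
      | nil => simp at hx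
      | cons a γ =>
        obtain rfl : a = v := by simpa using h3
        simpa [Ne.symm hne] using h2
    rw [← hb, Multiset.mem_add] at h1
    rcases h1 with h1 | h1
    · obtain ⟨δ, rfl⟩ := List.getLast?_eq_some_iff.1 hx
      rw [List.dropLast_concat] at h1
      exact (List.nodup_append.1 H.nodup).2.2 x h1 x (by simp) rfl
    · exact row_eq_one_iff.1 hrx h1
  subst hvx
  have hγ := eq_singleton_of_nodup (H.head.trans hv) hx H.nodup
  refine ⟨[], γ, o, h, g, rfl, by simpa using H, ?_, rfl, ?_⟩
  · rw [List.append_nil, ← H.last, hx]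
  · rw [hg, hγ, map_mul, hrx]; simp

/-- Here `g` is the part of the hike not yet erased, spelled as the current path followed by the
unused edges `r`, and the walk takes the first edge of `r` leaving its end point. A loop closed by
this step lies on top of the rows of `g`, so it divides `g` on the left and moves from `g` to `h`.
The number of unused edges decreases. -/
theorem exists_complete_walk (n : ℕ) (w γ : List V) (o : Option (Cycle V)) (h g : Hike G)
    (r : EdgeMonoid V) (v : V) (hn : len r = n) (H : ErasureInv G w γ o h)
    (hv : w.head? = some v) (hg : Hike.toEdges g = edgeProd γ * r) :
    ∃ l γ' o' h' g', l.foldl (hikeStep G) ((γ.reverse, o), h) = ((γ'.reverse, o'), h') ∧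
      ErasureInv G (w ++ l) γ' o' h' ∧ (w ++ l).getLast? = some v ∧ h * g = h' * g' ∧
      row v (Hike.toEdges g') = 1 := by
  induction n generalizing w γ o h g r with
  | zero => exact exists_complete_walk_aux (by simp [eq_one_of_len_eq_zero hn]) H hv hg
  | succ n ih =>
    have hw : w ≠ [] := by rintro rfl; simp at hv
    obtain ⟨x, hx⟩ := H.ne_nil hw
    rcases row_eq_one_or x r with hr | ⟨y, r, rfl⟩
    · exact exists_complete_walk_aux (fun z hz => by
        obtain rfl : x = z := by rw [hx] at hz; simpa using hz
        exact hr) H hv hg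
    · have hxy : G.Adj x y := g.adj_of_mem_content (e := (x, y)) (by
        rw [hg, map_mul, toAdd_mul, map_mul, toAdd_mul, content_edge]
        simp)
      have hn' : len r = n := by rw [len_mul, len_edge] at hn; omega
      have hv' : (w ++ [y]).head? = some v := by
        cases w with
        | nil => exact absurd rfl hw
        | cons a w => simpa using hv
      by_cases hy : y ∈ γ
      · obtain ⟨α, β, rfl⟩ := List.append_of_mem hy
        have hyβ : y ∉ β := (List.nodup_cons.1 (List.nodup_append.1 H.nodup).2.1).1
        obtain ⟨c, hc, hce⟩ := exists_loop H.nodup H.chain hx hxy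
        rw [← mul_assoc, hce, mul_assoc] at hg
        obtain ⟨g', rfl⟩ := Hike.left_dvd_of_rows c g (fun z _ => ⟨_, by rw [hg, map_mul]⟩)
        rw [map_mul, Hike.toEdges_of] at hg
        obtain ⟨l, γ', o', h', g'', h1, h2, h3, h4, h5⟩ :=
          ih (w ++ [y]) _ _ _ g' r hn' (H.close hx hxy) hv' (mul_left_cancel hg)
        refine ⟨y :: l, γ', o', h', g'', ?_, by simpa using h2, by simpa using h3, ?_, h5⟩
        · rw [List.foldl_cons, hikeStep_of_mem hyβ, h1]
        · rw [← h4, ← hc, cycleHike_coe, mul_assoc]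
      · obtain ⟨l, γ', o', h', g', h1, h2, h3, h4, h5⟩ :=
          ih (w ++ [y]) _ o h g r hn' (H.extend hx hxy hy) hv' (by
            rw [hg, edgeProd_concat hx, mul_assoc])
        refine ⟨y :: l, γ', o', h', g', ?_, by simpa using h2, by simpa using h3, h4, h5⟩
        rw [List.foldl_cons, hikeStep_of_notMem hy, h1]

/-- Every hike is the product of the hike of a closed walk based at `v` and of a hike that avoids
`v`. -/
theorem exists_eraseHike_mul (g : Hike G) (v : V) :
    ∃ l ∈ closedWalks G v, ∃ g' : Hike G, g = eraseHike G l * g' ∧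
      row v (Hike.toEdges g') = 1 := by
  obtain ⟨l, γ, o, h, g', h1, h2, h3, h4, h5⟩ :=
    exists_complete_walk _ [v] [v] none 1 g (Hike.toEdges g) v rfl (ErasureInv.init G v) rfl
      (by simp)
  refine ⟨v :: l, ⟨rfl, h3, h2.walk⟩, g', ?_, h5⟩
  change l.foldl (hikeStep G) (([v], none), 1) = _ at h1
  change g = (l.foldl (hikeStep G) (([v], none), 1)).2 * g'
  rw [h1, ← h4, one_mul]

theorem eq_of_mul_closedWalk {v : V} {a b : List V} (ha : a ∈ closedWalks G v)
    (hb : b ∈ closedWalks G v) {t u : EdgeMonoid V} (ht : row v t = 1) (hu : row v u = 1)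
    (h : edgeProd a * t = edgeProd b * u) : a = b ∧ t = u := by
  obtain ⟨a1, a2, -⟩ := ha
  obtain ⟨b1, b2, -⟩ := hb
  obtain ⟨a, rfl⟩ := List.head?_eq_some_iff.1 a1
  obtain ⟨b, rfl⟩ := List.head?_eq_some_iff.1 b1
  obtain ⟨h1, h2⟩ := edgeProd_mul_injective a2 b2 ht hu h
  exact ⟨by rw [h1], h2⟩

theorem Hike.eq_one_of_toEdges_eq_one {h : Hike G} (hh : Hike.toEdges h = 1) : h = 1 := by
  induction h using TraceMonoid.induction_left with
  | one => rfl
  | of_mul c h ih =>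
    obtain ⟨x, hx⟩ := c.exists_mem
    obtain ⟨y, hy⟩ := c.row_toEdges_of_mem hx
    have := congrArg (row x) hh
    rw [map_mul, map_mul, Hike.toEdges_of, hy, map_one] at this
    exact absurd this FreeMonoid.of_mul_ne_one

/-- A hike is determined by its edges. -/
theorem Hike.toEdges_injective : Function.Injective (Hike.toEdges (G := G)) := by
  have key : ∀ (n : ℕ) (g h : Hike G), len (Hike.toEdges g) = n →
      Hike.toEdges g = Hike.toEdges h → g = h := by
    intro n
    induction n using Nat.strong_induction_on with
    | _ n ih =>
      intro g h hn hgh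
      by_cases hg : Hike.toEdges g = 1
      · rw [Hike.eq_one_of_toEdges_eq_one hg, Hike.eq_one_of_toEdges_eq_one (hgh.symm.trans hg)]
      · obtain ⟨v, hv⟩ : ∃ v, row v (Hike.toEdges g) ≠ 1 := by
          by_contra hcon
          push Not at hcon
          apply hg
          induction g using TraceMonoid.induction_left with
          | one => simp
          | of_mul c g _ =>
            obtain ⟨x, hx⟩ := c.exists_mem
            obtain ⟨y, hy⟩ := c.row_toEdges_of_mem hx
            have := hcon x
            rw [map_mul, map_mul, Hike.toEdges_of, hy] at this
            exact absurd this FreeMonoid.of_mul_ne_one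
        -- The closed walk at `v` can be read off the edges, so it is the same for both hikes. It is
        -- nontrivial because the row of `v` is not empty, hence the remainders are shorter.
        obtain ⟨a, ha, g, rfl, hg'⟩ := exists_eraseHike_mul g v
        obtain ⟨b, hb, h, rfl, hh'⟩ := exists_eraseHike_mul h v
        rw [map_mul, map_mul, toEdges_eraseHike ha, toEdges_eraseHike hb] at hgh
        obtain ⟨rfl, h2⟩ := eq_of_mul_closedWalk ha hb hg' hh' hgh
        rw [map_mul, toEdges_eraseHike ha] at hn hv
        rw [map_mul, hg', mul_one] at hv
        have hpos : 0 < len (edgeProd a) := by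
          by_contra hcon
          rw [eq_one_of_len_eq_zero (t := edgeProd a) (by omega), map_one] at hv
          exact hv rfl
        rw [len_mul] at hn
        rw [ih _ (by omega) g h rfl h2]
  exact fun g h => key _ g h rfl

/-- The closed walks based at a vertex of `p` from which `p` is erased last correspond to the hikes
with unique right prime divisor `p`. -/
theorem bijOn_eraseHike (p : SimpleCycle G) {v : V} (hv : v ∈ p.1) :
    Set.BijOn (eraseHike G) {l | l ∈ closedWalks G v ∧ lastErasedLoop l = some p.1}
      {h | Hike.IsWalkWithLast p h} := by
  -- Two different right prime divisors would be disjoint, but all of them contain `v`.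
  have huniq : ∀ l ∈ closedWalks G v, ∀ q r : SimpleCycle G, q.RightDvd (eraseHike G l) →
      r.RightDvd (eraseHike G l) → q = r := by
    intro l hl q r hq hr
    by_contra hne
    exact SimpleCycle.disjoint_of_rightDvd hq hr hne v (mem_of_rightDvd_eraseHike hl hq)
      (mem_of_rightDvd_eraseHike hl hr)
  refine ⟨?_, ?_, ?_⟩
  · rintro l ⟨hl, hp⟩
    obtain ⟨q, hq1, hq2⟩ := (erasureInv_of_mem_closedWalks hl).loop _ hp
    obtain rfl : q = p := Subtype.ext hq1
    exact ⟨hq2, fun r hr => huniq l hl r q hr hq2⟩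
  · rintro a ⟨ha, -⟩ b ⟨hb, -⟩ hab
    have := congrArg Hike.toEdges hab
    rw [toEdges_eraseHike ha, toEdges_eraseHike hb] at this
    exact (eq_of_mul_closedWalk ha hb (map_one _) (map_one _) (by simpa using this)).1
  · rintro h ⟨h1, h2⟩
    obtain ⟨l, hl, g, rfl, hg⟩ := exists_eraseHike_mul h v
    -- A last prime of the remainder would be a right divisor of the whole hike, hence `p`; but `p`
    -- contains `v` and the remainder avoids it.
    have hg1 : g = 1 := by
      induction g using TraceMonoid.induction_right with
      | one => rfl
      | mul_of g q _ =>
        have hq : q = p := h2 q ⟨eraseHike G l * g, by rw [mul_assoc]⟩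
        subst hq
        obtain ⟨y, hy⟩ := q.row_toEdges_of_mem hv
        rw [map_mul, map_mul, Hike.toEdges_of, hy] at hg
        have := congrArg FreeMonoid.length hg
        simp at this
    subst hg1
    rw [mul_one] at h1 h2
    refine ⟨l, ⟨hl, ?_⟩, by simp⟩
    have H := erasureInv_of_mem_closedWalks hl
    cases ho : lastErasedLoop l with
    | none => rw [H.noLoop ho] at h1; exact absurd h1 p.not_rightDvd_one
    | some c =>
      obtain ⟨q, hq1, hq2⟩ := H.loop c ho
      rw [← hq1, h2 q hq2]

end LoopErasure

/-! ## Indicator series -/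

namespace TraceSeries

open TraceMonoid

variable {α : Type*} {I : α → α → Prop}

/-- The sum of the elements of a set. -/
noncomputable def ind (A : Set (TraceMonoid α I)) : TraceSeries α I :=
  open Classical in fun t => if t ∈ A then 1 else 0

open Classical in
theorem ind_apply (A : Set (TraceMonoid α I)) (t : TraceMonoid α I) :
    ind A t = if t ∈ A then 1 else 0 := rfl

theorem ext_coeff {f g : TraceSeries α I} (h : ∀ t, f t = g t) : f = g := funext h

theorem single_eq_ind (s : TraceMonoid α I) : single s = ind {s} := rfl

theorem ind_empty : ind (∅ : Set (TraceMonoid α I)) = 0 := by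
  apply ext_coeff
  intro t
  rw [ind_apply, if_neg (Set.notMem_empty t)]; rfl

theorem sum_apply {ι : Type*} (s : Finset ι) (f : ι → TraceSeries α I) (t : TraceMonoid α I) :
    (∑ i ∈ s, f i) t = ∑ i ∈ s, f i t := by
  classical
  induction s using Finset.induction_on with
  | empty => rfl
  | insert a s ha ih => rw [Finset.sum_insert ha, Finset.sum_insert ha, add_apply, ih]

/-- The coefficient of `t` counts its factorisations along `A` and `B`. This is how unique
factorisations become identities of series. -/
theorem ind_mul {A B C : Set (TraceMonoid α I)}
    (h : Set.BijOn (fun x : TraceMonoid α I × TraceMonoid α I => x.1 * x.2) (A ×ˢ B) C) :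
    ind A * ind B = ind C := by
  classical
  apply ext_coeff
  intro t
  rw [mul_apply, ind_apply]
  by_cases ht : t ∈ C
  · obtain ⟨x, hx, rfl⟩ := h.surjOn ht
    rw [if_pos ht, Finset.sum_eq_single x]
    · rw [ind_apply, ind_apply, if_pos hx.1, if_pos hx.2, mul_one]
    · intro y hy hne
      rw [mem_factorizations] at hy
      by_cases hA : y.1 ∈ A
      · by_cases hB : y.2 ∈ B
        · exact absurd (h.injOn ⟨hA, hB⟩ hx hy) hne
        · rw [ind_apply B, if_neg hB, mul_zero]
      · rw [ind_apply A, if_neg hA, zero_mul]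
    · intro hx'
      exact absurd (mem_factorizations.2 rfl) hx'
  · rw [if_neg ht]
    refine Finset.sum_eq_zero fun y hy => ?_
    rw [mem_factorizations] at hy
    by_cases hA : y.1 ∈ A
    · by_cases hB : y.2 ∈ B
      · exact absurd (hy ▸ h.mapsTo (show y ∈ A ×ˢ B from ⟨hA, hB⟩)) ht
      · rw [ind_apply B, if_neg hB, mul_zero]
    · rw [ind_apply A, if_neg hA, zero_mul]

theorem sum_ind {ι : Type*} (s : Finset ι) (A : ι → Set (TraceMonoid α I))
    (h : ∀ i ∈ s, ∀ j ∈ s, ∀ t, t ∈ A i → t ∈ A j → i = j) :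
    ∑ i ∈ s, ind (A i) = ind {t | ∃ i ∈ s, t ∈ A i} := by
  classical
  apply ext_coeff
  intro t
  rw [sum_apply, ind_apply]
  by_cases ht : ∃ i ∈ s, t ∈ A i
  · rw [if_pos (show t ∈ {t | ∃ i ∈ s, t ∈ A i} from ht)]
    obtain ⟨i, hi, hit⟩ := ht
    rw [Finset.sum_eq_single_of_mem i hi, ind_apply, if_pos hit]
    intro j hj hne
    rw [ind_apply, if_neg]
    exact fun hjt => hne (h j hj i hi t hjt hit)
  · rw [if_neg (show t ∉ {t | ∃ i ∈ s, t ∈ A i} from ht)]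
    refine Finset.sum_eq_zero fun i hi => ?_
    rw [ind_apply, if_neg]
    exact fun hit => ht ⟨i, hi, hit⟩

theorem ind_add {A B : Set (TraceMonoid α I)} (h : ∀ t ∈ A, t ∉ B) :
    ind A + ind B = ind (A ∪ B) := by
  classical
  apply ext_coeff
  intro t
  rw [add_apply, ind_apply, ind_apply, ind_apply]
  by_cases hA : t ∈ A
  · simp [hA, h t hA]
  · by_cases hB : t ∈ B <;> simp [hA, hB]

theorem single_mul_single (s t : TraceMonoid α I) :
    (single s * single t : TraceSeries α I) = single (s * t) := by
  rw [single_eq_ind, single_eq_ind, single_eq_ind]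
  apply ind_mul
  simp

end TraceSeries

/-! ## The formal resolvent -/

open EdgeMonoid TraceSeries

namespace EdgeSeries

variable {V ι : Type*}

/-- A row vector fixed by a matrix without constant terms vanishes. -/
theorem eq_zero_of_right_fixed (W : ι → ι → EdgeSeries V) (hW : ∀ i j, W i j 1 = 0)
    {f : ι → EdgeSeries V} (T : ι → Finset ι)
    (hf : ∀ c t, (∑ l ∈ T c, f l * W l c) t = 0 → f c t = 0) (c : ι) : f c = 0 := by
  apply ext_coeff
  intro t
  rw [zero_apply]
  induction hn : len t using Nat.strong_induction_on generalizing c t with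
  | _ n ih =>
    -- The hypothesis is an implication between coefficients rather than a fixed-point equation, so
    -- that it also applies when the sum is twice the vector. In the sum, either the factor from `W`
    -- is constant and vanishes, or the other factor is shorter.
    apply hf
    rw [sum_apply]
    refine Finset.sum_eq_zero fun l _ => ?_
    rw [mul_apply]
    refine Finset.sum_eq_zero fun x hx => ?_
    rw [TraceMonoid.mem_factorizations] at hx
    by_cases h2 : x.2 = 1
    · rw [h2, hW, mul_zero]
    · have : len x.2 ≠ 0 := fun h => h2 (eq_one_of_len_eq_zero h)
      rw [ih (len x.1) (by rw [← hn, ← hx, len_mul]; omega) l x.1 rfl, zero_mul]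

/-- A column vector fixed by a matrix without constant terms vanishes. -/
theorem eq_zero_of_left_fixed (W : ι → ι → EdgeSeries V) (hW : ∀ i j, W i j 1 = 0)
    {f : ι → EdgeSeries V} (T : ι → Finset ι) (hf : ∀ c, f c = ∑ l ∈ T c, W c l * f l) (c : ι) :
    f c = 0 := by
  apply ext_coeff
  intro t
  rw [zero_apply]
  induction hn : len t using Nat.strong_induction_on generalizing c t with
  | _ n ih =>
    rw [hf, sum_apply]
    refine Finset.sum_eq_zero fun l _ => ?_
    rw [mul_apply]
    refine Finset.sum_eq_zero fun x hx => ?_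
    rw [TraceMonoid.mem_factorizations] at hx
    by_cases h2 : x.1 = 1
    · rw [h2, hW, zero_mul]
    · have : len x.1 ≠ 0 := fun h => h2 (eq_one_of_len_eq_zero h)
      rw [ih (len x.2) (by rw [← hn, ← hx, len_mul]; omega) l x.2 rfl, mul_zero]

end EdgeSeries

section Resolvent

variable {V : Type*} {G : Digraph V}

theorem BoundedDegree.finite_out (hG : BoundedDegree G) (v : V) : {u | G.Adj v u}.Finite := by
  obtain ⟨D, hD⟩ := hG
  exact Set.finite_of_encard_le_coe (hD v).1

theorem BoundedDegree.finite_in (hG : BoundedDegree G) (v : V) : {u | G.Adj u v}.Finite := by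
  obtain ⟨D, hD⟩ := hG
  exact Set.finite_of_encard_le_coe (hD v).2

theorem labelledMatrix_of_adj {i j : V} (h : G.Adj i j) :
    labelledMatrix G i j = single (edge i j) := by
  simp [labelledMatrix, edgeMatrix, h, edge]

theorem labelledMatrix_of_not_adj {i j : V} (h : ¬ G.Adj i j) : labelledMatrix G i j = 0 := by
  simp [labelledMatrix, edgeMatrix, h]

theorem edge_ne_one (i j : V) : edge i j ≠ 1 := fun h => by
  have := congrArg len h
  simp at this

theorem labelledMatrix_apply_one (i j : V) : labelledMatrix G i j 1 = 0 := by
  by_cases h : G.Adj i j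
  · rw [labelledMatrix_of_adj h, single_eq_ind, ind_apply, if_neg]
    exact fun h' => edge_ne_one i j h'.symm
  · rw [labelledMatrix_of_not_adj h]; rfl

/-- Entries in different rows commute. -/
theorem labelledMatrix_comm {i k : V} (h : i ≠ k) (j l : V) :
    labelledMatrix G i j * labelledMatrix G k l = labelledMatrix G k l * labelledMatrix G i j := by
  by_cases h1 : G.Adj i j
  · by_cases h2 : G.Adj k l
    · rw [labelledMatrix_of_adj h1, labelledMatrix_of_adj h2, single_mul_single,
        single_mul_single, edge_comm h]
    · rw [labelledMatrix_of_not_adj h2, mul_zero, zero_mul]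
  · rw [labelledMatrix_of_not_adj h1, mul_zero, zero_mul]

/-- The walks from `i` to `j`. -/
def walks (G : Digraph V) (i j : V) : Set (List V) :=
  {l | l.head? = some i ∧ l.getLast? = some j ∧ l.IsChain G.Adj}

/-- The predicate `P` carries the length of the walk in the case of matrix powers and is trivial in
the case of the resolvent. -/
theorem labelledMatrix_mul_ind (i k j : V) (P : List V → Prop) :
    labelledMatrix G i k * ind (edgeProd '' {l | l ∈ walks G k j ∧ P l}) =
      ind (edgeProd '' {l | ∃ l', l = i :: l' ∧ G.Adj i k ∧ l' ∈ walks G k j ∧ P l'}) := by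
  by_cases h : G.Adj i k
  · rw [labelledMatrix_of_adj h, single_eq_ind]
    apply ind_mul
    have hcons : ∀ l, l ∈ walks G k j → edgeProd (i :: l) = edge i k * edgeProd l := by
      intro l hl
      obtain ⟨l, rfl⟩ := List.head?_eq_some_iff.1 hl.1
      rfl
    refine ⟨?_, ?_, ?_⟩
    · rintro ⟨_, _⟩ ⟨rfl, l, hl, rfl⟩
      exact ⟨i :: l, ⟨l, rfl, h, hl⟩, hcons l hl.1⟩
    · rintro ⟨_, a⟩ ⟨rfl, -⟩ ⟨_, b⟩ ⟨rfl, -⟩ hab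
      rw [mul_left_cancel (show edge i k * a = edge i k * b from hab)]
    · rintro _ ⟨_, ⟨l, rfl, -, hl⟩, rfl⟩
      exact ⟨(edge i k, edgeProd l), ⟨rfl, l, hl, rfl⟩, (hcons l hl.1).symm⟩
  · rw [labelledMatrix_of_not_adj h, zero_mul]
    simp [h, ind_empty]

theorem ind_mul_labelledMatrix (i k j : V) :
    ind (edgeProd '' walks G i k) * labelledMatrix G k j =
      ind (edgeProd '' {l | ∃ l', l = l' ++ [j] ∧ G.Adj k j ∧ l' ∈ walks G i k}) := by
  by_cases h : G.Adj k j
  · rw [labelledMatrix_of_adj h, single_eq_ind]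
    apply ind_mul
    refine ⟨?_, ?_, ?_⟩
    · rintro ⟨_, _⟩ ⟨⟨l, hl, rfl⟩, rfl⟩
      exact ⟨l ++ [j], ⟨l, rfl, h, hl⟩, edgeProd_concat hl.2.1 j⟩
    · rintro ⟨a, _⟩ ⟨-, rfl⟩ ⟨b, _⟩ ⟨-, rfl⟩ hab
      rw [mul_right_cancel (show a * edge k j = b * edge k j from hab)]
    · rintro _ ⟨_, ⟨l, rfl, -, hl⟩, rfl⟩
      exact ⟨(edgeProd l, edge k j), ⟨⟨l, hl, rfl⟩, rfl⟩, (edgeProd_concat hl.2.1 j).symm⟩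
  · rw [labelledMatrix_of_not_adj h, mul_zero]
    simp [h, ind_empty]

variable [DecidableEq V]

theorem walk_eq_of_edgeProd_eq {i j j' : V} {a b : List V} (ha : a ∈ walks G i j)
    (hb : b ∈ walks G i j') (h : edgeProd a = edgeProd b) : a = b := by
  obtain ⟨a, rfl⟩ := List.head?_eq_some_iff.1 ha.1
  obtain ⟨b, rfl⟩ := List.head?_eq_some_iff.1 hb.1
  rw [edgeProd_injective h]

omit [DecidableEq V] in
theorem cons_mem_walks {i k j : V} {l : List V} (h : G.Adj i k) (hl : l ∈ walks G k j) :
    i :: l ∈ walks G i j := by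
  obtain ⟨l, rfl⟩ := List.head?_eq_some_iff.1 hl.1
  exact ⟨rfl, by rw [List.getLast?_cons_cons]; exact hl.2.1, List.isChain_cons_cons.2 ⟨h, hl.2.2⟩⟩

omit [DecidableEq V] in
theorem concat_mem_walks {i k j : V} {l : List V} (h : G.Adj k j) (hl : l ∈ walks G i k) :
    l ++ [j] ∈ walks G i j := by
  refine ⟨?_, by simp, isChain_concat hl.2.2 hl.2.1 h⟩
  obtain ⟨l, rfl⟩ := List.head?_eq_some_iff.1 hl.1
  rfl

omit [DecidableEq V] in
theorem mem_walks_cases_left {i j : V} {l : List V} (hl : l ∈ walks G i j) :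
    (l = [i] ∧ i = j) ∨ ∃ k l', l = i :: l' ∧ G.Adj i k ∧ l' ∈ walks G k j := by
  obtain ⟨h1, h2, h3⟩ := hl
  obtain ⟨l, rfl⟩ := List.head?_eq_some_iff.1 h1
  cases l with
  | nil => left; exact ⟨rfl, by simpa using h2⟩
  | cons k l =>
    right
    rw [List.isChain_cons_cons] at h3
    rw [List.getLast?_cons_cons] at h2
    exact ⟨k, k :: l, rfl, h3.1, rfl, h2, h3.2⟩

omit [DecidableEq V] in
theorem mem_walks_cases_right {i j : V} {l : List V} (hl : l ∈ walks G i j) :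
    (l = [i] ∧ i = j) ∨ ∃ k l', l = l' ++ [j] ∧ G.Adj k j ∧ l' ∈ walks G i k := by
  obtain ⟨h1, h2, h3⟩ := hl
  obtain ⟨l, rfl⟩ := List.getLast?_eq_some_iff.1 h2
  rcases hk : l.getLast? with _ | k
  · left
    rw [List.getLast?_eq_none_iff] at hk
    subst hk
    have : j = i := by simpa using h1
    exact ⟨by simp [this], this.symm⟩
  · right
    rw [List.isChain_append] at h3
    refine ⟨k, l, rfl, h3.2.2 k hk j (by simp), ?_, hk, h3.1⟩
    cases l with
    | nil => simp at hk
    | cons a l => simpa using h1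

/-- The powers of the labelled adjacency matrix enumerate the walks. -/
theorem matPow_labelledMatrix (hG : BoundedDegree G) (n : ℕ) (i j : V) :
    matPow (labelledMatrix G) n i j =
      ind (edgeProd '' {l | l ∈ walks G i j ∧ l.length = n + 1}) := by
  classical
  induction n generalizing i with
  | zero =>
    have hw : {l | l ∈ walks G i j ∧ l.length = 0 + 1} = if i = j then {[i]} else ∅ := by
      ext l
      constructor
      · rintro ⟨h1, h2⟩
        rcases mem_walks_cases_left h1 with ⟨rfl, rfl⟩ | ⟨k, l', rfl, -, h3⟩
        · simp
        · obtain ⟨l', rfl⟩ := List.head?_eq_some_iff.1 h3.1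
          simp at h2
      · split_ifs with h
        · rintro rfl
          exact ⟨⟨rfl, by simp [h], by simp⟩, rfl⟩
        · rintro ⟨⟩
    rw [hw]
    simp only [matPow]
    split_ifs with h
    · rw [Set.image_singleton, edgeProd_singleton]; rfl
    · rw [Set.image_empty, ind_empty]
  | succ n ih =>
    change ∑ᶠ k, labelledMatrix G i k * matPow (labelledMatrix G) n k j = _
    rw [finsum_eq_sum_of_support_subset (s := (hG.finite_out i).toFinset)]
    · simp only [ih, labelledMatrix_mul_ind]
      rw [sum_ind]
      · congr 1
        ext t
        constructor
        · rintro ⟨k, -, _, ⟨l', rfl, h1, h2, h3⟩, rfl⟩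
          exact ⟨i :: l', ⟨cons_mem_walks h1 h2, by simp [h3]⟩, rfl⟩
        · rintro ⟨l, ⟨h1, h2⟩, rfl⟩
          rcases mem_walks_cases_left h1 with ⟨rfl, rfl⟩ | ⟨k, l', rfl, hk, h3⟩
          · simp at h2
          · exact ⟨k, by simpa using hk, _, ⟨l', rfl, hk, h3, by simpa using h2⟩, rfl⟩
      · rintro k - k' - _ ⟨_, ⟨l, rfl, hk, hl, -⟩, rfl⟩ ⟨_, ⟨l', rfl, hk', hl', -⟩, h⟩
        have := walk_eq_of_edgeProd_eq (cons_mem_walks hk' hl') (cons_mem_walks hk hl) h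
        obtain rfl : l' = l := (List.cons.inj this).2
        exact Option.some.inj (hl.1.symm.trans hl'.1)
    · intro k hk
      rw [Function.mem_support] at hk
      by_contra hcon
      apply hk
      rw [labelledMatrix_of_not_adj (by simpa using hcon), zero_mul]

/-- The formal resolvent enumerates the walks. -/
theorem formalResolvent_eq (hG : BoundedDegree G) (i j : V) :
    formalResolvent G i j = ind (edgeProd '' walks G i j) := by
  classical
  apply ext_coeff
  intro t
  change ∑ᶠ n, matPow (labelledMatrix G) n i j t = _
  rw [finsum_eq_single _ (len t)]
  · rw [matPow_labelledMatrix hG, ind_apply, ind_apply]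
    congr 1
    apply propext
    constructor
    · rintro ⟨l, ⟨h1, h2⟩, h3⟩
      exact ⟨l, h1, h3⟩
    · rintro ⟨l, h1, rfl⟩
      refine ⟨l, ⟨h1, ?_⟩, rfl⟩
      obtain ⟨l, rfl⟩ := List.head?_eq_some_iff.1 h1.1
      simp [len_edgeProd]
  · intro n hn
    rw [matPow_labelledMatrix hG, ind_apply, if_neg]
    rintro ⟨l, ⟨h1, h2⟩, rfl⟩
    apply hn
    rw [len_edgeProd, h2]
    rfl

theorem ite_eq_ind (i j : V) :
    (if i = j then 1 else 0 : EdgeSeries V) = ind {t | t = 1 ∧ i = j} := by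
  split_ifs with h
  · simp only [h, and_true]; rfl
  · simp [h, ind_empty]

/-- The equation `R = I + W R`, by the first step of a walk. The set `T` may exceed the set of
successors, so that the same sum can serve a graph and its subgraphs. -/
theorem formalResolvent_left (hG : BoundedDegree G) (i j : V) {T : Finset V}
    (hT : ∀ k, G.Adj i k → k ∈ T) :
    formalResolvent G i j =
      (if i = j then 1 else 0) + ∑ k ∈ T, labelledMatrix G i k * formalResolvent G k j := by
  have h0 : ∀ k, walks G k j = {l | l ∈ walks G k j ∧ True} := fun k => by simp
  simp only [formalResolvent_eq hG]
  conv_rhs => enter [2, 2, k]; rw [h0, labelledMatrix_mul_ind]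
  rw [ite_eq_ind, sum_ind, ind_add]
  · congr 1
    ext t
    constructor
    · rintro ⟨l, h1, rfl⟩
      rcases mem_walks_cases_left h1 with ⟨rfl, rfl⟩ | ⟨k, l', rfl, hk, h3⟩
      · left; exact ⟨rfl, rfl⟩
      · right; exact ⟨k, hT k hk, _, ⟨l', rfl, hk, h3, trivial⟩, rfl⟩
    · rintro (⟨rfl, rfl⟩ | ⟨k, -, _, ⟨l', rfl, hk, h3, -⟩, rfl⟩)
      · exact ⟨[i], ⟨rfl, rfl, by simp⟩, rfl⟩
      · exact ⟨_, cons_mem_walks hk h3, rfl⟩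
  · rintro _ ⟨rfl, rfl⟩ ⟨k, -, _, ⟨l', rfl, hk, h3, -⟩, h⟩
    obtain ⟨l', rfl⟩ := List.head?_eq_some_iff.1 h3.1
    have := congrArg len h
    simp at this
  · rintro k - k' - _ ⟨_, ⟨l, rfl, hk, hl, -⟩, rfl⟩ ⟨_, ⟨l', rfl, hk', hl', -⟩, h⟩
    have := walk_eq_of_edgeProd_eq (cons_mem_walks hk' hl') (cons_mem_walks hk hl) h
    obtain rfl : l' = l := (List.cons.inj this).2
    exact Option.some.inj (hl.1.symm.trans hl'.1)

theorem formalResolvent_right (hG : BoundedDegree G) (i j : V) {T : Finset V}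
    (hT : ∀ k, G.Adj k j → k ∈ T) :
    formalResolvent G i j =
      (if i = j then 1 else 0) + ∑ k ∈ T, formalResolvent G i k * labelledMatrix G k j := by
  simp only [formalResolvent_eq hG, ind_mul_labelledMatrix]
  rw [ite_eq_ind, sum_ind, ind_add]
  · congr 1
    ext t
    constructor
    · rintro ⟨l, h1, rfl⟩
      rcases mem_walks_cases_right h1 with ⟨rfl, rfl⟩ | ⟨k, l', rfl, hk, h3⟩
      · left; exact ⟨rfl, rfl⟩
      · right; exact ⟨k, hT k hk, _, ⟨l', rfl, hk, h3⟩, rfl⟩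
    · rintro (⟨rfl, rfl⟩ | ⟨k, -, _, ⟨l', rfl, hk, h3⟩, rfl⟩)
      · exact ⟨[i], ⟨rfl, rfl, by simp⟩, rfl⟩
      · exact ⟨_, concat_mem_walks hk h3, rfl⟩
  · rintro _ ⟨rfl, rfl⟩ ⟨k, -, _, ⟨l', rfl, hk, h3⟩, h⟩
    rw [edgeProd_concat h3.2.1] at h
    have := congrArg len h
    simp at this
  · rintro k - k' - _ ⟨_, ⟨l, rfl, hk, hl⟩, rfl⟩ ⟨_, ⟨l', rfl, hk', hl'⟩, h⟩
    have := walk_eq_of_edgeProd_eq (concat_mem_walks hk' hl') (concat_mem_walks hk hl) h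
    obtain rfl : l' = l := (List.append_inj' this rfl).1
    exact Option.some.inj (hl.2.1.symm.trans hl'.2.1)

end Resolvent

/-! ## Series of hikes as products of resolvents -/

open EdgeMonoid TraceSeries

section HikeSeries

variable {V : Type*} [DecidableEq V] {G : Digraph V}

/-- The digraph without the edges starting in `U`. -/
def deleteRows (G : Digraph V) (U : Finset V) : Digraph V :=
  ⟨fun i j => G.Adj i j ∧ i ∉ U⟩

omit [DecidableEq V] in
theorem deleteRows_adj {U : Finset V} {i j : V} :
    (deleteRows G U).Adj i j ↔ G.Adj i j ∧ i ∉ U := Iff.rfl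

omit [DecidableEq V] in
theorem BoundedDegree.deleteRows (hG : BoundedDegree G) (U : Finset V) :
    BoundedDegree (deleteRows G U) := by
  obtain ⟨D, hD⟩ := hG
  refine ⟨D, fun v => ⟨le_trans (Set.encard_le_encard ?_) (hD v).1,
    le_trans (Set.encard_le_encard ?_) (hD v).2⟩⟩ <;>
  exact fun u hu => hu.1

theorem isChain_deleteRows {U : Finset V} {l : List V} :
    l.IsChain (deleteRows G U).Adj ↔ l.IsChain G.Adj ∧ ∀ u ∈ U, row u (edgeProd l) = 1 := by
  simp only [row_eq_one_iff, content_edgeProd_fst, Multiset.mem_coe]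
  induction l with
  | nil => simp
  | cons x l ih =>
    cases l with
    | nil => simp
    | cons y l =>
      rw [List.isChain_cons_cons, List.isChain_cons_cons, ih, deleteRows_adj]
      simp only [List.dropLast_cons_cons, List.mem_cons, not_or]
      constructor
      · rintro ⟨⟨h1, h2⟩, h3, h4⟩
        exact ⟨⟨h1, h3⟩, fun u hu => ⟨fun h => h2 (h ▸ hu), h4 u hu⟩⟩
      · rintro ⟨⟨h1, h3⟩, h4⟩
        exact ⟨⟨h1, fun h => (h4 x h).1 rfl⟩, h3, fun u hu => (h4 u hu).2⟩

/-- A walk that never leaves a vertex of `U` can meet `U` only at its end. For closed walks based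
off `U`, deleting rows therefore amounts to deleting vertices, while the index set stays the same.
-/
theorem walks_deleteRows {U : Finset V} {i j : V} {l : List V} :
    l ∈ walks (deleteRows G U) i j ↔ l ∈ walks G i j ∧ ∀ u ∈ U, row u (edgeProd l) = 1 := by
  simp only [walks, Set.mem_ofPred_eq, isChain_deleteRows]
  tauto

/-- The edges of the hikes that avoid `U` and all of whose right prime divisors meet `L`. -/
def hikeSet (G : Digraph V) (U : Finset V) (L : List V) : Set (EdgeMonoid V) :=
  {t | ∃ h : Hike G, Hike.toEdges h = t ∧ (∀ u ∈ U, row u t = 1) ∧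
    ∀ q : SimpleCycle G, q.RightDvd h → ∃ x ∈ L, x ∈ q.1}

omit [DecidableEq V] in
theorem Hike.eq_one_of_no_right_divisor {h : Hike G}
    (hh : ∀ q : SimpleCycle G, ¬ q.RightDvd h) : h = 1 := by
  induction h using TraceMonoid.induction_right with
  | one => rfl
  | mul_of g q _ => exact absurd ⟨g, rfl⟩ (hh q)

theorem hikeSet_nil (U : Finset V) : hikeSet G U [] = {1} := by
  ext t
  constructor
  · rintro ⟨h, rfl, -, h2⟩
    have : h = 1 := Hike.eq_one_of_no_right_divisor fun q hq => by
      obtain ⟨x, hx, -⟩ := h2 q hq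
      simp at hx
    rw [this, map_one]; rfl
  · rintro rfl
    exact ⟨1, map_one _, fun u _ => map_one _, fun q hq => absurd hq q.not_rightDvd_one⟩

theorem FreeMonoid.mul_eq_one_iff' {α : Type*} {a b : FreeMonoid α} :
    a * b = 1 ↔ a = 1 ∧ b = 1 := by
  rw [← FreeMonoid.length_eq_zero, FreeMonoid.length_mul, add_eq_zero, FreeMonoid.length_eq_zero,
    FreeMonoid.length_eq_zero]

theorem SimpleCycle.notMem_of_rightDvd {q : SimpleCycle G} {h : Hike G} {v : V}
    (hq : q.RightDvd h) (hv : row v (Hike.toEdges h) = 1) : v ∉ q.1 := by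
  obtain ⟨g, rfl⟩ := hq
  rw [map_mul, map_mul, Hike.toEdges_of, FreeMonoid.mul_eq_one_iff'] at hv
  exact q.row_toEdges_eq_one_iff.1 hv.2

omit [DecidableEq V] in
theorem SimpleCycle.RightDvd.mul_left {q : SimpleCycle G} {h : Hike G} (hq : q.RightDvd h)
    (g : Hike G) : q.RightDvd (g * h) := by
  obtain ⟨a, rfl⟩ := hq
  exact ⟨g * a, by rw [mul_assoc]⟩

/-- Split off the closed walk at `v`. Right prime divisors of the remainder divide the whole hike
but avoid `v`, so they must meet `L`; conversely, right prime divisors coming from the closed walk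
all contain `v`. -/
theorem ind_hikeSet_cons (hG : BoundedDegree G) (U : Finset V) (v : V) (L : List V) :
    ind (hikeSet G U (v :: L)) =
      formalResolvent (deleteRows G U) v v * ind (hikeSet G (insert v U) L) := by
  rw [formalResolvent_eq (hG.deleteRows U)]
  symm
  apply ind_mul
  refine ⟨?_, ?_, ?_⟩
  · rintro ⟨_, _⟩ ⟨⟨l, hl, rfl⟩, h, rfl, h1, h2⟩
    rw [walks_deleteRows] at hl
    obtain ⟨hl, hlU⟩ := hl
    refine ⟨eraseHike G l * h, ?_, ?_, ?_⟩
    · rw [map_mul, toEdges_eraseHike hl]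
    · intro u hu
      have h3 := h1 u (Finset.mem_insert_of_mem hu)
      simp only at h3 ⊢
      rw [map_mul, hlU u hu, h3, mul_one]
    · intro q hq
      rcases SimpleCycle.rightDvd_mul hq with hq | hq
      · obtain ⟨x, hx, hxq⟩ := h2 q hq
        exact ⟨x, List.mem_cons_of_mem _ hx, hxq⟩
      · exact ⟨v, List.mem_cons_self, mem_of_rightDvd_eraseHike hl hq⟩
  · rintro ⟨_, t⟩ ⟨⟨a, ha, rfl⟩, h, -, h1, -⟩ ⟨_, u⟩ ⟨⟨b, hb, rfl⟩, h', -, h1', -⟩ hab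
    rw [walks_deleteRows] at ha hb
    obtain ⟨rfl, h2⟩ := eq_of_mul_closedWalk ha.1 hb.1 (h1 v (Finset.mem_insert_self _ _))
      (h1' v (Finset.mem_insert_self _ _)) hab
    exact Prod.ext rfl h2
  · rintro _ ⟨h, rfl, h1, h2⟩
    obtain ⟨l, hl, g, rfl, hg⟩ := exists_eraseHike_mul h v
    have h3 : ∀ u ∈ U, row u (edgeProd l) = 1 ∧ row u (Hike.toEdges g) = 1 := by
      intro u hu
      have := h1 u hu
      rwa [map_mul, map_mul, FreeMonoid.mul_eq_one_iff', toEdges_eraseHike hl] at this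
    refine ⟨(edgeProd l, Hike.toEdges g), ⟨⟨l, ?_, rfl⟩, g, rfl, ?_, ?_⟩, ?_⟩
    · exact walks_deleteRows.2 ⟨hl, fun u hu => (h3 u hu).1⟩
    · intro u hu
      rcases Finset.mem_insert.1 hu with rfl | hu
      · exact hg
      · exact (h3 u hu).2
    · intro q hq
      obtain ⟨x, hx, hxq⟩ := h2 q (hq.mul_left _)
      rcases List.mem_cons.1 hx with rfl | hx
      · exact absurd hxq (SimpleCycle.notMem_of_rightDvd hq hg)
      · exact ⟨x, hx, hxq⟩
    · rw [map_mul, toEdges_eraseHike hl]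

/-- The product of the entries `(v, v)` of the resolvents of the graphs obtained by removing the
vertices of a list one after the other. -/
noncomputable def loopProd (G : Digraph V) : Finset V → List V → EdgeSeries V
  | _, [] => 1
  | U, v :: L => formalResolvent (deleteRows G U) v v * loopProd G (insert v U) L

theorem loopProd_eq_ind (hG : BoundedDegree G) (U : Finset V) (L : List V) :
    loopProd G U L = ind (hikeSet G U L) := by
  induction L generalizing U with
  | nil => rw [hikeSet_nil]; rfl
  | cons v L ih => rw [ind_hikeSet_cons hG, loopProd, ih]

/-! ### The series of the closed walks with a given last loop. -/

theorem Hike.finite_toEdges_eq (P : Hike G → Prop) (t : EdgeMonoid V) :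
    {h : Hike G | P h ∧ Hike.toEdges h = t}.Finite :=
  Set.Subsingleton.finite fun _ ha _ hb => Hike.toEdges_injective (ha.2.trans hb.2.symm)

theorem walkSeries_eq_ind (p : SimpleCycle G) :
    walkSeries p = ind (Hike.toEdges '' {h : Hike G | h.IsWalkWithLast p}) := by
  classical
  apply ext_coeff
  intro t
  change (({h : Hike G | h.IsWalkWithLast p ∧ Hike.toEdges h = t}.ncard : ℕ) : ℤ) = _
  rw [ind_apply]
  split_ifs with h
  · obtain ⟨h, hh, rfl⟩ := h
    rw [Set.ncard_eq_one.2 ⟨h, ?_⟩]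
    · rfl
    · ext g
      constructor
      · rintro ⟨-, h2⟩
        exact Hike.toEdges_injective h2
      · rintro rfl
        exact ⟨hh, rfl⟩
  · rw [show {h : Hike G | h.IsWalkWithLast p ∧ Hike.toEdges h = t} = ∅ from ?_]
    · simp
    · ext g
      constructor
      · rintro ⟨h1, h2⟩
        exact h ⟨g, h1, h2⟩
      · rintro ⟨⟩

omit [DecidableEq V] in
-- A right prime divisor of `h` that is disjoint from `p` commutes past `p` and remains visible in
-- `h p`; one that meets `p` is hidden behind it.
theorem isWalkWithLast_mul_iff (p : SimpleCycle G) (h : Hike G) :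
    (h * TraceMonoid.of _ p).IsWalkWithLast p ↔
      ∀ q : SimpleCycle G, q.RightDvd h → ∃ x ∈ p.1, x ∈ q.1 := by
  constructor
  · rintro ⟨-, h2⟩ q hq
    by_contra hcon
    push Not at hcon
    have hd : p.Disjoint q := hcon
    have hqp : q = p := by
      obtain ⟨g, rfl⟩ := hq
      exact h2 q ⟨g * TraceMonoid.of _ p, by
        rw [mul_assoc, mul_assoc, TraceMonoid.of_mul_of hd]⟩
    subst hqp
    exact q.disjoint_irrefl hd
  · intro hh
    refine ⟨⟨h, rfl⟩, fun q hq => ?_⟩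
    by_contra hne
    obtain ⟨h1, h2⟩ := SimpleCycle.rightDvd_mul_of hq (Ne.symm hne)
    obtain ⟨x, hx, hxq⟩ := hh q h2
    exact h1 x hx hxq

theorem walkSeries_eq_loopProd (hG : BoundedDegree G) (p : SimpleCycle G) {L : List V}
    (hL : ∀ x, x ∈ L ↔ x ∈ p.1) :
    walkSeries p = loopProd G ∅ L * single p.toEdges := by
  rw [walkSeries_eq_ind, loopProd_eq_ind hG, single_eq_ind]
  symm
  apply ind_mul
  refine ⟨?_, ?_, ?_⟩
  · rintro ⟨_, _⟩ ⟨⟨h, rfl, -, h2⟩, rfl⟩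
    refine ⟨h * TraceMonoid.of _ p, ?_, by simp⟩
    refine (isWalkWithLast_mul_iff p h).2 fun q hq => ?_
    obtain ⟨x, hx, hxq⟩ := h2 q hq
    exact ⟨x, (hL x).1 hx, hxq⟩
  · rintro ⟨a, _⟩ ⟨-, rfl⟩ ⟨b, _⟩ ⟨-, rfl⟩ hab
    rw [mul_right_cancel (show a * p.toEdges = b * p.toEdges from hab)]
  · rintro _ ⟨h, hh, rfl⟩
    obtain ⟨g, rfl⟩ := hh.1
    refine ⟨(Hike.toEdges g, p.toEdges), ⟨⟨g, rfl, by simp, fun q hq => ?_⟩, rfl⟩, by simp⟩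
    obtain ⟨x, hx, hxq⟩ := (isWalkWithLast_mul_iff p g).1 hh q hq
    exact ⟨x, (hL x).2 hx, hxq⟩

end HikeSeries

/-! ## Commutation relations for the entries of the resolvent -/

open EdgeMonoid TraceSeries

section Manin

variable {V : Type*} [DecidableEq V] {G : Digraph V}

/-- The identity matrix. -/
noncomputable def delta (i j : V) : EdgeSeries V := if i = j then 1 else 0

theorem delta_comm (i j : V) (x : EdgeSeries V) : delta i j * x = x * delta i j := by
  unfold delta
  split_ifs <;> simp

theorem sum_mul_delta (f : V → EdgeSeries V) {T : Finset V} {c : V} (hc : c ∈ T) :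
    ∑ a ∈ T, f a * delta a c = f c := by
  simp [delta, hc]

/-- The matrix `I - W`. -/
noncomputable def oneSubLabelled (G : Digraph V) (i j : V) : EdgeSeries V :=
  delta i j - labelledMatrix G i j

theorem oneSubLabelled_comm {i k : V} (h : i ≠ k) (j l : V) :
    oneSubLabelled G i j * oneSubLabelled G k l =
      oneSubLabelled G k l * oneSubLabelled G i j := by
  have h1 : ∀ (a b : V) (x : EdgeSeries V), Commute (delta a b) x := delta_comm
  exact ((h1 _ _ _).sub_right (h1 _ _ _)).sub_left
    ((h1 _ _ _).symm.sub_right (labelledMatrix_comm h j l))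

/-- A finite set containing the origins of the edges ending at `c` or `d`, and `c` and `d`. -/
noncomputable def inSupport (hG : BoundedDegree G) (c d : V) : Finset V :=
  insert c (insert d ((hG.finite_in c).toFinset ∪ (hG.finite_in d).toFinset))

theorem sum_resolvent_mul (hG : BoundedDegree G) (i c : V) {T : Finset V}
    (hT : ∀ k, G.Adj k c → k ∈ T) :
    ∑ a ∈ T, formalResolvent G i a * labelledMatrix G a c =
      formalResolvent G i c - delta i c := by
  rw [formalResolvent_right hG i c hT, delta]
  abel

theorem sum_resolvent_mul_oneSub (hG : BoundedDegree G) (i c : V) {T : Finset V}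
    (hT : ∀ k, G.Adj k c → k ∈ T) (hc : c ∈ T) :
    ∑ a ∈ T, formalResolvent G i a * oneSubLabelled G a c = delta i c := by
  simp only [oneSubLabelled, mul_sub, Finset.sum_sub_distrib]
  rw [sum_mul_delta _ hc, sum_resolvent_mul hG i c hT]
  abel

/-- The coefficients of the exterior product of two columns of the resolvent. -/
noncomputable def wedgeCoeff (G : Digraph V) (i j a b : V) : EdgeSeries V :=
  formalResolvent G i a * formalResolvent G j b - formalResolvent G j a * formalResolvent G i b

/-- The order of the last two factors puts the second resolvent entry next to its column of `I - W`.
The inner sum collapses to a central delta, and then the outer one does. What matters is that the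
result is antisymmetric in `c` and `d`. -/
theorem sum_wedgeCoeff (hG : BoundedDegree G) (i j c d : V) {T : Finset V}
    (hc : ∀ k, G.Adj k c → k ∈ T) (hcT : c ∈ T) (hd : ∀ k, G.Adj k d → k ∈ T) (hdT : d ∈ T) :
    ∑ a ∈ T, ∑ b ∈ T, wedgeCoeff G i j a b * (oneSubLabelled G b c * oneSubLabelled G a d) =
      delta i d * delta j c - delta j d * delta i c := by
  have h1 : ∀ a, ∑ b ∈ T, wedgeCoeff G i j a b *
      (oneSubLabelled G b c * oneSubLabelled G a d) =
      formalResolvent G i a * oneSubLabelled G a d * delta j c -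
        formalResolvent G j a * oneSubLabelled G a d * delta i c := by
    intro a
    have h2 : ∀ b, wedgeCoeff G i j a b * (oneSubLabelled G b c * oneSubLabelled G a d) =
        formalResolvent G i a * (formalResolvent G j b * oneSubLabelled G b c) *
          oneSubLabelled G a d -
        formalResolvent G j a * (formalResolvent G i b * oneSubLabelled G b c) *
          oneSubLabelled G a d := by
      intro b
      rw [wedgeCoeff]
      noncomm_ring
    simp only [h2, Finset.sum_sub_distrib, ← Finset.sum_mul, ← Finset.mul_sum,
      sum_resolvent_mul_oneSub hG _ c hc hcT]
    simp only [mul_assoc, delta_comm]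
  simp only [h1, Finset.sum_sub_distrib, ← Finset.sum_mul,
    sum_resolvent_mul_oneSub hG _ d hd hdT]

/-- The columns of the resolvent anticommute. -/
theorem wedgeCoeff_add_swap (hG : BoundedDegree G) (i j a b : V) :
    wedgeCoeff G i j a b + wedgeCoeff G i j b a = 0 := by
  set Y : V × V → EdgeSeries V :=
    fun x => wedgeCoeff G i j x.1 x.2 + wedgeCoeff G i j x.2 x.1 with hY
  set E : V × V → V × V → EdgeSeries V := fun x y =>
    oneSubLabelled G x.2 y.1 * oneSubLabelled G x.1 y.2 +
      oneSubLabelled G x.2 y.2 * oneSubLabelled G x.1 y.1 with hE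
  set D : V × V → V × V → EdgeSeries V := fun x y =>
    delta x.2 y.1 * delta x.1 y.2 + delta x.2 y.2 * delta x.1 y.1 with hD
  -- The commutation of entries in different rows enters here. For `a = b` there is nothing to
  -- prove.
  have hEs : ∀ a b y, E (a, b) y = E (b, a) y := by
    intro a b y
    by_cases hab : a = b
    · rw [hab]
    · simp only [hE]
      rw [oneSubLabelled_comm (Ne.symm hab), oneSubLabelled_comm (Ne.symm hab), add_comm]
  -- By the antisymmetry of `sum_wedgeCoeff` and the symmetry of `E`, the product `Y E` vanishes,
  -- while `Y D = 2 Y`. The matrices `D` and `E` have the same constant terms, so `D - E` has none,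
  -- and the factor 2 is harmless over the integers.
  refine EdgeSeries.eq_zero_of_right_fixed (f := Y) (fun x y => D x y - E x y) ?_
    (fun y => inSupport hG y.1 y.2 ×ˢ inSupport hG y.1 y.2) ?_ (a, b)
  · intro x y
    have h1 : ∀ f g : EdgeSeries V, (f * g) 1 = f 1 * g 1 := by
      intro f g
      rw [mul_apply, Finset.sum_eq_single (1, 1)]
      · rintro ⟨u, v⟩ hx hne
        rw [TraceMonoid.mem_factorizations] at hx
        have hu : u = 1 := TraceMonoid.eq_one_of_mul_eq_one hx
        subst hu
        have hv : v = 1 := by simpa using hx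
        exact absurd (by rw [hv]) hne
      · intro h
        exact absurd (TraceMonoid.mem_factorizations.2 (one_mul 1)) h
    have h2 : ∀ i j, oneSubLabelled G i j 1 = delta i j 1 := by
      intro i j
      change delta i j 1 - labelledMatrix G i j 1 = _
      rw [labelledMatrix_apply_one, sub_zero]
    change D x y 1 - E x y 1 = 0
    simp only [hD, hE, add_apply, h1, h2, sub_self]
  · rintro ⟨c, d⟩ t
    set T := inSupport hG c d with hT
    have hc : ∀ k, G.Adj k c → k ∈ T := fun k hk => by simp [hT, inSupport, hk]
    have hd : ∀ k, G.Adj k d → k ∈ T := fun k hk => by simp [hT, inSupport, hk]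
    have hcT : c ∈ T := by simp [hT, inSupport]
    have hdT : d ∈ T := by simp [hT, inSupport]
    have h0 : ∑ a ∈ T, ∑ b ∈ T, wedgeCoeff G i j a b * E (a, b) (c, d) = 0 := by
      simp only [hE, mul_add, Finset.sum_add_distrib]
      rw [sum_wedgeCoeff hG i j c d hc hcT hd hdT, sum_wedgeCoeff hG i j d c hd hdT hc hcT]
      rw [delta_comm j d, delta_comm j c]
      abel
    have h1 : ∑ x ∈ T ×ˢ T, Y x * E x (c, d) = 0 := by
      rw [Finset.sum_product]
      simp only [hY, add_mul, Finset.sum_add_distrib]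
      rw [h0, zero_add, Finset.sum_comm]
      rw [← h0]
      exact Finset.sum_congr rfl fun a _ => Finset.sum_congr rfl fun b _ => by rw [hEs b a]
    have h2 : ∑ x ∈ T ×ˢ T, Y x * D x (c, d) = Y (c, d) + Y (c, d) := by
      rw [Finset.sum_product]
      simp only [hD, mul_add, Finset.sum_add_distrib, ← mul_assoc]
      have h3 : ∀ e f, e ∈ T → f ∈ T →
          ∑ a ∈ T, ∑ b ∈ T, Y (a, b) * delta b e * delta a f = Y (f, e) := by
        intro e f he hf
        simp only [← Finset.sum_mul]
        rw [sum_mul_delta (fun a => ∑ b ∈ T, Y (a, b) * delta b e) hf]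
        exact sum_mul_delta (fun b => Y (f, b)) he
      rw [h3 c d hcT hdT, h3 d c hdT hcT]
      simp only [hY]
      abel
    intro h
    simp only [mul_sub, Finset.sum_sub_distrib] at h
    rw [h1, h2, sub_zero, add_apply] at h
    omega

theorem wedgeCoeff_self (hG : BoundedDegree G) (i j a : V) : wedgeCoeff G i j a a = 0 := by
  apply ext_coeff
  intro t
  have := congrFun (wedgeCoeff_add_swap hG i j a a) t
  rw [add_apply, zero_apply] at this
  rw [zero_apply]
  omega

/-- Something that commutes with all edges not starting at `k` can be moved through columns of the
resolvent. -/
theorem wedgeCoeff_mul (hG : BoundedDegree G) (i j k l : V) {x : EdgeSeries V}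
    (hx : ∀ m, m ≠ k → ∀ c, x * labelledMatrix G m c = labelledMatrix G m c * x) :
    formalResolvent G i k * x * formalResolvent G j l -
      formalResolvent G j k * x * formalResolvent G i l = wedgeCoeff G i j k l * x := by
  rw [← sub_eq_zero]
  -- As a function of `l`, the difference of the two sides is a row vector fixed by `W`: the delta
  -- terms coming from `R W = R - I` cancel.
  refine EdgeSeries.eq_zero_of_right_fixed (f := fun l =>
    formalResolvent G i k * x * formalResolvent G j l -
      formalResolvent G j k * x * formalResolvent G i l - wedgeCoeff G i j k l * x)
    (labelledMatrix G) labelledMatrix_apply_one (fun c => (hG.finite_in c).toFinset) ?_ l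
  intro c t
  have hT : ∀ k, G.Adj k c → k ∈ (hG.finite_in c).toFinset := fun k hk => by simpa using hk
  have h1 : ∀ m, (formalResolvent G i k * x * formalResolvent G j m -
      formalResolvent G j k * x * formalResolvent G i m - wedgeCoeff G i j k m * x) *
        labelledMatrix G m c =
      formalResolvent G i k * x * (formalResolvent G j m * labelledMatrix G m c) -
      formalResolvent G j k * x * (formalResolvent G i m * labelledMatrix G m c) -
      (formalResolvent G i k * (formalResolvent G j m * labelledMatrix G m c) * x -
        formalResolvent G j k * (formalResolvent G i m * labelledMatrix G m c) * x) := by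
    intro m
    -- The only row with which `x` may fail to commute is `m = k`, and there the wedge coefficient
    -- is zero.
    have h2 : wedgeCoeff G i j k m * x * labelledMatrix G m c =
        wedgeCoeff G i j k m * labelledMatrix G m c * x := by
      by_cases hm : m = k
      · rw [hm, wedgeCoeff_self hG]; simp
      · rw [mul_assoc, hx m hm, mul_assoc]
    rw [sub_mul, sub_mul, h2, wedgeCoeff]
    noncomm_ring
  simp only [h1, Finset.sum_sub_distrib, ← Finset.sum_mul, ← Finset.mul_sum,
    sum_resolvent_mul hG _ c hT]
  intro h
  rw [← h]
  refine congrFun (?_ : (_ : EdgeSeries V) = _) t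
  rw [wedgeCoeff]
  simp only [mul_sub, sub_mul, mul_assoc, delta_comm]
  abel

theorem formalResolvent_deleteRows_of_mem (hG : BoundedDegree G) {U : Finset V} {i : V}
    (hi : i ∈ U) (j : V) : formalResolvent (deleteRows G U) i j = delta i j := by
  rw [formalResolvent_left (hG.deleteRows U) i j (T := (hG.finite_out i).toFinset)
    (fun k hk => by simpa using hk.1), delta, Finset.sum_eq_zero, add_zero]
  intro k _
  rw [labelledMatrix_of_not_adj (G := deleteRows G U) (fun h => h.2 hi), zero_mul]

/-- The columns of the resolvent of the graph without the edges starting in `U` differ from those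
of the resolvent by combinations of the columns indexed by `U`. -/
theorem exists_resolvent_sub (hG : BoundedDegree G) (U : Finset V) (j : V) :
    ∃ τ : V → EdgeSeries V, ∀ i, formalResolvent G i j =
      formalResolvent (deleteRows G U) i j + ∑ u ∈ U, formalResolvent G i u * τ u := by
  have hU := hG.deleteRows U
  set T : V → Finset V := fun i => (hG.finite_out i).toFinset with hT
  have hT1 : ∀ i k, G.Adj i k → k ∈ T i := fun i k hk => by simpa [hT] using hk
  have hT2 : ∀ i k, (deleteRows G U).Adj i k → k ∈ T i := fun i k hk => hT1 i k hk.1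
  -- A walk is cut at its last edge that starts in `U`: `τ u` collects the possible continuations
  -- from `u`, this edge included.
  set τ : V → EdgeSeries V := fun u =>
    ∑ k ∈ T u, labelledMatrix G u k * formalResolvent (deleteRows G U) k j with hτ
  refine ⟨τ, fun i => ?_⟩
  rw [← sub_eq_zero]
  refine EdgeSeries.eq_zero_of_left_fixed (f := fun i => formalResolvent G i j -
    (formalResolvent (deleteRows G U) i j + ∑ u ∈ U, formalResolvent G i u * τ u))
    (labelledMatrix G) labelledMatrix_apply_one T ?_ i
  intro i
  have h1 : ∀ c, ∑ k ∈ T i, labelledMatrix G i k * formalResolvent G k c =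
      formalResolvent G i c - delta i c := by
    intro c
    rw [formalResolvent_left hG i c (hT1 i), delta]
    abel
  simp only [mul_sub, mul_add, Finset.mul_sum, Finset.sum_sub_distrib, Finset.sum_add_distrib]
  rw [h1, Finset.sum_comm]
  simp only [← mul_assoc, ← Finset.sum_mul, h1]
  simp only [sub_mul, Finset.sum_sub_distrib]
  -- The difference satisfies `f = W f`. Row `i` of the reduced resolvent is trivial for `i ∈ U`,
  -- where `τ i` supplies the missing first steps; for other `i` the two graphs have the same edges
  -- out of `i`.
  by_cases hi : i ∈ U
  · have h2 := formalResolvent_deleteRows_of_mem hG hi j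
    have h3 : ∑ u ∈ U, delta i u * τ u = τ i := by
      simp [delta, hi]
    rw [h2, h3]
    simp only [hτ]
    abel
  · have h2 : ∑ k ∈ T i, labelledMatrix G i k * formalResolvent (deleteRows G U) k j =
        formalResolvent (deleteRows G U) i j - delta i j := by
      rw [formalResolvent_left hU i j (hT2 i), delta, add_sub_cancel_left]
      refine Finset.sum_congr rfl fun k _ => ?_
      by_cases hk : G.Adj i k
      · rw [labelledMatrix_of_adj hk, labelledMatrix_of_adj (G := deleteRows G U) ⟨hk, hi⟩]
      · rw [labelledMatrix_of_not_adj hk,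
          labelledMatrix_of_not_adj (G := deleteRows G U) (fun h => hk h.1)]
    have h3 : ∑ u ∈ U, delta i u * τ u = 0 := by
      refine Finset.sum_eq_zero fun u hu => ?_
      have : i ≠ u := fun h => hi (h ▸ hu)
      simp [delta, this]
    rw [h2, h3]
    abel

end Manin

/-! ## Column determinants and Grassmann variables -/

open scoped TensorProduct

section Grassmann

variable (S : Type*) [Ring S] (m : ℕ)

/-- The Grassmann algebra in `m` variables over the ring `S`. -/
abbrev Grassmann : Type _ := ExteriorAlgebra ℤ (Fin m → ℤ) ⊗[ℤ] S

namespace Grassmann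

variable {S m}

/-- The `i`-th Grassmann variable. -/
noncomputable def gen (i : Fin m) : Grassmann S m :=
  ExteriorAlgebra.ι ℤ (Pi.single i (1 : ℤ)) ⊗ₜ (1 : S)

/-- The inclusion of the scalars. -/
noncomputable def scal : S →+* Grassmann S m :=
  (Algebra.TensorProduct.includeRight : S →ₐ[ℤ] Grassmann S m).toRingHom

theorem scal_apply (s : S) :
    (scal s : Grassmann S m) = (1 : ExteriorAlgebra ℤ (Fin m → ℤ)) ⊗ₜ s := rfl

theorem gen_mul_scal (i : Fin m) (s : S) :
    (gen i * scal s : Grassmann S m) = ExteriorAlgebra.ι ℤ (Pi.single i (1 : ℤ)) ⊗ₜ s := by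
  rw [gen, scal_apply, Algebra.TensorProduct.tmul_mul_tmul, mul_one, one_mul]

theorem gen_comm (i : Fin m) (s : S) : (gen i * scal s : Grassmann S m) = scal s * gen i := by
  rw [gen, scal_apply, Algebra.TensorProduct.tmul_mul_tmul, Algebra.TensorProduct.tmul_mul_tmul]
  simp

theorem gen_sq (i : Fin m) : (gen i * gen i : Grassmann S m) = 0 := by
  rw [gen, Algebra.TensorProduct.tmul_mul_tmul, ExteriorAlgebra.ι_sq_zero,
    TensorProduct.zero_tmul]

theorem gen_add_swap (i k : Fin m) : (gen i * gen k + gen k * gen i : Grassmann S m) = 0 := by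
  rw [gen, gen, Algebra.TensorProduct.tmul_mul_tmul, Algebra.TensorProduct.tmul_mul_tmul,
    ← TensorProduct.add_tmul, ExteriorAlgebra.ι_add_mul_swap, TensorProduct.zero_tmul]

/-- Transposed terms cancel in pairs and diagonal terms contain a square. No division by 2 is
involved. -/
theorem sum_gen_symm {g : Fin m → Fin m → S} (hg : ∀ i k, g i k = g k i) :
    ∑ i, ∑ k, (gen i * gen k * scal (g i k) : Grassmann S m) = 0 := by
  rw [← Finset.sum_product']
  refine Finset.sum_involution (fun x _ => (x.2, x.1)) ?_ ?_ ?_ ?_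
  · rintro ⟨i, k⟩ -
    simp only
    rw [hg k i, ← add_mul, gen_add_swap, zero_mul]
  · rintro ⟨i, k⟩ - hne h
    obtain rfl : k = i := congrArg Prod.fst h
    exact hne (by simp only; rw [gen_sq, zero_mul])
  · simp
  · simp

/-- The linear combination of the Grassmann variables with the given coefficients. -/
noncomputable def column (c : Fin m → S) : Grassmann S m := ∑ i, gen i * scal (c i)

theorem column_mul_scal (c : Fin m → S) (x : S) :
    (column c * scal x : Grassmann S m) = column fun i => c i * x := by
  simp only [column, Finset.sum_mul, mul_assoc, map_mul]

theorem column_add (c d : Fin m → S) :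
    (column (fun i => c i + d i) : Grassmann S m) = column c + column d := by
  simp only [column, map_add, mul_add, Finset.sum_add_distrib]

theorem column_sum {ι : Type*} (s : Finset ι) (c : ι → Fin m → S) :
    (column (fun i => ∑ a ∈ s, c a i) : Grassmann S m) = ∑ a ∈ s, column (c a) := by
  simp only [column, map_sum, Finset.mul_sum]
  rw [Finset.sum_comm]

theorem column_mul_column (c d : Fin m → S) :
    (column c * column d : Grassmann S m) = ∑ i, ∑ k, gen i * gen k * scal (c i * d k) := by
  simp only [column, Finset.sum_mul_sum]
  refine Finset.sum_congr rfl fun i _ => Finset.sum_congr rfl fun k _ => ?_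
  rw [map_mul, mul_assoc, ← mul_assoc (scal (c i)), ← gen_comm, mul_assoc, mul_assoc]

theorem column_anticomm {c d : Fin m → S}
    (h : ∀ i k, c i * d k + d i * c k = c k * d i + d k * c i) :
    (column c * column d + column d * column c : Grassmann S m) = 0 := by
  rw [column_mul_column, column_mul_column, ← Finset.sum_add_distrib]
  simp only [← Finset.sum_add_distrib, ← mul_add, ← map_add]
  exact sum_gen_symm h

theorem column_sq {c : Fin m → S} (h : ∀ i k, c i * c k = c k * c i) :
    (column c * column c : Grassmann S m) = 0 := by
  rw [column_mul_column]
  exact sum_gen_symm h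

theorem column_mul_scal_mul_column {c d : Fin m → S} {x : S}
    (h : ∀ i k, c i * x * d k - c k * x * d i = (c i * d k - c k * d i) * x) :
    (column c * scal x * column d : Grassmann S m) = column c * column d * scal x := by
  rw [column_mul_scal, column_mul_column, column_mul_column, ← sub_eq_zero, Finset.sum_mul,
    ← Finset.sum_sub_distrib]
  simp only [Finset.sum_mul, mul_assoc (gen _ * gen _), ← map_mul, ← Finset.sum_sub_distrib,
    ← mul_sub, ← map_sub]
  apply sum_gen_symm
  intro i k
  have := h i k
  rw [sub_mul] at this
  rw [sub_eq_sub_iff_sub_eq_sub]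
  exact this

/-! ### The column determinant as a top Grassmann coefficient. -/

theorem prod_tmul {A : Type*} [Ring A] {n : ℕ} (a : Fin n → A) (b : Fin n → S) :
    (List.ofFn fun j => (a j ⊗ₜ[ℤ] b j : A ⊗[ℤ] S)).prod =
      (List.ofFn a).prod ⊗ₜ (List.ofFn b).prod := by
  induction n with
  | zero => simp [Algebra.TensorProduct.one_def]
  | succ n ih =>
    simp only [List.ofFn_succ, List.prod_cons]
    rw [ih, Algebra.TensorProduct.tmul_mul_tmul]

/-- The coefficient of the product of all Grassmann variables. -/
noncomputable def topCoeff : Grassmann S m →ₗ[ℤ] S :=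
  (TensorProduct.lid ℤ S).toLinearMap ∘ₗ
    -- The functional on the exterior algebra is the determinant in degree `m` and zero in all other
    -- degrees.
    LinearMap.rTensor S (ExteriorAlgebra.liftAlternating
      (Pi.single (M := fun k => (Fin m → ℤ) [⋀^Fin k]→ₗ[ℤ] ℤ) m Matrix.detRowAlternating))

theorem topCoeff_tmul (r : Fin m → Fin m) (s : S) :
    topCoeff ((List.ofFn fun j => ExteriorAlgebra.ι ℤ (Pi.single (r j) (1 : ℤ) : Fin m → ℤ)).prod
      ⊗ₜ[ℤ] s) =
      Matrix.detRowAlternating (fun j => (Pi.single (r j) (1 : ℤ) : Fin m → ℤ)) • s := by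
  rw [← ExteriorAlgebra.ιMulti_apply]
  change TensorProduct.lid ℤ S (LinearMap.rTensor S _ (_ ⊗ₜ[ℤ] s)) = _
  rw [LinearMap.rTensor_tmul, TensorProduct.lid_tmul,
    ExteriorAlgebra.liftAlternating_apply_ιMulti, Pi.single_eq_same]

theorem det_single_perm (σ : Equiv.Perm (Fin m)) :
    Matrix.detRowAlternating (fun j => (Pi.single (σ j) (1 : ℤ) : Fin m → ℤ)) =
      (Equiv.Perm.sign σ : ℤ) := by
  have := Matrix.det_permute σ (1 : Matrix (Fin m) (Fin m) ℤ)
  rw [Matrix.det_one, mul_one, Int.cast_id] at this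
  rw [← this]
  change Matrix.det _ = _
  congr 1
  ext i j
  simp [Matrix.submatrix, Matrix.one_apply, Pi.single_apply, eq_comm]

/-- Expand over all maps choosing a row in each column. The tensor product separates the Grassmann
part from the coefficients, which keep the order of the columns; the determinant kills the
non-injective choices and gives the sign of the others. -/
theorem topCoeff_prod_column (M : Matrix (Fin m) (Fin m) S) :
    topCoeff (List.ofFn fun j => (column fun i => M i j : Grassmann S m)).prod = colDet M := by
  have h1 : (List.ofFn fun j => (column fun i => M i j : Grassmann S m)).prod =
      ∑ r : Fin m → Fin m, (List.ofFn fun j =>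
        (ExteriorAlgebra.ι ℤ (Pi.single (r j) (1 : ℤ)) ⊗ₜ[ℤ] M (r j) j : Grassmann S m)).prod := by
    have := (MultilinearMap.mkPiAlgebraFin ℤ m (Grassmann S m)).map_sum
      (fun j i => (ExteriorAlgebra.ι ℤ (Pi.single i (1 : ℤ)) ⊗ₜ[ℤ] M i j : Grassmann S m))
    simp only [MultilinearMap.mkPiAlgebraFin_apply] at this
    rw [← this]
    simp only [column, gen_mul_scal]
  rw [h1, map_sum, colDet]
  simp only [prod_tmul, topCoeff_tmul]
  symm
  refine Finset.sum_of_injOn (fun σ : Equiv.Perm (Fin m) => (σ : Fin m → Fin m))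
    (fun σ _ τ _ h => DFunLike.coe_injective h)
    (fun _ _ => Finset.mem_coe.2 (Finset.mem_univ _)) ?_ ?_
  · intro r _ hr
    rw [AlternatingMap.map_eq_zero_of_not_injective, zero_smul]
    intro hinj
    apply hr
    have hr' : Function.Injective r := by
      intro a b hab
      apply hinj
      simp only [hab]
    exact ⟨Equiv.ofBijective r (Finite.injective_iff_bijective.1 hr'), by simp, rfl⟩
  · intro σ _
    rw [det_single_perm]

theorem topCoeff_prod_gen (x : S) :
    topCoeff ((List.ofFn fun j => (gen j : Grassmann S m)).prod * scal x) = x := by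
  simp only [gen]
  rw [prod_tmul, scal_apply, Algebra.TensorProduct.tmul_mul_tmul, mul_one]
  rw [topCoeff_tmul (fun j => j)]
  have := det_single_perm (1 : Equiv.Perm (Fin m))
  simp only [Equiv.Perm.coe_one, id_eq, Equiv.Perm.sign_one, Units.val_one] at this
  rw [this]
  simp [List.ofFn_const]

end Grassmann

/-! ### Products of anticommuting elements -/

/-- The sign depends only on the sequence of transpositions, hence one `ε` serves both families. The
reordering of the columns is thus undone later on the Grassmann variables without computing it. -/
theorem perm_prod_anticomm {ι B B' : Type*} [Ring B] [Ring B'] {f : ι → B} {g : ι → B'}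
    (hf : ∀ i j, f i * f j + f j * f i = 0) (hg : ∀ i j, g i * g j + g j * g i = 0)
    {l l' : List ι} (h : l.Perm l') :
    ∃ ε : ℤ, (l.map f).prod = ε • (l'.map f).prod ∧ (l.map g).prod = ε • (l'.map g).prod := by
  induction h with
  | nil => exact ⟨1, by simp, by simp⟩
  | cons x _ ih =>
    obtain ⟨ε, h1, h2⟩ := ih
    exact ⟨ε, by simp only [List.map_cons, List.prod_cons, h1, mul_smul_comm],
      by simp only [List.map_cons, List.prod_cons, h2, mul_smul_comm]⟩
  | swap x y l =>
    refine ⟨-1, ?_, ?_⟩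
    · simp only [List.map_cons, List.prod_cons, ← mul_assoc]
      rw [eq_neg_of_add_eq_zero_left (hf y x)]
      simp
    · simp only [List.map_cons, List.prod_cons, ← mul_assoc]
      rw [eq_neg_of_add_eq_zero_left (hg y x)]
      simp
  | trans _ _ ih1 ih2 =>
    obtain ⟨ε, h1, h2⟩ := ih1
    obtain ⟨ε', h3, h4⟩ := ih2
    exact ⟨ε * ε', by rw [h1, h3, smul_smul], by rw [h2, h4, smul_smul]⟩

theorem mul_mul_eq_zero_of_anticomm {B : Type*} [Ring B] {P a b : B} (h : a * b + b * a = 0)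
    (hP : P * b = 0) : P * a * b = 0 := by
  rw [mul_assoc, eq_neg_of_add_eq_zero_left h, mul_neg, ← mul_assoc, hP, zero_mul, neg_zero]

theorem anticomm_add_add {B : Type*} [Ring B] {a s b t : B} (h1 : a * b + b * a = 0)
    (h2 : a * t + t * a = 0) (h3 : b * s + s * b = 0) (h4 : s * t + t * s = 0) :
    (a + s) * (b + t) + (b + t) * (a + s) = 0 := by
  have : (a + s) * (b + t) + (b + t) * (a + s) =
      (a * b + b * a) + (a * t + t * a) + (b * s + s * b) + (s * t + t * s) := by noncomm_ring
  rw [this, h1, h2, h3, h4]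
  simp

/-- Squares are assumed to vanish separately, because anticommutation only gives twice the square.
-/
theorem prod_mul_eq_zero {ι B : Type*} [Ring B] {f : ι → B}
    (hf : ∀ i j, f i * f j + f j * f i = 0) (hf2 : ∀ i, f i * f i = 0) {l : List ι} {a : ι}
    (ha : a ∈ l) : (l.map f).prod * f a = 0 := by
  induction l using List.reverseRecOn with
  | nil => simp at ha
  | append_singleton l b ih =>
    rw [List.map_append, List.prod_append, List.map_singleton, List.prod_singleton, mul_assoc]
    rcases List.mem_append.1 ha with ha | ha
    · rw [eq_neg_of_add_eq_zero_left (hf b a), mul_neg, ← mul_assoc, ih ha]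
      simp
    · obtain rfl : a = b := by simpa using ha
      rw [hf2, mul_zero]

theorem mul_prod_eq_zero {ι B : Type*} [Ring B] {f : ι → B}
    (hf : ∀ i j, f i * f j + f j * f i = 0) (hf2 : ∀ i, f i * f i = 0) {l : List ι} {a : ι}
    (ha : a ∈ l) : f a * (l.map f).prod = 0 := by
  induction l with
  | nil => simp at ha
  | cons b l ih =>
    rw [List.map_cons, List.prod_cons, ← mul_assoc]
    rcases List.mem_cons.1 ha with rfl | ha
    · rw [hf2, zero_mul]
    · rw [eq_neg_of_add_eq_zero_left (hf a b), neg_mul, mul_assoc, ih ha]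
      simp

end Grassmann

/-! ## The column determinant as a product of resolvents -/

open EdgeMonoid TraceSeries Grassmann

section Determinant

variable {V : Type*} [DecidableEq V] {G : Digraph V} {m : ℕ}

/-- The Grassmann variable of a vertex. -/
noncomputable def psi (x : Fin m → V) (v : V) : Grassmann (EdgeSeries V) m :=
  column fun i => delta (x i) v

/-- The combination of the Grassmann variables given by a column of the resolvent. -/
noncomputable def psiRes (G : Digraph V) (x : Fin m → V) (v : V) : Grassmann (EdgeSeries V) m :=
  column fun i => formalResolvent G (x i) v

/-- The combination of the Grassmann variables given by a column of the matrix `I + R W_p`. -/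
noncomputable def psiMat (G : Digraph V) (x : Fin m → V) (P : Finset V) (v : V) :
    Grassmann (EdgeSeries V) m :=
  if v ∈ P then psiRes G x v
  else psi x v + ∑ u ∈ P, psiRes G x u * scal (labelledMatrix G u v)

variable (x : Fin m → V)

theorem psi_sq (v : V) : psi x v * psi x v = 0 :=
  column_sq fun _ _ => delta_comm _ _ _

theorem psi_anticomm_column (v : V) (c : Fin m → EdgeSeries V) :
    psi x v * column c + column c * psi x v = 0 :=
  column_anticomm fun i k => by rw [delta_comm, delta_comm, add_comm]

theorem psi_anticomm (u v : V) : psi x u * psi x v + psi x v * psi x u = 0 :=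
  psi_anticomm_column x u _

theorem psi_anticomm_psiRes (u v : V) : psi x u * psiRes G x v + psiRes G x v * psi x u = 0 :=
  psi_anticomm_column x u _

theorem psi_apply (hx : Function.Injective x) (i : Fin m) : psi x (x i) = gen i := by
  rw [psi, column, Finset.sum_eq_single i]
  · simp [delta]
  · intro k _ hk
    have : x k ≠ x i := fun h => hk (hx h)
    simp [delta, this]
  · simp

theorem psi_comm (v : V) (s : EdgeSeries V) : psi x v * scal s = scal s * psi x v := by
  simp only [psi, column, Finset.sum_mul, Finset.mul_sum]
  refine Finset.sum_congr rfl fun i _ => ?_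
  rw [mul_assoc, ← map_mul, delta_comm, map_mul, ← mul_assoc, gen_comm, mul_assoc]

theorem prod_psi_comm (l : List V) (s : EdgeSeries V) :
    (l.map (psi x)).prod * scal s = scal s * (l.map (psi x)).prod := by
  induction l with
  | nil => simp
  | cons v l ih =>
    rw [List.map_cons, List.prod_cons, mul_assoc, ih, ← mul_assoc, psi_comm, mul_assoc]

/-- The prefix `Q` annihilates the resolvent columns of `P`, so the corrections in the other columns
drop out. The property passes to `Q * psi x v` because `psi x v` anticommutes with those columns. -/
theorem mul_prod_psiMat (P : Finset V) (rest : List V) (hrest : ∀ v ∈ rest, v ∉ P)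
    (Q : Grassmann (EdgeSeries V) m) (hQ : ∀ u ∈ P, Q * psiRes G x u = 0) :
    Q * (rest.map (psiMat G x P)).prod = Q * (rest.map (psi x)).prod := by
  induction rest generalizing Q with
  | nil => simp
  | cons v rest ih =>
    have h1 : Q * psiMat G x P v = Q * psi x v := by
      rw [psiMat, if_neg (hrest v List.mem_cons_self), mul_add, Finset.mul_sum,
        Finset.sum_eq_zero, add_zero]
      intro u hu
      rw [← mul_assoc, hQ u hu, zero_mul]
    simp only [List.map_cons, List.prod_cons]
    rw [← mul_assoc, ← mul_assoc, h1]
    exact ih (fun w hw => hrest w (List.mem_cons_of_mem _ hw)) _ fun u hu =>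
      mul_mul_eq_zero_of_anticomm (psi_anticomm_psiRes x v u) (hQ u hu)

section

variable (hG : BoundedDegree G)
include hG

theorem psiRes_anticomm (u v : V) :
    psiRes G x u * psiRes G x v + psiRes G x v * psiRes G x u = 0 := by
  refine column_anticomm fun i k => ?_
  have := wedgeCoeff_add_swap hG (x i) (x k) u v
  rw [wedgeCoeff, wedgeCoeff, sub_add_sub_comm, sub_eq_zero] at this
  exact this

theorem psiRes_sq (v : V) : psiRes G x v * psiRes G x v = 0 :=
  column_sq fun i k => sub_eq_zero.1 (wedgeCoeff_self hG (x i) (x k) v)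

theorem psiRes_mul_scal_mul (u v : V) {y : EdgeSeries V}
    (hy : ∀ k, k ≠ u → ∀ c, y * labelledMatrix G k c = labelledMatrix G k c * y) :
    psiRes G x u * scal y * psiRes G x v = psiRes G x u * psiRes G x v * scal y :=
  column_mul_scal_mul_column fun i k => wedgeCoeff_mul hG (x i) (x k) u v hy

/-- Both scalars are moved to the far right by `psiRes_mul_scal_mul`, which leaves two anticommuting
columns. They need not commute when `u = v`, but then the square of the column vanishes. -/
theorem psiRes_scal_anticomm (u v : V) {y z : EdgeSeries V}
    (hy : ∀ k, k ≠ u → ∀ c, y * labelledMatrix G k c = labelledMatrix G k c * y)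
    (hz : ∀ k, k ≠ v → ∀ c, z * labelledMatrix G k c = labelledMatrix G k c * z)
    (hyz : u ≠ v → y * z = z * y) :
    psiRes G x u * scal y * (psiRes G x v * scal z) +
      psiRes G x v * scal z * (psiRes G x u * scal y) = 0 := by
  rw [← mul_assoc, ← mul_assoc, psiRes_mul_scal_mul x hG u v hy, psiRes_mul_scal_mul x hG v u hz]
  by_cases huv : u = v
  · subst huv
    rw [psiRes_sq x hG]
    simp
  · rw [mul_assoc (_ * _), mul_assoc (_ * _), ← map_mul, ← map_mul, hyz huv, ← add_mul,
      psiRes_anticomm x hG, zero_mul]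

/-- This allows an arbitrary ordering of the vertices of `G_p`. By bilinearity it reduces to pairs
of variables, resolvent columns, and resolvent columns followed by an edge of their own row. -/
theorem psiMat_anticomm (P : Finset V) (u v : V) :
    psiMat G x P u * psiMat G x P v + psiMat G x P v * psiMat G x P u = 0 := by
  have hone : ∀ w : V, ∀ k, k ≠ w → ∀ c,
      (1 : EdgeSeries V) * labelledMatrix G k c = labelledMatrix G k c * 1 := by simp
  have hW : ∀ w d : V, ∀ k, k ≠ w → ∀ c,
      labelledMatrix G w d * labelledMatrix G k c = labelledMatrix G k c * labelledMatrix G w d :=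
    fun w d k hk c => labelledMatrix_comm (Ne.symm hk) d c
  have h1 : ∀ w w' d, psiRes G x w * (psiRes G x w' * scal (labelledMatrix G w' d)) +
      psiRes G x w' * scal (labelledMatrix G w' d) * psiRes G x w = 0 := by
    intro w w' d
    have := psiRes_scal_anticomm x hG w w' (hone w) (hW w' d) (by simp)
    simpa only [map_one, mul_one] using this
  have h2 : ∀ w w' d, psi x w * (psiRes G x w' * scal (labelledMatrix G w' d)) +
      psiRes G x w' * scal (labelledMatrix G w' d) * psi x w = 0 := by
    intro w w' d
    rw [psiRes, column_mul_scal]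
    exact psi_anticomm_column x w _
  have h3 : ∀ w d w' d', psiRes G x w * scal (labelledMatrix G w d) *
        (psiRes G x w' * scal (labelledMatrix G w' d')) +
      psiRes G x w' * scal (labelledMatrix G w' d') *
        (psiRes G x w * scal (labelledMatrix G w d)) = 0 := by
    intro w d w' d'
    exact psiRes_scal_anticomm x hG w w' (hW w d) (hW w' d') (fun h => labelledMatrix_comm h d d')
  have h4 : ∀ w d, psiRes G x w * (∑ u ∈ P, psiRes G x u * scal (labelledMatrix G u d)) +
      (∑ u ∈ P, psiRes G x u * scal (labelledMatrix G u d)) * psiRes G x w = 0 := by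
    intro w d
    rw [Finset.mul_sum, Finset.sum_mul, ← Finset.sum_add_distrib]
    exact Finset.sum_eq_zero fun u _ => h1 w u d
  have h5 : ∀ w d, psi x w * (∑ u ∈ P, psiRes G x u * scal (labelledMatrix G u d)) +
      (∑ u ∈ P, psiRes G x u * scal (labelledMatrix G u d)) * psi x w = 0 := by
    intro w d
    rw [Finset.mul_sum, Finset.sum_mul, ← Finset.sum_add_distrib]
    exact Finset.sum_eq_zero fun u _ => h2 w u d
  have h6 : (∑ w ∈ P, psiRes G x w * scal (labelledMatrix G w u)) *
        (∑ w ∈ P, psiRes G x w * scal (labelledMatrix G w v)) +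
      (∑ w ∈ P, psiRes G x w * scal (labelledMatrix G w v)) *
        (∑ w ∈ P, psiRes G x w * scal (labelledMatrix G w u)) = 0 := by
    rw [Finset.sum_mul_sum, Finset.sum_mul_sum, Finset.sum_comm, ← Finset.sum_add_distrib]
    refine Finset.sum_eq_zero fun w _ => ?_
    rw [← Finset.sum_add_distrib]
    exact Finset.sum_eq_zero fun w' _ => h3 w' u w v
  unfold psiMat
  split_ifs with hu hv hv
  · exact psiRes_anticomm x hG u v
  · rw [mul_add, add_mul, add_add_add_comm, h4, add_comm (psiRes G x u * psi x v),
      psi_anticomm_psiRes, add_zero]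
  · rw [mul_add, add_mul, add_add_add_comm, psi_anticomm_psiRes,
      add_comm (_ * psiRes G x v), h4, add_zero]
  · exact anticomm_add_add (psi_anticomm x u v) (h5 u v) (h5 v u) h6

/-- A product containing all columns indexed by `U` annihilates these columns. -/
theorem mul_psiRes_eq_zero_insert {P : Grassmann (EdgeSeries V) m} {U : Finset V} {v : V}
    (hP : ∀ u ∈ U, P * psiRes G x u = 0) :
    ∀ u ∈ insert v U, P * psiRes G x v * psiRes G x u = 0 := by
  intro u hu
  rcases Finset.mem_insert.1 hu with rfl | hu
  · rw [mul_assoc, psiRes_sq x hG, mul_zero]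
  · exact mul_mul_eq_zero_of_anticomm (psiRes_anticomm x hG v u) (hP u hu)

/-- The prefix `P` annihilates the columns of `U`, so column `v` may be replaced by that of the
graph without the rows of `U`. In the latter, entries at `U` vanish, and an entry at any other
vertex different from `v` meets the variable of that vertex further right. Only the diagonal entry
remains, and it moves to the end. -/
theorem mul_prod_psiRes (hx : Function.Injective x) (L : List V) (rest : List V) (U : Finset V)
    (P : Grassmann (EdgeSeries V) m) (hP : ∀ u ∈ U, P * psiRes G x u = 0) (hL : L.Nodup)
    (hLU : ∀ v ∈ L, v ∉ U) (hLx : ∀ v ∈ L, ∃ i, x i = v)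
    (hall : ∀ i, x i ∈ U ∨ x i ∈ L ∨ x i ∈ rest) :
    P * (L.map (psiRes G x)).prod * (rest.map (psi x)).prod =
      P * ((L ++ rest).map (psi x)).prod * scal (loopProd G U L) := by
  induction L generalizing U P with
  | nil => simp [loopProd]
  | cons v L ih =>
    rw [List.nodup_cons] at hL
    have hvU : v ∉ U := hLU v List.mem_cons_self
    have h1 := ih (insert v U) (P * psiRes G x v) (mul_psiRes_eq_zero_insert x hG hP) hL.2
      (fun w hw h => by
        rcases Finset.mem_insert.1 h with rfl | h
        · exact hL.1 hw
        · exact hLU w (List.mem_cons_of_mem _ hw) h)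
      (fun w hw => hLx w (List.mem_cons_of_mem _ hw))
      (fun i => by
        rcases hall i with h | h | h
        · exact Or.inl (Finset.mem_insert_of_mem h)
        · rcases List.mem_cons.1 h with h | h
          · exact Or.inl (by rw [h]; exact Finset.mem_insert_self _ _)
          · exact Or.inr (Or.inl h)
        · exact Or.inr (Or.inr h))
    rw [List.map_cons, List.prod_cons, ← mul_assoc, h1, List.cons_append, List.map_cons,
      List.prod_cons, loopProd, map_mul]
    have h2 : P * psiRes G x v = P * psiRes (deleteRows G U) x v := by
      obtain ⟨τ, hτ⟩ := exists_resolvent_sub hG U v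
      have h3 : psiRes G x v = psiRes (deleteRows G U) x v +
          ∑ u ∈ U, psiRes G x u * scal (τ u) := by
        simp only [psiRes, column_mul_scal]
        rw [← column_sum, ← column_add]
        congr 1
        funext i
        exact hτ (x i)
      rw [h3, mul_add, Finset.mul_sum, Finset.sum_eq_zero, add_zero]
      intro u hu
      rw [← mul_assoc, hP u hu, zero_mul]
    have h4 : psiRes (deleteRows G U) x v * ((L ++ rest).map (psi x)).prod =
        psi x v * ((L ++ rest).map (psi x)).prod *
          scal (formalResolvent (deleteRows G U) v v) := by
      obtain ⟨i, hi⟩ := hLx v List.mem_cons_self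
      rw [psiRes, column, Finset.sum_mul, Finset.sum_eq_single i]
      · rw [hi, mul_assoc, ← prod_psi_comm, ← mul_assoc, ← psi_apply x hx, hi]
      · intro k _ hk
        have hkv : x k ≠ v := fun h => hk (hx (h.trans hi.symm))
        by_cases hkU : x k ∈ U
        · rw [formalResolvent_deleteRows_of_mem hG hkU, delta, if_neg hkv]
          simp
        · have hmem : x k ∈ L ++ rest := by
            rcases hall k with h | h | h
            · exact absurd h hkU
            · exact List.mem_append_left _ ((List.mem_cons.1 h).resolve_left hkv)
            · exact List.mem_append_right _ h
          rw [mul_assoc, ← prod_psi_comm, ← mul_assoc, ← psi_apply x hx,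
            mul_prod_eq_zero (psi_anticomm x) (psi_sq x) hmem, zero_mul]
      · simp
    rw [h2, mul_assoc P, h4]
    simp only [mul_assoc]

/-- The product of the columns of `I + R W_p`, in any order. -/
theorem topCoeff_prod_psiMat (hx : Function.Injective x) {L : List V} (hL : L.Nodup)
    (hLx : ∀ v ∈ L, ∃ i, x i = v) :
    topCoeff (List.ofFn fun i => psiMat G x L.toFinset (x i)).prod = loopProd G ∅ L := by
  set l := List.ofFn x with hl
  set rest := l.filter (fun v => v ∉ L) with hrest
  have hmem : ∀ v, v ∈ l ↔ ∃ i, x i = v := fun v => by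
    rw [hl, List.mem_ofFn]
  have hperm : l.Perm (L ++ rest) := by
    rw [List.perm_ext_iff_of_nodup (List.nodup_ofFn.2 hx)]
    · intro v
      rw [List.mem_append, hrest, List.mem_filter]
      by_cases hv : v ∈ L
      · simp [hv, hmem, hLx v hv]
      · simp only [hv, false_or, not_false_eq_true, decide_true, and_true]
        exact Iff.rfl
    · refine List.nodup_append.2 ⟨hL, (List.nodup_ofFn.2 hx).filter _, ?_⟩
      rintro a ha b hb rfl
      simp [hrest, ha] at hb
  have hmap : ∀ f : V → Grassmann (EdgeSeries V) m,
      (List.ofFn fun i => f (x i)).prod = (l.map f).prod := by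
    intro f
    rw [hl, List.map_ofFn]
    rfl
  have key : ((L ++ rest).map (psiMat G x L.toFinset)).prod =
      ((L ++ rest).map (psi x)).prod * scal (loopProd G ∅ L) := by
    have h1 : (L.map (psiMat G x L.toFinset)).prod = (L.map (psiRes G x)).prod := by
      congr 1
      refine List.map_congr_left fun v hv => ?_
      rw [psiMat, if_pos (List.mem_toFinset.2 hv)]
    rw [List.map_append, List.prod_append, h1, mul_prod_psiMat x]
    · have := mul_prod_psiRes x hG hx L rest ∅ 1 (by simp) hL (by simp) hLx (fun i => by
        by_cases hi : x i ∈ L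
        · exact Or.inr (Or.inl hi)
        · right; right
          rw [hrest, List.mem_filter]
          exact ⟨(hmem _).2 ⟨i, rfl⟩, by simpa using hi⟩)
      simpa only [one_mul] using this
    · intro v hv
      rw [hrest, List.mem_filter] at hv
      simpa using hv.2
    · intro u hu
      exact prod_mul_eq_zero (psiRes_anticomm x hG) (psiRes_sq x hG) (List.mem_toFinset.1 hu)
  -- The common sign brings the variables back from the order `L ++ rest` to the original one.
  obtain ⟨ε, h1, h2⟩ := perm_prod_anticomm (psiMat_anticomm x hG L.toFinset) (psi_anticomm x) hperm
  rw [hmap, h1, key, ← smul_mul_assoc, ← h2, ← hmap]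
  simp only [psi_apply x hx]
  exact topCoeff_prod_gen _

end

omit [DecidableEq V] in
theorem mem_gpVerts {hG : BoundedDegree G} {p : SimpleCycle G} {v : V} :
    v ∈ gpVerts hG p ↔ v ∈ p.1 ∨ ∃ u ∈ p.1, G.Adj u v ∨ G.Adj v u := by
  rw [gpVerts, Set.Finite.mem_toFinset]; rfl

/-- In a column on `p`, `W_p` has all edges of `W` and their origins lie in `G_p`, so `I + R W = R`
applies. In a column off `p`, only the rows of `p` survive in `W_p`. -/
theorem colDet_eq_loopProd (hG : BoundedDegree G) (p : SimpleCycle G) {L : List V} (hL : L.Nodup)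
    (hp : ∀ v, v ∈ L ↔ v ∈ p.1) (e : Fin m ≃ gpVerts hG p) :
    colDet ((1 + restrictTo (gpVerts hG p) (formalResolvent G) *
      restrictTo (gpVerts hG p) (touching p (labelledMatrix G))).submatrix e e) =
      loopProd G ∅ L := by
  classical
  set x : Fin m → V := fun i => e i with hxdef
  have hx : Function.Injective x := Subtype.val_injective.comp e.injective
  have hxs : ∀ v ∈ gpVerts hG p, ∃ i, x i = v := fun v hv => ⟨e.symm ⟨v, hv⟩, by simp [hxdef]⟩
  rw [← topCoeff_prod_psiMat x hG hx hL
    (fun v hv => hxs v (mem_gpVerts.2 (Or.inl ((hp v).1 hv)))), ← topCoeff_prod_column]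
  congr 3
  funext j
  have hcol : ∀ i, ((1 + restrictTo (gpVerts hG p) (formalResolvent G) *
      restrictTo (gpVerts hG p) (touching p (labelledMatrix G))).submatrix e e) i j =
      delta (x i) (x j) + ∑ k ∈ gpVerts hG p, formalResolvent G (x i) k *
        touching p (labelledMatrix G) k (x j) := by
    intro i
    rw [Matrix.submatrix_apply, Matrix.add_apply, Matrix.mul_apply]
    congr 1
    · rw [Matrix.one_apply, delta]
      simp [hxdef]
    · exact Finset.sum_coe_sort (gpVerts hG p) (fun k => formalResolvent G (x i) k *
        touching p (labelledMatrix G) k (x j))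
  simp only [hcol]
  rw [psiMat]
  by_cases hj : x j ∈ p.1
  · rw [if_pos (List.mem_toFinset.2 ((hp _).2 hj)), psiRes]
    congr 1
    funext i
    have h1 : ∀ k, touching p (labelledMatrix G) k (x j) = labelledMatrix G k (x j) := fun k => by
      rw [touching, if_pos (Or.inr hj)]
    simp only [h1]
    rw [sum_resolvent_mul hG]
    · abel
    · exact fun k hk => mem_gpVerts.2 (Or.inr ⟨x j, hj, Or.inr hk⟩)
  · rw [if_neg (fun h => hj ((hp _).1 (List.mem_toFinset.1 h))), psi]
    simp only [psiRes, column_mul_scal]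
    rw [← column_sum, ← column_add]
    congr 1
    funext i
    congr 1
    symm
    apply Finset.sum_subset_zero_on_sdiff
    · exact fun v hv => mem_gpVerts.2 (Or.inl ((hp v).1 (List.mem_toFinset.1 hv)))
    · intro v hv
      rw [Finset.mem_sdiff, List.mem_toFinset, hp] at hv
      rw [touching, if_neg (by tauto), mul_zero]
    · intro v hv
      rw [touching, if_pos (Or.inl ((hp v).1 (List.mem_toFinset.1 hv)))]

end Determinant

/-! ## Evaluation of formal series -/

open EdgeMonoid TraceSeries

section Evaluation

variable {V : Type*} {K : Type*} [CommRing K]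

/-- The weight of an element of the edge monoid. -/
def EdgeMonoid.weight (wt : V → V → K) : EdgeMonoid V →* K :=
  TraceMonoid.lift (fun e => wt e.1 e.2) (fun _ _ _ => mul_comm _ _)

theorem EdgeMonoid.weight_edge (wt : V → V → K) (i j : V) :
    EdgeMonoid.weight wt (edge i j) = wt i j :=
  TraceMonoid.lift_of _ _ _

theorem EdgeMonoid.weight_eq (wt : V → V → K) (t : EdgeMonoid V) :
    EdgeMonoid.weight wt t =
      ((TraceMonoid.content t).toAdd.map fun e => wt e.1 e.2).prod := by
  induction t using TraceMonoid.induction_left with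
  | one => simp
  | of_mul a t ih =>
    obtain ⟨i, j⟩ := a
    change EdgeMonoid.weight wt (edge i j * t) =
      ((TraceMonoid.content (edge i j * t)).toAdd.map fun e => wt e.1 e.2).prod
    rw [map_mul, map_mul, toAdd_mul, content_edge, ih, weight_edge]
    simp

theorem EdgeMonoid.weight_edgeProd (wt : V → V → K) (l : List V) :
    EdgeMonoid.weight wt (edgeProd l) = (List.zipWith wt l l.tail).prod := by
  induction l with
  | nil => simp
  | cons x l ih =>
    cases l with
    | nil => simp
    | cons y l =>
      rw [edgeProd_cons_cons, map_mul, weight_edge, ih]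
      simp

variable {G : Digraph V}

theorem SimpleCycle.weight_eq (wt : V → V → K) (c : SimpleCycle G) :
    c.weight wt = EdgeMonoid.weight wt c.toEdges := by
  rw [EdgeMonoid.weight_eq, content_toEdges, SimpleCycle.weight]

theorem SimpleCycle.length_eq (c : SimpleCycle G) : c.1.length = len c.toEdges := by
  rw [len, content_toEdges, ← Multiset.card_map Prod.fst, cycleEdges_fst, Cycle.card_toMultiset]

theorem Hike.weight_eq (wt : V → V → K) (h : Hike G) :
    h.weight wt = EdgeMonoid.weight wt (Hike.toEdges h) := by
  induction h using TraceMonoid.induction_left with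
  | one => simp [Hike.weight]
  | of_mul c h ih =>
    rw [map_mul, map_mul, ← ih, toEdges_of, ← c.weight_eq]
    simp [Hike.weight]

theorem Hike.length_eq (h : Hike G) : h.length = len (Hike.toEdges h) := by
  induction h using TraceMonoid.induction_left with
  | one => simp [Hike.length]
  | of_mul c h ih =>
    rw [map_mul, len_mul, ← ih, toEdges_of, ← c.length_eq]
    simp [Hike.length]

/-- The generating function of a formal series. -/
noncomputable def evalSeries (wt : V → V → K) (f : EdgeSeries V) : PowerSeries K :=
  -- The sum is zero by convention if its support is infinite, so evaluation is well behaved only on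
  -- series of finite type.
  PowerSeries.mk fun n => ∑ᶠ t ∈ {t : EdgeMonoid V | len t = n}, f t • EdgeMonoid.weight wt t

theorem coeff_evalSeries (wt : V → V → K) (f : EdgeSeries V) (n : ℕ) (A : Finset (EdgeMonoid V))
    (hA : ∀ t ∈ A, len t = n) (hf : ∀ t, len t = n → f t ≠ 0 → t ∈ A) :
    PowerSeries.coeff n (evalSeries wt f) = ∑ t ∈ A, f t • EdgeMonoid.weight wt t := by
  rw [evalSeries, PowerSeries.coeff_mk]
  apply finsum_mem_eq_sum_of_inter_support_eq
  ext t
  simp only [Set.mem_inter_iff, Set.mem_ofPred_eq, Function.mem_support, Finset.mem_coe]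
  constructor
  · rintro ⟨h1, h2⟩
    exact ⟨hf t h1 (fun h => h2 (by rw [h, zero_smul])), h2⟩
  · rintro ⟨h1, h2⟩
    exact ⟨hA t h1, h2⟩

/-- The series with finitely many terms of each length. -/
def FiniteType (f : EdgeSeries V) : Prop := ∀ n, {t : EdgeMonoid V | len t = n ∧ f t ≠ 0}.Finite

theorem FiniteType.zero : FiniteType (0 : EdgeSeries V) := fun n => by
  simp [zero_apply]

theorem FiniteType.single (s : EdgeMonoid V) : FiniteType (single s : EdgeSeries V) := fun n => by
  refine (Set.finite_singleton s).subset ?_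
  rintro t ⟨-, h⟩
  rw [single_eq_ind, ind_apply] at h
  by_contra hne
  exact h (if_neg hne)

theorem FiniteType.add {f g : EdgeSeries V} (hf : FiniteType f) (hg : FiniteType g) :
    FiniteType (f + g) := fun n => by
  refine ((hf n).union (hg n)).subset ?_
  rintro t ⟨h1, h2⟩
  rw [add_apply] at h2
  by_cases h : f t = 0
  · right; exact ⟨h1, fun h' => h2 (by rw [h, h', add_zero])⟩
  · left; exact ⟨h1, h⟩

theorem FiniteType.neg {f : EdgeSeries V} (hf : FiniteType f) : FiniteType (-f) := fun n => by
  refine (hf n).subset ?_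
  rintro t ⟨h1, h2⟩
  exact ⟨h1, fun h => h2 (show -(f t) = 0 by rw [h, neg_zero])⟩

open Classical in
/-- The pairs contributing to the terms of length `n` of a product. -/
theorem exists_pairs {f g : EdgeSeries V} (hf : FiniteType f) (hg : FiniteType g) (n : ℕ) :
    ∃ D : Finset (EdgeMonoid V × EdgeMonoid V), ∀ x, x ∈ D ↔
      len x.1 + len x.2 = n ∧ f x.1 ≠ 0 ∧ g x.2 ≠ 0 := by
  refine ⟨(Finset.HasAntidiagonal.antidiagonal n).biUnion fun a =>
    (hf a.1).toFinset ×ˢ (hg a.2).toFinset, fun x => ?_⟩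
  simp only [Finset.mem_biUnion, Finset.HasAntidiagonal.mem_antidiagonal, Finset.mem_product,
    Set.Finite.mem_toFinset, Set.mem_ofPred_eq]
  constructor
  · rintro ⟨a, h1, ⟨h2, h3⟩, h4, h5⟩
    exact ⟨by rw [h2, h4, h1], h3, h5⟩
  · rintro ⟨h1, h2, h3⟩
    exact ⟨(len x.1, len x.2), h1, ⟨rfl, h2⟩, rfl, h3⟩

theorem exists_factors_of_mul_ne_zero {f g : EdgeSeries V} {t : EdgeMonoid V}
    (h : (f * g) t ≠ 0) : ∃ x : EdgeMonoid V × EdgeMonoid V,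
      x.1 * x.2 = t ∧ f x.1 ≠ 0 ∧ g x.2 ≠ 0 := by
  rw [mul_apply] at h
  obtain ⟨x, hx, hne⟩ := Finset.exists_ne_zero_of_sum_ne_zero h
  exact ⟨x, TraceMonoid.mem_factorizations.1 hx, left_ne_zero_of_mul hne,
    right_ne_zero_of_mul hne⟩

theorem FiniteType.mul {f g : EdgeSeries V} (hf : FiniteType f) (hg : FiniteType g) :
    FiniteType (f * g) := fun n => by
  obtain ⟨D, hD⟩ := exists_pairs hf hg n
  refine ((D.finite_toSet).image fun x => x.1 * x.2).subset ?_
  rintro t ⟨h1, h2⟩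
  obtain ⟨x, rfl, h3, h4⟩ := exists_factors_of_mul_ne_zero h2
  exact ⟨x, (hD x).2 ⟨by rw [← len_mul, h1], h3, h4⟩, rfl⟩

theorem evalSeries_add (wt : V → V → K) {f g : EdgeSeries V} (hf : FiniteType f)
    (hg : FiniteType g) : evalSeries wt (f + g) = evalSeries wt f + evalSeries wt g := by
  classical
  ext n
  have hu : ∀ t ∈ (hf n).toFinset ∪ (hg n).toFinset, len t = n := by
    intro t ht
    simp only [Finset.mem_union, Set.Finite.mem_toFinset, Set.mem_ofPred_eq] at ht
    tauto
  have h1 : ∀ t, len t = n → f t ≠ 0 → t ∈ (hf n).toFinset ∪ (hg n).toFinset := by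
    intro t h1 h2
    simp [h1, h2]
  have h2 : ∀ t, len t = n → g t ≠ 0 → t ∈ (hf n).toFinset ∪ (hg n).toFinset := by
    intro t h1 h2
    simp [h1, h2]
  rw [map_add, coeff_evalSeries wt f n _ hu h1, coeff_evalSeries wt g n _ hu h2,
    coeff_evalSeries wt (f + g) n _ hu, ← Finset.sum_add_distrib]
  · exact Finset.sum_congr rfl fun t _ => by rw [add_apply, add_smul]
  · intro t ht hne
    by_cases h : f t = 0
    · exact h2 t ht fun h' => hne (by rw [add_apply, h, h', add_zero])
    · exact h1 t ht h

/-- The same finite set of pairs is grouped by the product on one side and by the two lengths on the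
other. -/
theorem evalSeries_mul (wt : V → V → K) {f g : EdgeSeries V} (hf : FiniteType f)
    (hg : FiniteType g) : evalSeries wt (f * g) = evalSeries wt f * evalSeries wt g := by
  classical
  ext n
  obtain ⟨D, hD⟩ := exists_pairs hf hg n
  have hlhs : PowerSeries.coeff n (evalSeries wt (f * g)) =
      ∑ x ∈ D, (f x.1 * g x.2) • EdgeMonoid.weight wt (x.1 * x.2) := by
    rw [coeff_evalSeries wt (f * g) n (D.image fun x => x.1 * x.2)]
    · rw [← Finset.sum_fiberwise_of_maps_to
        (g := fun x : EdgeMonoid V × EdgeMonoid V => x.1 * x.2)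
        (fun x hx => Finset.mem_image_of_mem _ hx)]
      refine Finset.sum_congr rfl fun t ht => ?_
      rw [mul_apply, Finset.sum_smul]
      symm
      apply Finset.sum_subset_zero_on_sdiff
      · intro x hx
        rw [Finset.mem_filter] at hx
        exact TraceMonoid.mem_factorizations.2 hx.2
      · intro x hx
        rw [Finset.mem_sdiff, TraceMonoid.mem_factorizations, Finset.mem_filter] at hx
        obtain ⟨y, hy, hyt⟩ := Finset.mem_image.1 ht
        have hlen : len x.1 + len x.2 = n := by
          rw [← len_mul, hx.1, ← hyt, len_mul]
          exact ((hD y).1 hy).1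
        by_cases h1 : f x.1 = 0
        · rw [h1, zero_mul, zero_smul]
        · by_cases h2 : g x.2 = 0
          · rw [h2, mul_zero, zero_smul]
          · exact absurd ⟨(hD x).2 ⟨hlen, h1, h2⟩, hx.1⟩ hx.2
      · intro x hx
        rw [(Finset.mem_filter.1 hx).2]
    · intro t ht
      obtain ⟨y, hy, rfl⟩ := Finset.mem_image.1 ht
      rw [len_mul]
      exact ((hD y).1 hy).1
    · intro t ht hne
      obtain ⟨x, rfl, h3, h4⟩ := exists_factors_of_mul_ne_zero hne
      exact Finset.mem_image_of_mem _ ((hD x).2 ⟨by rw [← len_mul, ht], h3, h4⟩)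
  rw [hlhs, PowerSeries.coeff_mul, ← Finset.sum_fiberwise_of_maps_to
    (g := fun x : EdgeMonoid V × EdgeMonoid V => (len x.1, len x.2))
    (t := Finset.HasAntidiagonal.antidiagonal n)
    (fun x hx => Finset.HasAntidiagonal.mem_antidiagonal.2 ((hD x).1 hx).1)]
  refine Finset.sum_congr rfl fun a ha => ?_
  rw [coeff_evalSeries wt f a.1 (hf a.1).toFinset
      (fun t ht => by simpa using (by simpa using ht : _ ∧ _).1)
    (fun t h1 h2 => by simp [h1, h2]),
    coeff_evalSeries wt g a.2 (hg a.2).toFinset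
      (fun t ht => by simpa using (by simpa using ht : _ ∧ _).1)
    (fun t h1 h2 => by simp [h1, h2]), Finset.sum_mul_sum, ← Finset.sum_product']
  refine Finset.sum_congr ?_ ?_
  · ext x
    rw [Finset.mem_filter, hD, Finset.mem_product]
    simp only [Set.Finite.mem_toFinset, Set.mem_ofPred_eq]
    rw [Finset.HasAntidiagonal.mem_antidiagonal] at ha
    constructor
    · rintro ⟨⟨-, h1, h2⟩, rfl⟩
      exact ⟨⟨rfl, h1⟩, rfl, h2⟩
    · rintro ⟨⟨h1, h2⟩, h3, h4⟩
      exact ⟨⟨by rw [h1, h3, ha], h2, h4⟩, Prod.ext h1 h3⟩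
  · intro x _
    rw [map_mul, smul_mul_smul_comm]

theorem evalSeries_single (wt : V → V → K) (s : EdgeMonoid V) :
    evalSeries wt (single s) =
      PowerSeries.C (EdgeMonoid.weight wt s) * PowerSeries.X ^ len s := by
  classical
  ext n
  rw [PowerSeries.coeff_C_mul, PowerSeries.coeff_X_pow]
  by_cases hn : n = len s
  · rw [coeff_evalSeries wt _ n {s} (by simp [hn]), if_pos hn, mul_one]
    · simp [single_eq_ind, ind_apply]
    · intro t _ h
      rw [single_eq_ind, ind_apply] at h
      by_contra hne
      exact h (if_neg fun h' => hne (Finset.mem_singleton.2 h'))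
  · rw [coeff_evalSeries wt _ n ∅ (by simp), if_neg hn, mul_zero, Finset.sum_empty]
    intro t ht h
    rw [single_eq_ind, ind_apply] at h
    exfalso
    exact h (if_neg fun h' => hn (by rw [← ht, h']))

theorem evalSeries_one (wt : V → V → K) : evalSeries wt (1 : EdgeSeries V) = 1 := by
  have := evalSeries_single wt (1 : EdgeMonoid V)
  rw [map_one, len_one, pow_zero, mul_one, map_one] at this
  exact this

theorem evalSeries_zero (wt : V → V → K) : evalSeries wt (0 : EdgeSeries V) = 0 := by
  ext n
  rw [coeff_evalSeries wt 0 n ∅ (by simp) (fun t _ h => absurd (zero_apply t) h)]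
  simp

variable (V) in
/-- The ring of series with finitely many terms of each length. -/
noncomputable def finiteTypeSubring : Subring (EdgeSeries V) where
  carrier := {f | FiniteType f}
  mul_mem' := FiniteType.mul
  one_mem' := FiniteType.single 1
  add_mem' := FiniteType.add
  zero_mem' := FiniteType.zero
  neg_mem' := FiniteType.neg

/-- Evaluation as a morphism of rings. -/
noncomputable def evalHom (wt : V → V → K) : finiteTypeSubring V →+* PowerSeries K where
  toFun f := evalSeries wt f.1
  map_one' := evalSeries_one wt
  map_zero' := evalSeries_zero wt
  map_add' f g := evalSeries_add wt f.2 g.2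
  map_mul' f g := evalSeries_mul wt f.2 g.2

theorem map_colDet {S T : Type*} [Ring S] [Ring T] (φ : S →+* T) {n : ℕ}
    (M : Matrix (Fin n) (Fin n) S) : φ (colDet M) = colDet (M.map φ) := by
  simp only [colDet, map_sum, map_zsmul, map_list_prod, List.map_ofFn]
  rfl

theorem colDet_eq_det {S : Type*} [CommRing S] {n : ℕ} (M : Matrix (Fin n) (Fin n) S) :
    colDet M = M.det := by
  rw [colDet, Matrix.det_apply]
  refine Finset.sum_congr rfl fun σ _ => ?_
  rw [List.prod_ofFn, Units.smul_def]

end Evaluation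

/-! ## Generating functions of closed walks -/

open EdgeMonoid TraceSeries

section GeneratingFunctions

variable {V : Type*} [DecidableEq V] {K : Type*} [CommRing K] {G : Digraph V}

omit [DecidableEq V] in
theorem finite_walks (hG : BoundedDegree G) (n : ℕ) (i : V) :
    {l : List V | l.head? = some i ∧ l.IsChain G.Adj ∧ l.length = n + 1}.Finite := by
  induction n generalizing i with
  | zero =>
    refine (Set.finite_singleton [i]).subset ?_
    rintro l ⟨h1, -, h2⟩
    obtain ⟨l, rfl⟩ := List.head?_eq_some_iff.1 h1
    have : l = [] := List.length_eq_zero_iff.1 (by simpa using h2)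
    rw [this]; rfl
  | succ n ih =>
    refine (((hG.finite_out i).biUnion fun k _ => ih k).image (List.cons i)).subset ?_
    rintro l ⟨h1, h2, h3⟩
    obtain ⟨l, rfl⟩ := List.head?_eq_some_iff.1 h1
    cases l with
    | nil => simp at h3
    | cons k l =>
      rw [List.isChain_cons_cons] at h2
      exact ⟨k :: l, Set.mem_biUnion (x := k) h2.1 ⟨rfl, h2.2, by simpa using h3⟩, rfl⟩

theorem finiteType_formalResolvent (hG : BoundedDegree G) (i j : V) :
    FiniteType (formalResolvent G i j) := fun n => by
  refine ((finite_walks hG n i).image edgeProd).subset ?_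
  rintro t ⟨h1, h2⟩
  rw [formalResolvent_eq hG, ind_apply] at h2
  obtain ⟨l, hl, rfl⟩ : t ∈ edgeProd '' walks G i j := by
    by_contra h
    exact h2 (if_neg h)
  refine ⟨l, ⟨hl.1, hl.2.2, ?_⟩, rfl⟩
  obtain ⟨l, rfl⟩ := List.head?_eq_some_iff.1 hl.1
  rw [len_edgeProd] at h1
  simpa using h1

omit [DecidableEq V] in
theorem finiteType_labelledMatrix (i j : V) : FiniteType (labelledMatrix G i j) := by
  by_cases h : G.Adj i j
  · rw [labelledMatrix_of_adj h]
    exact FiniteType.single _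
  · rw [labelledMatrix_of_not_adj h]
    exact FiniteType.zero

omit [DecidableEq V] in
theorem evalSeries_labelledMatrix (wt : V → V → K) (i j : V) :
    evalSeries wt (labelledMatrix G i j) =
      PowerSeries.C (edgeMatrix G wt i j) * PowerSeries.X := by
  by_cases h : G.Adj i j
  · rw [labelledMatrix_of_adj h, evalSeries_single, weight_edge, len_edge, pow_one]
    simp [edgeMatrix, h]
  · rw [labelledMatrix_of_not_adj h, evalSeries_zero]
    simp [edgeMatrix, h]

omit [DecidableEq V] in
theorem evalSeries_sum (wt : V → V → K) (T : Finset V) (f : V → EdgeSeries V)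
    (hf : ∀ k, FiniteType (f k)) :
    evalSeries wt (∑ k ∈ T, f k) = ∑ k ∈ T, evalSeries wt (f k) := by
  have := map_sum (evalHom wt) (fun k => (⟨f k, hf k⟩ : finiteTypeSubring V)) T
  rw [← show (evalHom wt) (∑ k ∈ T, (⟨f k, hf k⟩ : finiteTypeSubring V)) =
    evalSeries wt (∑ k ∈ T, f k) from ?_]
  · exact this
  · change evalSeries wt ((∑ k ∈ T, (⟨f k, hf k⟩ : finiteTypeSubring V) : finiteTypeSubring V) :
      EdgeSeries V) = _
    rw [AddSubmonoidClass.coe_finsetSum]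

/-- Evaluating `R = I + W R` gives the recursion that defines the powers of `A`, one coefficient at
a time. -/
theorem evalSeries_formalResolvent (hG : BoundedDegree G) (wt : V → V → K) (i j : V) :
    evalSeries wt (formalResolvent G i j) = resolventGF (edgeMatrix G wt) i j := by
  classical
  have hrec : ∀ i, evalSeries wt (formalResolvent G i j) = (if i = j then 1 else 0) +
      ∑ k ∈ (hG.finite_out i).toFinset, PowerSeries.C (edgeMatrix G wt i k) *
        evalSeries wt (formalResolvent G k j) * PowerSeries.X := by
    intro i
    have hW : ∀ k, FiniteType (labelledMatrix G i k * formalResolvent G k j) := fun k =>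
      (finiteType_labelledMatrix i k).mul (finiteType_formalResolvent hG k j)
    have h1 : FiniteType (if i = j then 1 else 0 : EdgeSeries V) := by
      split_ifs
      · exact FiniteType.single 1
      · exact FiniteType.zero
    have h2 : FiniteType (∑ k ∈ (hG.finite_out i).toFinset,
        labelledMatrix G i k * formalResolvent G k j) :=
      (finiteTypeSubring V).sum_mem fun k _ => hW k
    rw [formalResolvent_left hG i j (T := (hG.finite_out i).toFinset)
      (fun k hk => by simpa using hk), evalSeries_add wt h1 h2, evalSeries_sum wt _ _ hW]
    congr 1
    · split_ifs
      · exact evalSeries_one wt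
      · exact evalSeries_zero wt
    · refine Finset.sum_congr rfl fun k _ => ?_
      rw [evalSeries_mul wt (finiteType_labelledMatrix i k) (finiteType_formalResolvent hG k j),
        evalSeries_labelledMatrix]
      ring
  ext n
  rw [resolventGF, PowerSeries.coeff_mk]
  induction n generalizing i with
  | zero =>
    rw [hrec, map_add, map_sum, Finset.sum_eq_zero, add_zero]
    · simp only [matPow]
      split_ifs <;> simp
    · intro k _
      rw [PowerSeries.coeff_zero_mul_X]
  | succ n ih =>
    rw [hrec, map_add, map_sum]
    simp only [PowerSeries.coeff_succ_mul_X, PowerSeries.coeff_C_mul, ih]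
    have h0 : PowerSeries.coeff (n + 1) (if i = j then 1 else 0 : PowerSeries K) = 0 := by
      split_ifs
      · rw [PowerSeries.coeff_one, if_neg (Nat.succ_ne_zero n)]
      · simp
    rw [h0, zero_add]
    change _ = ∑ᶠ k, edgeMatrix G wt i k * matPow (edgeMatrix G wt) n k j
    rw [finsum_eq_sum_of_support_subset]
    intro k hk
    rw [Function.mem_support] at hk
    by_contra hcon
    apply hk
    have : ¬ G.Adj i k := by simpa using hcon
    simp [edgeMatrix, this]

theorem finite_rootedWalks (hG : BoundedDegree G) (p : SimpleCycle G) (v : V) (n : ℕ) :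
    (rootedWalks p v n).Finite :=
  (finite_walks hG n v).subset fun _ hl => ⟨hl.2.1, hl.2.2.2.1, hl.1⟩

/-- Closed walks of length `n` read from a vertex of `p` correspond to hikes of length `n`. -/
theorem bijOn_rootedWalks (p : SimpleCycle G) {v : V} (hv : v ∈ p.1) (n : ℕ) :
    Set.BijOn (eraseHike G) (rootedWalks p v n)
      {h : Hike G | h.IsWalkWithLast p ∧ h.length = n} := by
  have hb := bijOn_eraseHike p hv
  -- A walk with `n` edges is a list of `n + 1` vertices.
  have hlen : ∀ l ∈ closedWalks G v, (eraseHike G l).length + 1 = l.length := by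
    intro l hl
    rw [Hike.length_eq, toEdges_eraseHike hl, len_edgeProd]
    obtain ⟨l, rfl⟩ := List.head?_eq_some_iff.1 hl.1
    simp
  refine ⟨?_, ?_, ?_⟩
  · rintro l ⟨h1, h2, h3, h4, h5⟩
    have hl : l ∈ closedWalks G v := ⟨h2, h3, h4⟩
    have := hlen l hl
    exact ⟨hb.mapsTo ⟨hl, h5⟩, by omega⟩
  · rintro a ⟨-, a2, a3, a4, a5⟩ b ⟨-, b2, b3, b4, b5⟩ hab
    exact hb.injOn ⟨⟨a2, a3, a4⟩, a5⟩ ⟨⟨b2, b3, b4⟩, b5⟩ hab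
  · rintro h ⟨h1, h2⟩
    obtain ⟨l, ⟨hl, h5⟩, rfl⟩ := hb.surjOn h1
    have := hlen l hl
    exact ⟨l, ⟨by omega, hl.1, hl.2.1, hl.2.2, h5⟩, rfl⟩

theorem finite_walkHikes (hG : BoundedDegree G) (p : SimpleCycle G) (n : ℕ) :
    {h : Hike G | h.IsWalkWithLast p ∧ h.length = n}.Finite := by
  obtain ⟨v, hv⟩ := p.exists_mem
  rw [← (bijOn_rootedWalks p hv n).image_eq]
  exact (finite_rootedWalks hG p v n).image _

theorem rootedWalkGF_eq (wt : V → V → K) (p : SimpleCycle G) {v : V} (hv : v ∈ p.1) :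
    rootedWalkGF wt p v = walkGF wt p := by
  ext n
  rw [rootedWalkGF, walkGF, PowerSeries.coeff_mk, PowerSeries.coeff_mk]
  refine finsum_mem_eq_of_bijOn _ (bijOn_rootedWalks p hv n) fun l hl => ?_
  rw [Hike.weight_eq, toEdges_eraseHike (v := v) ⟨hl.2.1, hl.2.2.1, hl.2.2.2.1⟩, weight_edgeProd]

/-- Since hikes are determined by their edges, summing over elements of the edge monoid is the same
as summing over hikes. -/
theorem evalSeries_walkSeries (hG : BoundedDegree G) (wt : V → V → K) (p : SimpleCycle G) :
    evalSeries wt (walkSeries p) = walkGF wt p := by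
  classical
  ext n
  have hfin := (finite_walkHikes hG p n).image (Hike.toEdges (G := G))
  rw [walkSeries_eq_ind, coeff_evalSeries wt _ n hfin.toFinset]
  · rw [walkGF, PowerSeries.coeff_mk]
    have h1 : ∑ t ∈ hfin.toFinset, ind (Hike.toEdges '' {h : Hike G | h.IsWalkWithLast p}) t •
        EdgeMonoid.weight wt t = ∑ t ∈ hfin.toFinset, EdgeMonoid.weight wt t := by
      refine Finset.sum_congr rfl fun t ht => ?_
      rw [Set.Finite.mem_toFinset] at ht
      obtain ⟨h, hh, rfl⟩ := ht
      rw [ind_apply, if_pos ⟨h, hh.1, rfl⟩, one_smul]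
    rw [h1, ← finsum_mem_eq_finite_toFinset_sum _ hfin,
      finsum_mem_image Hike.toEdges_injective.injOn]
    refine finsum_mem_congr rfl fun h _ => ?_
    rw [Hike.weight_eq]
  · intro t ht
    rw [Set.Finite.mem_toFinset] at ht
    obtain ⟨h, hh, rfl⟩ := ht
    rw [← Hike.length_eq, hh.2]
  · intro t ht hne
    rw [ind_apply] at hne
    obtain ⟨h, hh, rfl⟩ : t ∈ Hike.toEdges '' {h : Hike G | h.IsWalkWithLast p} := by
      by_contra hcon
      exact hne (if_neg hcon)
    rw [Set.Finite.mem_toFinset]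
    exact ⟨h, ⟨hh, by rw [Hike.length_eq, ht]⟩, rfl⟩

theorem walkSeries_eq_colDet (hG : BoundedDegree G) (p : SimpleCycle G) (m : ℕ)
    (e : Fin m ≃ gpVerts hG p) :
    walkSeries p =
      colDet ((1 + restrictTo (gpVerts hG p) (formalResolvent G) *
        restrictTo (gpVerts hG p) (touching p (labelledMatrix G))).submatrix e e) *
      TraceSeries.single p.toEdges := by
  obtain ⟨v, hv⟩ := p.exists_mem
  obtain ⟨a, h1, h2, -⟩ := p.exists_rep hv
  have hp : ∀ w, w ∈ v :: a ↔ w ∈ p.1 := fun w => by rw [h1]; rfl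
  rw [walkSeries_eq_loopProd hG p hp, colDet_eq_loopProd hG p h2 hp e]

/-- The formal identity is evaluated. The matrices are first lifted to the subring of series of
finite type, on which evaluation is a ring morphism and so commutes with the column determinant. In
`K[[z]]` this is the usual determinant, and the ordering of `G_p` no longer matters. -/
theorem walkGF_eq_det (hG : BoundedDegree G) (wt : V → V → K) (p : SimpleCycle G) :
    walkGF wt p =
      PowerSeries.C (p.weight wt) * PowerSeries.X ^ p.1.length *
        (1 + (PowerSeries.X : PowerSeries K) •
          (restrictTo (gpVerts hG p) (resolventGF (edgeMatrix G wt)) *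
            (restrictTo (gpVerts hG p) (touching p (edgeMatrix G wt))).map
              PowerSeries.C)).det := by
  set e := (gpVerts hG p).equivFin.symm
  set N := 1 + (PowerSeries.X : PowerSeries K) •
          (restrictTo (gpVerts hG p) (resolventGF (edgeMatrix G wt)) *
            (restrictTo (gpVerts hG p) (touching p (edgeMatrix G wt))).map
              PowerSeries.C) with hN
  have hR : ∀ i j, formalResolvent G i j ∈ finiteTypeSubring V := finiteType_formalResolvent hG
  have hW : ∀ i j, touching p (labelledMatrix G) i j ∈ finiteTypeSubring V := by
    intro i j
    rw [touching]
    split_ifs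
    · exact finiteType_labelledMatrix i j
    · exact zero_mem _
  set R' : Matrix (gpVerts hG p) (gpVerts hG p) (finiteTypeSubring V) :=
    fun i j => ⟨formalResolvent G i j, hR i j⟩ with hR'
  set W' : Matrix (gpVerts hG p) (gpVerts hG p) (finiteTypeSubring V) :=
    fun i j => ⟨touching p (labelledMatrix G) i j, hW i j⟩ with hW'
  have h1 : (1 + restrictTo (gpVerts hG p) (formalResolvent G) *
        restrictTo (gpVerts hG p) (touching p (labelledMatrix G))).submatrix e e =
      ((1 + R' * W').submatrix e e).map (finiteTypeSubring V).subtype := by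
    rw [← Matrix.submatrix_map, Matrix.map_add _ (map_add _), Matrix.map_mul,
      Matrix.map_one _ (map_zero _) (map_one _)]
    rfl
  have h2 : ((1 + R' * W').submatrix e e).map (evalHom wt) = N.submatrix e e := by
    rw [← Matrix.submatrix_map, Matrix.map_add _ (map_add _), Matrix.map_mul,
      Matrix.map_one _ (map_zero _) (map_one _), hN]
    congr 2
    ext1 i j
    rw [Matrix.smul_apply, Matrix.mul_apply, Matrix.mul_apply, Finset.smul_sum]
    refine Finset.sum_congr rfl fun k _ => ?_
    have h3 : (R'.map (evalHom wt)) i k = resolventGF (edgeMatrix G wt) i k :=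
      evalSeries_formalResolvent hG wt i k
    have h4 : (W'.map (evalHom wt)) k j =
        PowerSeries.C (touching p (edgeMatrix G wt) k j) * PowerSeries.X := by
      change evalSeries wt (touching p (labelledMatrix G) k j) = _
      unfold touching
      split_ifs
      · exact evalSeries_labelledMatrix wt _ _
      · rw [evalSeries_zero]; simp
    rw [h3, h4, smul_eq_mul]
    change _ = PowerSeries.X * (resolventGF (edgeMatrix G wt) i k *
      PowerSeries.C (touching p (edgeMatrix G wt) k j))
    ring
  have h3 : FiniteType (colDet (((1 + R' * W').submatrix e e).map
      (finiteTypeSubring V).subtype)) := by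
    rw [← map_colDet]
    exact (colDet ((1 + R' * W').submatrix e e)).2
  have h4 : evalSeries wt (colDet (((1 + R' * W').submatrix e e).map
      (finiteTypeSubring V).subtype)) = N.det := by
    rw [← map_colDet]
    change evalHom wt (colDet ((1 + R' * W').submatrix e e)) = _
    rw [map_colDet, h2, colDet_eq_det, Matrix.det_submatrix_equiv_self]
  rw [← evalSeries_walkSeries hG, walkSeries_eq_colDet hG p _ e, h1,
    evalSeries_mul wt h3 (FiniteType.single _), h4, evalSeries_single, p.weight_eq, p.length_eq]
  ring

end GeneratingFunctions

theorem mainTheorem5 {V : Type*} [DecidableEq V] {K : Type*} [CommRing K] (G : Digraph V)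
    (hG : BoundedDegree G) (wt : V → V → K) (p : SimpleCycle G) :
    -- the generating function of closed walks whose last erased loop is `p`
    ((∀ n : ℕ, {h : Hike G | h.IsWalkWithLast p ∧ h.length = n}.Finite) ∧
      walkGF wt p =
        PowerSeries.C (p.weight wt) * PowerSeries.X ^ p.1.length *
          (1 + (PowerSeries.X : PowerSeries K) •
            (restrictTo (gpVerts hG p) (resolventGF (edgeMatrix G wt)) *
              (restrictTo (gpVerts hG p) (touching p (edgeMatrix G wt))).map
                PowerSeries.C)).det) ∧
    -- it does not matter from which vertex of `p` the walks are read
    (∀ v ∈ p.1, (∀ n : ℕ, (rootedWalks p v n).Finite) ∧ rootedWalkGF wt p v = walkGF wt p) ∧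
    -- the formal series version
    ((∀ t : EdgeMonoid V, {h : Hike G | h.IsWalkWithLast p ∧ Hike.toEdges h = t}.Finite) ∧
      ∀ (m : ℕ) (e : Fin m ≃ gpVerts hG p),
        walkSeries p =
          colDet ((1 + restrictTo (gpVerts hG p) (formalResolvent G) *
            restrictTo (gpVerts hG p) (touching p (labelledMatrix G))).submatrix e e) *
          TraceSeries.single p.toEdges) := 
  ⟨⟨finite_walkHikes hG p, walkGF_eq_det hG wt p⟩,
    fun v hv => ⟨finite_rootedWalks hG p v, rootedWalkGF_eq wt p hv⟩,
    Hike.finite_toEdges_eq _, walkSeries_eq_colDet hG p⟩
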